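/- Let $K\ge 1$, $\alpha>2$, $N_0\ge 0$, let $P_1,\dots,P_K$, $P_U$, $P_J$, $\lambda_1,\dots,\lambda_K$, $\lambda_E$, $\lambda_J$, $\theta_s$, $\tau$ be positive reals, and put $R_\tau=(P_J/\tau)^{1/\alpha}$. In the plane $\mathbb{R}^2$, base stations (BSs) of tier $t\in\{1,\dots,K\}$ form a homogeneous Poisson point process (PPP) of density $\lambda_t$, and eavesdroppers $e_0,e_1,\dots$ form a PPP of density $\lambda_E$. A transmitter at $x$ of power $P$ is received at $y$ with power $P\,h\,\|x-y\|^{-\alpha}$, where $h$ is a unit-mean exponential fading gain. The typical user, at the origin, is served by the BS $b_0$ with the largest $P_t\|b\|^{-\alpha}$ among all BSs $b$ ($t$ being the tier of $b$); $P_{b_0}$ is its power. Correlations are ignored, which means the following: each eavesdropper $e_i$ has its own, independent, interference environment, consisting of * interfering BSs, for every tier $t$ a PPP of density $\lambda_t$ and power $P_t$, with total received power $I'_B$ at $e_i$; * interfering scheduled users, for every tier $t$ a PPP of density $\lambda_t$ and power $P_U$, with total received power $I'_U$ at $e_i$; * active jammers of power $P_J$, with total received power $I'_J$ at $e_i$: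 the points of a PPP of density $\lambda_J$ outside the open disc of radius $R_\tau$ (the hole) around that point $x$ which is closest to $e_i$ in the union, over the tiers $t$, of further PPPs of densities $\lambda_t$ (only the closest hole is kept). All these PPPs (including the $K$ BS processes that serve the typical user and the process of eavesdroppers) and all fading gains are mutually independent. Let $$\mathrm{SINR}_E(e_i)=\frac{P_{b_0}h_i\|b_0-e_i\|^{-\alpha}}{I'_B+I'_U+I'_J+N_0},\qquad \mathcal P_s(\theta_s,\tau)=\mathbb P\Big(\bigcap_i\{\mathrm{SINR}_E(e_i)<\theta_s\}\Big).$$ Then the serving BS is in tier $k$ with probability $\mathcal A_k=\lambda_kP_k^{2/\alpha}/\sum_t\lambda_tP_t^{2/\alpha}$; for every $s>0$ the Laplace transforms $\mathcal L_I(s)=\mathbb E[e^{-sI}]$ of the interferences at each eavesdropper are, with $\mathrm{sinc}(x)=\sin(\pi x)/(\pi x)$ and $\lambda_U^{s'}=\sum_t\lambda_t$, $$\mathcal L_{I'_B}(s)=\exp\Big(-\frac{\pi s^{2/\alpha}\sum_t\lambda_tP_t^{2/\alpha}}{\mathrm{sinc}(2/\alpha)}\Big),\qquad \mathcal L_{I'_U}(s)=\exp\Big(-\frac{\pi\lambda_U^{s'}(sP_U)^{2/\alpha}}{\mathrm{sinc}(2/\alpha)}\Big),$$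 $$\mathcal L_{I'_J}(s)=\exp\Big(-\frac{\pi\lambda_J(sP_J)^{2/\alpha}}{\mathrm{sinc}(2/\alpha)}\Big)\int_0^\infty G(v,s)\,2\pi\lambda_U^{s'}e^{-\pi\lambda_U^{s'}v^2}v\,dv,$$ where, with $\lambda_J'(y)=\lambda_J\arccos\frac{y^2+v^2-R_\tau^2}{2yv}$, $$G(v,s)=\begin{cases}\exp\Big(\int_{v-R_\tau}^{v+R_\tau}\frac{2y\lambda_J'(y)}{1+y^\alpha/(sP_J)}dy\Big),& v>R_\tau,\\[1ex]\exp\Big(\pi\lambda_J(R_\tau-v)^2\,{}_2F_1\big(1,\tfrac2\alpha;1+\tfrac2\alpha;-\tfrac{(R_\tau-v)^\alpha}{sP_J}\big)\Big)\exp\Big(\int_{R_\tau-v}^{R_\tau+v}\frac{2y\lambda_J'(y)}{1+y^\alpha/(sP_J)}dy\Big),& v\le R_\tau,\end{cases}$$ and ${}_2F_1$ is the (analytically continued) Gauss hypergeometric function; and, with $\gamma_k(r)=\theta_sr^\alpha/P_k$, $$\mathcal P_s(\theta_s,\tau)=\sum_{k=1}^K\mathcal A_k\exp\Big(-2\pi\lambda_E\int_0^\infty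 e^{-N_0\gamma_k(r)}\mathcal L_{I'_B}(\gamma_k(r))\,\mathcal L_{I'_U}(\gamma_k(r))\,\mathcal L_{I'_J}(\gamma_k(r))\,r\,dr\Big),$$ all the integrals over $(0,\infty)$ being finite. -/

import Mathlib

open MeasureTheory ProbabilityTheory Set
open scoped ENNReal NNReal

noncomputable section

namespace HetNet

/-- The plane, with its Euclidean norm. -/
abbrev Plane : Type := EuclideanSpace ℝ (Fin 2)

/-- A sequence `X` of random points is (an enumeration of) a Poisson point process with intensity
measure `Λ`: the number of points in a measurable set of finite intensity is Poisson distributed,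
and the numbers of points in disjoint such sets are independent. -/
structure IsPoissonProcess {Ω E : Type*} [MeasurableSpace Ω] [MeasurableSpace E]
    (X : Ω → ℕ → E) (Λ : Measure E) (μ : Measure Ω) : Prop where
  measurable : Measurable X
  count_law : ∀ B : Set E, MeasurableSet B → Λ B ≠ ∞ → ∀ n : ℕ,
    μ {ω | {j : ℕ | X ω j ∈ B}.encard = n} = poissonMeasure (Λ B).toNNReal {n}
  count_indep : ∀ (m : ℕ) (B : Fin m → Set E), (∀ i, MeasurableSet (B i)) →
    (∀ i, Λ (B i) ≠ ∞) → Pairwise (fun i j => Disjoint (B i) (B j)) →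
    iIndepFun (fun i ω => {j : ℕ | X ω j ∈ B i}.encard) μ

/-- Homogeneous Poisson point process of density `lam` in the plane. -/
def IsHomogeneousPPP {Ω : Type*} [MeasurableSpace Ω]
    (X : Ω → ℕ → Plane) (lam : ℝ) (μ : Measure Ω) : Prop :=
  IsPoissonProcess X (ENNReal.ofReal lam • (volume : Measure Plane)) μ

/-- The parameters of a `K`-tier network. -/
structure Params (K : ℕ) where
  /-- densities of the base stations of each tier -/
  lamB : Fin K → ℝ
  /-- transmit powers of the base stations of each tier -/
  powB : Fin K → ℝ
  /-- density of the eavesdroppers -/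
  lamE : ℝ
  /-- density of the jammers -/
  lamJ : ℝ
  /-- transmit power of the (full-duplex) users -/
  powU : ℝ
  /-- transmit power of the jammers -/
  powJ : ℝ
  /-- path loss exponent -/
  α : ℝ
  /-- thermal noise -/
  noise : ℝ
  lamB_pos : ∀ t, 0 < lamB t
  powB_pos : ∀ t, 0 < powB t
  lamE_pos : 0 < lamE
  lamJ_pos : 0 < lamJ
  powU_pos : 0 < powU
  powJ_pos : 0 < powJ
  two_lt_α : 2 < α
  noise_nonneg : 0 ≤ noise

/-! ### The random objects -/

/-- Labels of the point processes. The index `i` is that of an eavesdropper: ignoring correlations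
means that every eavesdropper sees its own independent copy of each interfering process, and that
the copy of the scheduled users that radiate is independent of the copy that carves the hole. -/
inductive PointLabel (K : ℕ) : Type
  /-- the base stations of tier `t`, to one of which the typical user is associated -/
  | station (t : Fin K)
  /-- the eavesdroppers -/
  | eavesdropper
  /-- the interfering base stations of tier `t`, as seen by eavesdropper `i` -/
  | intStation (i : ℕ) (t : Fin K)
  /-- the scheduled users of tier `t` that interfere with eavesdropper `i` -/
  | intUser (i : ℕ) (t : Fin K)
  /-- the scheduled users of tier `t` in their role as centres of holes, for eavesdropper `i` -/
  | hole (i : ℕ) (t : Fin K)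
  /-- the jammers, as seen by eavesdropper `i` -/
  | jammer (i : ℕ)

/-- Labels of the fading gains, all of them gains of channels ending at eavesdropper `i`. -/
inductive FadeLabel (K : ℕ) : Type
  /-- from the tagged base station -/
  | signal (i : ℕ)
  /-- from the `n`-th interfering base station of tier `t` -/
  | station (i : ℕ) (t : Fin K) (n : ℕ)
  /-- from the `n`-th interfering scheduled user of tier `t` -/
  | user (i : ℕ) (t : Fin K) (n : ℕ)
  /-- from the `n`-th jammer -/
  | jammer (i : ℕ) (n : ℕ)

namespace Params

variable {K : ℕ} (p : Params K)

/-- The density of each point process: one scheduled user per base station. -/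
def density : PointLabel K → ℝ
  | .station t => p.lamB t
  | .eavesdropper => p.lamE
  | .intStation _ t => p.lamB t
  | .intUser _ t => p.lamB t
  | .hole _ t => p.lamB t
  | .jammer _ => p.lamJ

/-- The network: independent homogeneous Poisson processes `X` and independent Rayleigh fading
(unit exponential gains) `h`, independent of all the locations. -/
structure IsNetwork {Ω : Type*} [MeasurableSpace Ω] (μ : Measure Ω)
    (X : PointLabel K → Ω → ℕ → Plane) (h : FadeLabel K → Ω → ℝ) : Prop where
  poisson : ∀ a, IsHomogeneousPPP (X a) (p.density a) μ
  points_indep : iIndepFun X μ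
  fade_measurable : ∀ b, Measurable (h b)
  fade_law : ∀ b, μ.map (h b) = expMeasure 1
  fade_indep : iIndepFun h μ
  points_fade_indep : IndepFun (fun ω a => X a ω) (fun ω b => h b ω) μ

/-- Power received at `e` from a source at `x` with transmit power `P` and fading gain `g`. -/
def rxPower (P g : ℝ) (x e : Plane) : ℝ≥0∞ :=
  ENNReal.ofReal (P * g) * edist x e ^ (-p.α)

/-- Radius of the guard zones for the jammer selection threshold `τ`. -/
def guardRadius (τ : ℝ) : ℝ := (p.powJ / τ) ^ (1 / p.α)

section Random

variable {Ω : Type*} (X : PointLabel K → Ω → ℕ → Plane) (h : FadeLabel K → Ω → ℝ)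

/-- The typical user at the origin is served by the `n`-th base station of tier `k`: no base
station has a larger average received power. -/
def IsServing (ω : Ω) (k : Fin K) (n : ℕ) : Prop :=
  ∀ (t : Fin K) (m : ℕ), p.rxPower (p.powB t) 1 (X (.station t) ω m) 0
    ≤ p.rxPower (p.powB k) 1 (X (.station k) ω n) 0

/-- Interference at eavesdropper `i` from the base stations. -/
def intfB (i : ℕ) (ω : Ω) : ℝ≥0∞ :=
  ∑ t : Fin K, ∑' n : ℕ, p.rxPower (p.powB t) (h (.station i t n) ω)
    (X (.intStation i t) ω n) (X .eavesdropper ω i)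

/-- Interference at eavesdropper `i` from the scheduled users. -/
def intfU (i : ℕ) (ω : Ω) : ℝ≥0∞ :=
  ∑ t : Fin K, ∑' n : ℕ, p.rxPower p.powU (h (.user i t n) ω)
    (X (.intUser i t) ω n) (X .eavesdropper ω i)

/-- The `m`-th scheduled user of tier `t` is the centre of the hole closest to eavesdropper `i`. -/
def IsClosestHole (i : ℕ) (ω : Ω) (t : Fin K) (m : ℕ) : Prop :=
  ∀ (t' : Fin K) (m' : ℕ), dist (X (.hole i t) ω m) (X .eavesdropper ω i)
    ≤ dist (X (.hole i t') ω m') (X .eavesdropper ω i)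

/-- The active jammers seen by eavesdropper `i`, where only the closest hole is carved out. -/
def activeJammers (τ : ℝ) (i : ℕ) (ω : Ω) : Set ℕ :=
  {n | ∀ (t : Fin K) (m : ℕ), IsClosestHole X i ω t m →
    X (.jammer i) ω n ∉ Metric.ball (X (.hole i t) ω m) (p.guardRadius τ)}

/-- Interference at eavesdropper `i` from the active jammers. -/
def intfJ (τ : ℝ) (i : ℕ) (ω : Ω) : ℝ≥0∞ :=
  ∑' n : p.activeJammers X τ i ω, p.rxPower p.powJ (h (.jammer i n) ω)
    (X (.jammer i) ω n) (X .eavesdropper ω i)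

/-- SINR at eavesdropper `i` if the tagged base station is the `n`-th one of tier `k`. -/
def sinrE (τ : ℝ) (k : Fin K) (n i : ℕ) (ω : Ω) : ℝ≥0∞ :=
  p.rxPower (p.powB k) (h (.signal i) ω) (X (.station k) ω n) (X .eavesdropper ω i) /
    (p.intfB X h i ω + p.intfU X h i ω + p.intfJ X h τ i ω + ENNReal.ofReal p.noise)

/-- The event that the typical user is served by a base station of tier `k`. -/
def associated (k : Fin K) : Set Ω := {ω | ∃ n, p.IsServing X ω k n}

/-- The event that no eavesdropper reaches the SINR `θ`. -/
def secrecyEvent (θ τ : ℝ) : Set Ω :=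
  {ω | ∃ k n, p.IsServing X ω k n ∧ ∀ i, p.sinrE X h τ k n i ω < ENNReal.ofReal θ}

end Random

/-! ### The closed-form expressions -/

/-- Association probability of tier `k`. -/
def assocProb (k : Fin K) : ℝ :=
  p.lamB k * p.powB k ^ (2 / p.α) / ∑ t, p.lamB t * p.powB t ^ (2 / p.α)

/-- Density of all the scheduled users. -/
def lamS : ℝ := ∑ t, p.lamB t

end Params

/-- The normalized cardinal sine `sin (π x) / (π x)`. -/
def nsinc (x : ℝ) : ℝ := Real.sinc (Real.pi * x)

/-- Gauss' hypergeometric function through Euler's integral, which for `0 < b < c` gives it at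
every real `z < 1` (the power series converges only for `|z| < 1`). -/
def gaussHG (a b c z : ℝ) : ℝ :=
  Real.Gamma c / (Real.Gamma b * Real.Gamma (c - b)) *
    ∫ t in (0 : ℝ)..1, t ^ (b - 1) * (1 - t) ^ (c - b - 1) * (1 - z * t) ^ (-a)

namespace Params

variable {K : ℕ} (p : Params K)

def lapB (s : ℝ) : ℝ :=
  Real.exp (-(Real.pi * s ^ (2 / p.α) * ∑ t, p.lamB t * p.powB t ^ (2 / p.α)) / nsinc (2 / p.α))

def lapU (s : ℝ) : ℝ :=
  Real.exp (-(Real.pi * p.lamS * (s * p.powU) ^ (2 / p.α)) / nsinc (2 / p.α))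

/-- `λ_J'(y)`; it depends on the distance `v` to the centre of the hole. -/
def lamJ' (τ v y : ℝ) : ℝ :=
  p.lamJ * Real.arccos ((y ^ 2 + v ^ 2 - p.guardRadius τ ^ 2) / (2 * y * v))

def G (τ v s : ℝ) : ℝ :=
  if p.guardRadius τ < v then
    Real.exp (∫ y in (v - p.guardRadius τ)..(v + p.guardRadius τ),
      2 * y * p.lamJ' τ v y / (1 + y ^ p.α / (s * p.powJ)))
  else
    Real.exp (Real.pi * p.lamJ * (p.guardRadius τ - v) ^ 2 *
      gaussHG 1 (2 / p.α) (1 + 2 / p.α)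
        (-((p.guardRadius τ - v) ^ p.α / (s * p.powJ)))) *
    Real.exp (∫ y in (p.guardRadius τ - v)..(p.guardRadius τ + v),
      2 * y * p.lamJ' τ v y / (1 + y ^ p.α / (s * p.powJ)))

/-- The integrand `G(v, s) g(v)`, with `g` the density of the distance to the closest hole. -/
def lapJIntegrand (τ s v : ℝ) : ℝ :=
  p.G τ v s * (2 * Real.pi * p.lamS * Real.exp (-(Real.pi * p.lamS * v ^ 2)) * v)

def lapJ (τ s : ℝ) : ℝ :=
  Real.exp (-(Real.pi * p.lamJ * (s * p.powJ) ^ (2 / p.α)) / nsinc (2 / p.α)) *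
    ∫ v in Ioi (0 : ℝ), p.lapJIntegrand τ s v

def gam (θ : ℝ) (k : Fin K) (r : ℝ) : ℝ := θ * r ^ p.α / p.powB k

def secrecyIntegrand (θ τ : ℝ) (k : Fin K) (r : ℝ) : ℝ :=
  Real.exp (-(p.noise * p.gam θ k r)) * p.lapB (p.gam θ k r) * p.lapU (p.gam θ k r) *
    p.lapJ τ (p.gam θ k r) * r

end Params

/-- Laplace transform `E[exp(-s I)]` of a nonnegative random variable, where `exp(-∞) = 0`. -/
def laplace {Ω : Type*} [MeasurableSpace Ω] (μ : Measure Ω) (I : Ω → ℝ≥0∞) (s : ℝ) : ℝ :=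
  ∫ ω, (if I ω = ∞ then 0 else Real.exp (-(s * (I ω).toReal))) ∂μ

end HetNet

end

noncomputable section

namespace HetNet

open Filter Topology

/-! ### The function `exp (-x)` on `[0, ∞]` -/

/-! Everything is computed through Laplace functionals. A Poisson process with σ-finite intensity
`Λ` satisfies `E exp(-∑ g(X_j)) = exp(-∫ (1 - e^{-g}) dΛ)` for all measurable `g` with values in
`[0, ∞]` (`IsPoissonProcess.hasPoissonLaplace`); the laws of the counts enter only there. Since
`expNeg ∞ = 0`, taking `g = ∞` on a set gives void probabilities, and `g = -log(1 - q)` gives the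
probability that no point succeeds, when a point at `x` succeeds independently with probability `q
x`.

Interference at a fixed location `e`: an exponential gain has Laplace transform `1 / (1 + c)`, so a
shot noise has exponent `∫ 1 / (1 + ‖x - e‖^α / q)` against the intensity
(`HasPoissonLaplace.shot_noise`). Over the plane, Gamma integrals and the reflection formula
evaluate it (`lintegral_pathKernel`). For the jammers, freeze the hole centres: the disc around the
closest centre, at distance `v`, is removed from the integral, which multiplies the Laplace
transform by the exponential of the disc integral, and this factor is `G(v, s)` (`Params.G_eq_exp`).
Averaging over `v` gives `lapJ`.

Nearest-point questions are moved to the half-line. Squared distances, scaled by `P_t^{-2/α}` for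
the stations, form a Poisson process of constant rate, the rates of independent processes add up,
and such a process has a unique first point, exponentially distributed
(`HasPoissonLaplace.ae_exists_min`, `HasPoissonLaplace.lintegral_iInf`). This yields the law of the
closest hole, the uniqueness of the serving station, and, through competing exponentials, the
association probabilities (`measure_associated`).

Secrecy: for a serving station of tier `k` at `b`, the signal gain is exponential and independent of
the interference, so an eavesdropper at distance `r` reaches the threshold with probability equal to
the noise factor times the three Laplace transforms at `γ_k(r)` (`measure_le_sinrAt`). Given their
locations, the eavesdroppers act independently, because their environments are disjoint blocks of
independent objects; the Laplace functional of their process gives `exp(-λ_E ∫ q)`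
(`measure_sinrAt_lt`). The result depends on `b` only through its tier, so averaging over the
stations produces the weighted sum (`measure_secrecyEvent`). All conditioning is done by
`lintegral_resample`: part of the randomness is frozen, and the rest is replaced by an independent
copy. -/

/-- `exp (-x)` on `[0, ∞]`. -/
def expNeg (x : ℝ≥0∞) : ℝ≥0∞ := EReal.exp (-(x : EReal))

/-- `-log y` on `[0, 1]`, the inverse of `expNeg`. -/
def negLog (y : ℝ≥0∞) : ℝ≥0∞ := (-(ENNReal.log y)).toENNReal

@[simp] lemma expNeg_zero : expNeg 0 = 1 := by simp [expNeg]

@[simp] lemma expNeg_top : expNeg ∞ = 0 := by simp [expNeg]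

lemma expNeg_ofReal {x : ℝ} (hx : 0 ≤ x) :
    expNeg (ENNReal.ofReal x) = ENNReal.ofReal (Real.exp (-x)) := by
  rw [expNeg, EReal.coe_ennreal_ofReal, max_eq_left hx, ← EReal.coe_neg, EReal.exp_coe]

lemma expNeg_of_ne_top {x : ℝ≥0∞} (hx : x ≠ ∞) :
    expNeg x = ENNReal.ofReal (Real.exp (-x.toReal)) := by
  conv_lhs => rw [← ENNReal.ofReal_toReal hx]
  exact expNeg_ofReal ENNReal.toReal_nonneg

lemma expNeg_add (x y : ℝ≥0∞) : expNeg (x + y) = expNeg x * expNeg y := by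
  rw [expNeg, EReal.coe_ennreal_add, EReal.neg_add (Or.inl (EReal.coe_ennreal_ne_bot x))
    (Or.inr (EReal.coe_ennreal_ne_bot y)), sub_eq_add_neg, EReal.exp_add]
  rfl

lemma expNeg_sum {ι : Type*} (s : Finset ι) (a : ι → ℝ≥0∞) :
    expNeg (∑ i ∈ s, a i) = ∏ i ∈ s, expNeg (a i) := by
  classical
  induction s using Finset.induction_on with
  | empty => simp
  | insert i s hi ih => rw [Finset.sum_insert hi, Finset.prod_insert hi, expNeg_add, ih]

lemma expNeg_strictAnti : StrictAnti expNeg := fun _ _ h =>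
  EReal.exp_strictMono (EReal.neg_lt_neg_iff.2 (EReal.coe_ennreal_lt_coe_ennreal_iff.2 h))

lemma expNeg_le_one (x : ℝ≥0∞) : expNeg x ≤ 1 := by
  rw [← expNeg_zero]; exact expNeg_strictAnti.antitone zero_le

lemma expNeg_ne_top (x : ℝ≥0∞) : expNeg x ≠ ∞ := ((expNeg_le_one x).trans_lt ENNReal.one_lt_top).ne

lemma continuous_expNeg : Continuous expNeg :=
  ENNReal.continuous_exp.comp (continuous_neg.comp continuous_coe_ennreal_ereal)

@[fun_prop]
lemma measurable_expNeg : Measurable expNeg := continuous_expNeg.measurable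

@[fun_prop]
lemma measurable_negLog : Measurable negLog :=
  measurable_ereal_toENNReal.comp (continuous_neg.measurable.comp ENNReal.measurable_log)

/-- Writes a factor in `[0, 1]` as an exponential, so that a product over the points of a process
becomes `expNeg` of a sum, to which a Laplace functional applies. -/
lemma expNeg_negLog {y : ℝ≥0∞} (hy : y ≤ 1) : expNeg (negLog y) = y := by
  rw [expNeg, negLog, EReal.coe_toENNReal, neg_neg, ENNReal.exp_log]
  rw [EReal.neg_nonneg]
  exact ENNReal.log_le_zero_iff.2 hy

lemma one_sub_expNeg_le (x : ℝ≥0∞) : 1 - expNeg x ≤ x := by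
  by_cases hx : x = ∞
  · simp [hx]
  rw [expNeg_of_ne_top hx]
  conv_rhs => rw [← ENNReal.ofReal_toReal hx]
  rw [← ENNReal.ofReal_one, ← ENNReal.ofReal_sub _ (Real.exp_pos _).le]
  apply ENNReal.ofReal_le_ofReal
  linarith [Real.add_one_le_exp (-x.toReal)]

lemma tendsto_prod_expNeg {ι : Type*} (a : ι → ℝ≥0∞) :
    Tendsto (fun s : Finset ι => ∏ i ∈ s, expNeg (a i)) atTop (𝓝 (expNeg (∑' i, a i))) := by
  simp_rw [← expNeg_sum]
  exact (continuous_expNeg.tendsto _).comp ENNReal.summable.hasSum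

lemma measurable_expNeg_tsum {Ω ι : Type*} [MeasurableSpace Ω] [Countable ι]
    {ξ : ι → Ω → ℝ≥0∞} (hm : ∀ i, Measurable (ξ i)) :
    Measurable fun ω => expNeg (∑' i, ξ i ω) :=
  measurable_expNeg.comp (Measurable.tsum hm)

/-- The Laplace transform of a countable sum of independent variables is a product. -/
lemma lintegral_expNeg_tsum {Ω ι : Type*} [MeasurableSpace Ω] {μ : Measure Ω}
    [IsProbabilityMeasure μ] [Countable ι] {ξ : ι → Ω → ℝ≥0∞} (hm : ∀ i, Measurable (ξ i))
    (hi : iIndepFun ξ μ) {c : ι → ℝ≥0∞} (hc : ∀ i, ∫⁻ ω, expNeg (ξ i ω) ∂μ = expNeg (c i)) :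
    ∫⁻ ω, expNeg (∑' i, ξ i ω) ∂μ = expNeg (∑' i, c i) := by
  -- Finite partial products are bounded by `1` and converge, so dominated convergence passes from
  -- finite to countable independence. The filter on finsets is countably generated because `ι` is
  -- countable.
  have h1 : Tendsto (fun s : Finset ι => ∫⁻ ω, ∏ i ∈ s, expNeg (ξ i ω) ∂μ) atTop
      (𝓝 (∫⁻ ω, expNeg (∑' i, ξ i ω) ∂μ)) := by
    refine tendsto_lintegral_filter_of_dominated_convergence (fun _ => 1) ?_ ?_ (by simp) ?_
    · exact Eventually.of_forall fun s =>
        Finset.measurable_prod s fun i _ => measurable_expNeg.comp (hm i)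
    · exact Eventually.of_forall fun s => ae_of_all _ fun ω =>
        Finset.prod_le_one' fun i _ => expNeg_le_one _
    · exact ae_of_all _ fun ω => tendsto_prod_expNeg _
  refine tendsto_nhds_unique h1 ?_
  convert tendsto_prod_expNeg c using 2 with s
  rw [lintegral_prod_eq_prod_lintegral_of_indepFun s (fun i ω => expNeg (ξ i ω))
    (hi.comp (fun _ => expNeg) fun _ => measurable_expNeg)
    fun i => measurable_expNeg.comp (hm i)]
  exact Finset.prod_congr rfl fun i _ => hc i

/-- Encoding an event by the weight `∞` on its complement turns intersections of events into sums of
weights. -/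
lemma measure_eq_lintegral_expNeg_indicator {Ω : Type*} [MeasurableSpace Ω] {μ : Measure Ω}
    {A : Set Ω} (hA : MeasurableSet A) :
    μ A = ∫⁻ ω, expNeg (Aᶜ.indicator (fun _ => ∞) ω) ∂μ := by
  rw [← lintegral_indicator_one hA]
  congr 1 with ω
  by_cases h : ω ∈ A <;> simp [h]

/-! ### Laplace functionals of point processes -/

/-- `Y` has the Laplace functional of a Poisson process with intensity measure `Λ`. -/
structure HasPoissonLaplace {Ω E ι : Type*} [MeasurableSpace Ω] [MeasurableSpace E]
    (Y : ι → Ω → E) (Λ : Measure E) (μ : Measure Ω) : Prop where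
  measurable : ∀ i, Measurable (Y i)
  laplace : ∀ g : E → ℝ≥0∞, Measurable g →
    ∫⁻ ω, expNeg (∑' i, g (Y i ω)) ∂μ = expNeg (∫⁻ x, (1 - expNeg (g x)) ∂Λ)

lemma tsum_indicator_const {E : Type*} (X : ℕ → E) (B : Set E) (c : ℝ≥0∞) :
    ∑' j, B.indicator (fun _ => c) (X j) = c * ({j | X j ∈ B}.encard : ℝ≥0∞) := by
  rw [← ENNReal.tsum_set_one, ← ENNReal.tsum_mul_left, tsum_subtype {j | X j ∈ B} fun _ => c * 1]
  congr 1 with j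
  rw [mul_one]
  rfl

lemma measurable_encard {Ω E : Type*} [MeasurableSpace Ω] [MeasurableSpace E]
    {X : Ω → ℕ → E} (hX : Measurable X) {B : Set E} (hB : MeasurableSet B) :
    Measurable fun ω => {j | X ω j ∈ B}.encard := by
  have h1 : Measurable fun ω => ({j | X ω j ∈ B}.encard : ℝ≥0∞) := by
    have h := fun ω => tsum_indicator_const (X ω) B 1
    simp only [one_mul] at h
    simp_rw [← h]
    exact Measurable.tsum fun j =>
      (measurable_const.indicator hB).comp ((measurable_pi_apply j).comp hX)
  refine measurable_to_countable' fun n => ?_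
  have : (fun ω => {j | X ω j ∈ B}.encard) ⁻¹' {n}
      = (fun ω => ({j | X ω j ∈ B}.encard : ℝ≥0∞)) ⁻¹' {(n : ℝ≥0∞)} := by
    ext ω; simp
  rw [this]
  exact h1 (measurableSet_singleton _)

/-- This is the generating function of the Poisson law at `z = e^{-c}`, with `c = ∞`, that is `z =
0`, allowed. -/
lemma lintegral_expNeg_mul_poisson {Ω : Type*} [MeasurableSpace Ω] {μ : Measure Ω}
    [IsProbabilityMeasure μ] {N : Ω → ℕ∞} (hN : Measurable N) {l : ℝ≥0}
    (hl : ∀ n : ℕ, μ {ω | N ω = n} = poissonMeasure l {n}) (c : ℝ≥0∞) :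
    ∫⁻ ω, expNeg (c * (N ω : ℝ≥0∞)) ∂μ = expNeg (l * (1 - expNeg c)) := by
  rcases eq_or_ne c 0 with rfl | hc
  · simp
  have h1 : ∫⁻ ω, expNeg (c * (N ω : ℝ≥0∞)) ∂μ
      = ∫⁻ n, expNeg (c * (n : ℝ≥0∞)) ∂(μ.map N) := by
    rw [lintegral_map (measurable_of_countable _) hN]
  -- For `c ≠ 0` the integrand vanishes at the count `⊤`, so the sum reduces to `ℕ` without a
  -- separate proof that the count is almost surely finite.
  rw [h1, lintegral_countable', ← Function.Injective.tsum_eq (g := ((↑) : ℕ → ℕ∞))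
    Nat.cast_injective]
  swap
  · intro n hn
    induction n using ENat.recTopCoe with
    | top => simp [hc] at hn
    | coe n => exact ⟨n, rfl⟩
  set e := (expNeg c).toReal with he
  have hec : expNeg c = ENNReal.ofReal e := (ENNReal.ofReal_toReal (expNeg_ne_top c)).symm
  have he1 : e ≤ 1 := ENNReal.toReal_le_of_le_ofReal zero_le_one (by simpa using expNeg_le_one c)
  have he0 : 0 ≤ e := ENNReal.toReal_nonneg
  have hpow : ∀ n : ℕ, expNeg (c * ((n : ℕ∞) : ℝ≥0∞)) = ENNReal.ofReal (e ^ n) := by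
    intro n
    have : c * ((n : ℕ∞) : ℝ≥0∞) = ∑ _i ∈ Finset.range n, c := by simp [mul_comm]
    rw [this, expNeg_sum, Finset.prod_const, Finset.card_range, hec, ENNReal.ofReal_pow he0]
  -- Splitting `e^{-l} = e^{-l(1-e)} e^{-le}` makes the terms a constant times the Poisson weights
  -- of parameter `l e`, which sum to `1`.
  have hterm : ∀ n : ℕ, expNeg (c * ((n : ℕ∞) : ℝ≥0∞)) * (μ.map N) {(n : ℕ∞)}
      = ENNReal.ofReal (Real.exp (-(l * (1 - e))) *
        (Real.exp (-(l * e)) * (l * e) ^ n / n.factorial)) := by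
    intro n
    rw [Measure.map_apply hN (measurableSet_singleton _), hpow]
    have := hl n
    rw [show N ⁻¹' {(n : ℕ∞)} = {ω | N ω = n} from rfl, this, poissonMeasure_singleton,
      ← ENNReal.ofReal_mul (by positivity)]
    congr 1
    rw [show -(l : ℝ) = -(l * (1 - e)) + -(l * e) by ring, Real.exp_add, mul_pow]
    ring
  simp_rw [hterm]
  have hs := (hasSum_one_poissonMeasure (l * ⟨e, he0⟩)).mul_left (Real.exp (-(l * (1 - e))))
  have hle : ((l * ⟨e, he0⟩ : ℝ≥0) : ℝ) = l * e := rfl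
  simp only [hle, mul_one] at hs
  rw [← ENNReal.ofReal_tsum_of_nonneg (fun n => by positivity) hs.summable, hs.tsum_eq,
    ← expNeg_ofReal (mul_nonneg l.coe_nonneg (by linarith)), ENNReal.ofReal_mul l.coe_nonneg, hec,
    ENNReal.ofReal_sub _ he0]
  simp

/-- Inside `S` the level sets of `f` are finitely many disjoint sets of finite intensity. Their
counts are independent and Poisson, so the Laplace transform is a finite product of generating
functions. -/
lemma IsPoissonProcess.laplace_simple {Ω E : Type*} [MeasurableSpace Ω] [MeasurableSpace E]
    {X : Ω → ℕ → E} {Λ : Measure E} {μ : Measure Ω} [IsProbabilityMeasure μ]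
    (hX : IsPoissonProcess X Λ μ) (f : SimpleFunc E ℝ≥0∞) {S : Set E} (hS : MeasurableSet S)
    (hS' : Λ S ≠ ∞) :
    ∫⁻ ω, expNeg (∑' j, S.indicator f (X ω j)) ∂μ
      = expNeg (∫⁻ x, (1 - expNeg (S.indicator f x)) ∂Λ) := by
  let B : Fin f.range.card → Set E := fun i => f ⁻¹' {(f.range.equivFin.symm i : ℝ≥0∞)} ∩ S
  have hB : ∀ i, MeasurableSet (B i) := fun i => (f.measurableSet_preimage _).inter hS
  have hBf : ∀ i, Λ (B i) ≠ ∞ := fun i => measure_ne_top_of_subset inter_subset_right hS'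
  have hd : Pairwise fun i j => Disjoint (B i) (B j) := by
    intro i j hij
    refine disjoint_left.2 fun x hx hx' => hij ?_
    exact f.range.equivFin.symm.injective (Subtype.ext (hx.1.symm.trans hx'.1))
  -- Used for `φ = id` on the side of the points and for `φ y = 1 - expNeg y` on the side of the
  -- intensity.
  have hsum : ∀ (φ : ℝ≥0∞ → ℝ≥0∞), φ 0 = 0 → ∀ x, φ (S.indicator f x)
      = ∑ i, (B i).indicator (fun _ => φ (f.range.equivFin.symm i : ℝ≥0∞)) x := by
    intro φ hφ x
    by_cases hx : x ∈ S
    · rw [Finset.sum_eq_single (f.range.equivFin ⟨f x, f.mem_range_self x⟩)]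
      · simp [B, hx]
      · intro i _ hi
        rw [indicator_of_notMem]
        rintro ⟨hxi, -⟩
        apply hi
        exact f.range.equivFin.symm_apply_eq.1 (Subtype.ext hxi.symm)
      · simp
    · simp [B, hx, hφ]
  have h1 : ∀ ω, ∑' j, S.indicator f (X ω j) = ∑' i, (f.range.equivFin.symm i : ℝ≥0∞) *
      ({j | X ω j ∈ B i}.encard : ℝ≥0∞) := by
    intro ω
    rw [tsum_fintype (L := .unconditional _) (β := Fin f.range.card)]
    simp_rw [← tsum_indicator_const]
    rw [← Summable.tsum_finsetSum fun i _ => ENNReal.summable]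
    exact tsum_congr fun j => hsum id rfl _
  have hind := hX.count_indep _ B hB hBf hd
  have hNm : ∀ i, Measurable fun ω => {j | X ω j ∈ B i}.encard := fun i =>
    measurable_encard hX.measurable (hB i)
  simp_rw [h1]
  rw [lintegral_expNeg_tsum (c := fun i => ((Λ (B i)).toNNReal : ℝ≥0∞) *
    (1 - expNeg (f.range.equivFin.symm i : ℝ≥0∞)))]
  · congr 1
    simp_rw [hsum (fun y => 1 - expNeg y) (by simp)]
    rw [lintegral_finsetSum _ fun i _ => measurable_const.indicator (hB i), tsum_fintype]
    refine Finset.sum_congr rfl fun i _ => ?_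
    rw [lintegral_indicator_const (hB i), ENNReal.coe_toNNReal (hBf i), mul_comm]
  · exact fun i => (measurable_of_countable (fun n : ℕ∞ =>
      (f.range.equivFin.symm i : ℝ≥0∞) * (n : ℝ≥0∞))).comp (hNm i)
  · exact hind.comp (fun i (n : ℕ∞) => (f.range.equivFin.symm i : ℝ≥0∞) * (n : ℝ≥0∞))
      fun i => measurable_of_countable _
  · exact fun i => lintegral_expNeg_mul_poisson (hNm i)
      (fun n => hX.count_law _ (hB i) (hBf i) n) _

/-- The Laplace functional of a Poisson process. -/
lemma IsPoissonProcess.hasPoissonLaplace {Ω E : Type*} [MeasurableSpace Ω] [MeasurableSpace E]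
    {X : Ω → ℕ → E} {Λ : Measure E} [SigmaFinite Λ] {μ : Measure Ω} [IsProbabilityMeasure μ]
    (hX : IsPoissonProcess X Λ μ) : HasPoissonLaplace (fun j ω => X ω j) Λ μ := by
  refine ⟨fun j => (measurable_pi_apply j).comp hX.measurable, fun g hg => ?_⟩
  -- Simple functions carried by sets of finite intensity increase to `g`; both sides of the formula
  -- pass to the limit.
  let G : ℕ → E → ℝ≥0∞ := fun n => (spanningSets Λ n).indicator (SimpleFunc.eapprox g n)
  have hGm : ∀ n, Measurable (G n) := fun n =>
    (SimpleFunc.measurable _).indicator (measurableSet_spanningSets Λ n)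
  have hmono : ∀ x, Monotone fun n => G n x := by
    intro x m n hmn
    refine (indicator_le_indicator_of_subset (monotone_spanningSets Λ hmn)
      (fun _ => zero_le) x).trans (indicator_le_indicator ?_)
    exact SimpleFunc.monotone_eapprox g hmn x
  have hlim : ∀ x, Tendsto (fun n => G n x) atTop (𝓝 (g x)) := by
    intro x
    refine (SimpleFunc.tendsto_eapprox hg x).congr' ?_
    obtain ⟨n, hn⟩ := mem_iUnion.1 ((iUnion_spanningSets Λ).symm ▸ mem_univ x)
    filter_upwards [eventually_ge_atTop n] with m hm
    exact (indicator_of_mem (monotone_spanningSets Λ hm hn) _).symm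
  have h1 : Tendsto (fun n => ∫⁻ ω, expNeg (∑' j, G n (X ω j)) ∂μ) atTop
      (𝓝 (∫⁻ ω, expNeg (∑' j, g (X ω j)) ∂μ)) := by
    refine tendsto_lintegral_filter_of_dominated_convergence (fun _ => 1) ?_ ?_ (by simp) ?_
    · exact Eventually.of_forall fun n => measurable_expNeg_tsum fun j =>
        (hGm n).comp ((measurable_pi_apply j).comp hX.measurable)
    · exact Eventually.of_forall fun s => ae_of_all _ fun ω => expNeg_le_one _
    · refine ae_of_all _ fun ω => (continuous_expNeg.tendsto _).comp ?_
      -- The sum over the points is an integral against the counting measure, so monotone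
      -- convergence applies to it.
      have := lintegral_tendsto_of_tendsto_of_monotone (μ := Measure.count)
        (f := fun n j => G n (X ω j)) (F := fun j => g (X ω j))
        (fun n => (measurable_of_countable _).aemeasurable)
        (ae_of_all _ fun j => hmono _) (ae_of_all _ fun j => hlim _)
      simpa only [lintegral_count] using this
  refine tendsto_nhds_unique h1 ?_
  simp_rw [G, hX.laplace_simple _ (measurableSet_spanningSets Λ _)
    (measure_spanningSets_lt_top Λ _).ne]
  refine (continuous_expNeg.tendsto _).comp ?_
  have hsub : Continuous fun y : ℝ≥0∞ => 1 - expNeg y :=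
    ENNReal.continuous_sub_left ENNReal.one_ne_top |>.comp continuous_expNeg
  refine lintegral_tendsto_of_tendsto_of_monotone
    (fun n => (hsub.measurable.comp (hGm n)).aemeasurable) (ae_of_all _ fun x m n hmn => ?_)
    (ae_of_all _ fun x => (hsub.tendsto _).comp (hlim x))
  exact tsub_le_tsub_left (expNeg_strictAnti.antitone (hmono x hmn)) 1

/-! ### Exponential variables and shot noise -/

/-- Fubini's theorem for a function of two independent variables. -/
lemma lintegral_of_indepFun {Ω α β : Type*} [MeasurableSpace Ω] [MeasurableSpace α]
    [MeasurableSpace β] {μ : Measure Ω} [IsProbabilityMeasure μ] {W : Ω → α} {Z : Ω → β}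
    (hW : Measurable W) (hZ : Measurable Z) (hWZ : IndepFun W Z μ) {F : α → β → ℝ≥0∞}
    (hF : Measurable (Function.uncurry F)) :
    ∫⁻ ω, F (W ω) (Z ω) ∂μ = ∫⁻ ω, ∫⁻ ω', F (W ω) (Z ω') ∂μ ∂μ := by
  have h1 := (indepFun_iff_map_prod_eq_prod_map_map hW.aemeasurable hZ.aemeasurable).1 hWZ
  have h2 : ∫⁻ ω, F (W ω) (Z ω) ∂μ
      = ∫⁻ z, Function.uncurry F z ∂(μ.map fun ω => (W ω, Z ω)) := by
    rw [lintegral_map hF (hW.prodMk hZ)]; rfl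
  have := Measure.isProbabilityMeasure_map (μ := μ) hZ.aemeasurable
  have h3 : Measurable fun x => ∫⁻ y, F x y ∂(μ.map Z) := hF.lintegral_prod_right'
  rw [h2, h1, lintegral_prod _ hF.aemeasurable]
  simp only [Function.uncurry_apply_pair]
  rw [lintegral_map h3 hW]
  exact lintegral_congr fun ω => lintegral_map (hF.comp measurable_prodMk_left) hZ

lemma lintegral_Ioi_exp_neg_mul {b : ℝ} (hb : 0 < b) (a : ℝ) :
    ∫⁻ x in Ioi a, ENNReal.ofReal (Real.exp (-(b * x))) = ENNReal.ofReal (Real.exp (-(b * a)) / b) := by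
  have h := integral_exp_mul_Ioi (neg_lt_zero.2 hb) a
  have hi := integrableOn_exp_mul_Ioi (neg_lt_zero.2 hb) a
  simp only [neg_mul] at h hi
  rw [← ofReal_integral_eq_lintegral_ofReal hi (ae_of_all _ fun x => (Real.exp_pos _).le), h,
    neg_div_neg_eq]

lemma lintegral_expMeasure {r : ℝ} (f : ℝ → ℝ≥0∞) :
    ∫⁻ x, f x ∂(expMeasure r)
      = ∫⁻ x in Ioi 0, f x * ENNReal.ofReal (r * Real.exp (-(r * x))) := by
  have h1 : expMeasure r = volume.withDensity (exponentialPDF r) := rfl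
  have hm : Measurable (exponentialPDF r) := (measurable_exponentialPDFReal r).ennreal_ofReal
  rw [h1, lintegral_withDensity_eq_lintegral_mul_non_measurable _ hm
    (ae_of_all _ fun x => ENNReal.ofReal_lt_top), setLIntegral_congr Ioi_ae_eq_Ici,
    ← lintegral_indicator measurableSet_Ici]
  congr 1 with x
  by_cases hx : 0 ≤ x
  · rw [indicator_of_mem (mem_Ici.2 hx), Pi.mul_apply, exponentialPDF_of_nonneg hx, mul_comm]
  · rw [indicator_of_notMem (by simpa using hx), Pi.mul_apply,
      exponentialPDF_of_neg (not_le.1 hx), zero_mul]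

lemma expMeasure_Ici {r : ℝ} (hr : 0 < r) {x : ℝ} (hx : 0 ≤ x) :
    expMeasure r (Ici x) = ENNReal.ofReal (Real.exp (-(r * x))) := by
  rw [← lintegral_indicator_one measurableSet_Ici, lintegral_expMeasure]
  have h1 : ∀ y, (Ici x).indicator 1 y * ENNReal.ofReal (r * Real.exp (-(r * y)))
      = (Ici x).indicator (fun y => ENNReal.ofReal r * ENNReal.ofReal (Real.exp (-(r * y)))) y := by
    intro y
    by_cases hy : y ∈ Ici x <;> simp [hy, ENNReal.ofReal_mul hr.le]
  simp_rw [h1]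
  rw [setLIntegral_indicator measurableSet_Ici, setLIntegral_congr (t := Ioi x)]
  · rw [lintegral_const_mul _ (by fun_prop), lintegral_Ioi_exp_neg_mul hr,
      ← ENNReal.ofReal_mul hr.le]
    congr 1; field_simp
  · refine (Ioi_ae_eq_Ici.symm.inter (ae_eq_refl (Ioi (0 : ℝ)))).trans (Filter.EventuallyEq.of_eq (inter_eq_left.2
      fun y hy => hx.trans_lt hy))

lemma preimage_ofReal_Ici {c : ℝ≥0∞} (hc : c ≠ ∞) (hc0 : c ≠ 0) :
    ENNReal.ofReal ⁻¹' Ici c = Ici c.toReal := by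
  ext x
  rcases le_or_gt 0 x with hx | hx
  · exact ENNReal.le_ofReal_iff_toReal_le hc hx
  · simp only [mem_preimage, mem_Ici, ENNReal.ofReal_of_nonpos hx.le, nonpos_iff_eq_zero, hc0,
      false_iff, not_le]
    exact hx.trans_le ENNReal.toReal_nonneg

section Exp

variable {Ω : Type*} [MeasurableSpace Ω] {μ : Measure Ω}

lemma measure_le_ofReal_exp [IsProbabilityMeasure μ] {h : Ω → ℝ} (hm : Measurable h) (hl : μ.map h = expMeasure 1)
    (c : ℝ≥0∞) : μ {ω | c ≤ ENNReal.ofReal (h ω)} = expNeg c := by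
  rcases eq_or_ne c ∞ with rfl | hc
  · simp
  have h1 : {ω | c ≤ ENNReal.ofReal (h ω)} = h ⁻¹' {x | c ≤ ENNReal.ofReal x} := rfl
  have hm1 : MeasurableSet {x : ℝ | c ≤ ENNReal.ofReal x} :=
    measurableSet_le measurable_const ENNReal.measurable_ofReal
  rcases eq_or_ne c 0 with rfl | hc0
  · simp
  have h2 : {x : ℝ | c ≤ ENNReal.ofReal x} = Ici c.toReal := preimage_ofReal_Ici hc hc0
  rw [h1, ← Measure.map_apply hm hm1, hl, h2, expMeasure_Ici one_pos ENNReal.toReal_nonneg,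
    expNeg_of_ne_top hc, one_mul]

lemma lintegral_expNeg_mul_exp {h : Ω → ℝ} (hm : Measurable h) (hl : μ.map h = expMeasure 1)
    (c : ℝ≥0∞) : ∫⁻ ω, expNeg (c * ENNReal.ofReal (h ω)) ∂μ = (1 + c)⁻¹ := by
  have h1 : ∫⁻ ω, expNeg (c * ENNReal.ofReal (h ω)) ∂μ
      = ∫⁻ x, expNeg (c * ENNReal.ofReal x) ∂(expMeasure 1) := by
    rw [← hl, lintegral_map (by fun_prop) hm]
  rw [h1, lintegral_expMeasure]
  rcases eq_or_ne c ∞ with rfl | hc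
  · rw [setLIntegral_congr_fun (g := fun _ => 0) measurableSet_Ioi]
    · simp
    · intro x hx
      simp [ENNReal.top_mul (ENNReal.ofReal_pos.2 hx).ne']
  · rw [setLIntegral_congr_fun (g := fun x => ENNReal.ofReal (Real.exp (-((c.toReal + 1) * x))))
      measurableSet_Ioi]
    · rw [lintegral_Ioi_exp_neg_mul (by positivity)]
      simp only [mul_zero, neg_zero, Real.exp_zero, one_div]
      rw [ENNReal.ofReal_inv_of_pos (by positivity), ENNReal.ofReal_add (by positivity) one_pos.le,
        ENNReal.ofReal_toReal hc, ENNReal.ofReal_one, add_comm]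
    · intro x hx
      have hx : 0 < x := hx
      conv_lhs => rw [← ENNReal.ofReal_toReal hc]
      simp only
      rw [← ENNReal.ofReal_mul ENNReal.toReal_nonneg, expNeg_ofReal (by positivity),
        ← ENNReal.ofReal_mul (by positivity), one_mul, one_mul, ← Real.exp_add]
      congr 2; ring

/-- The Laplace transform of a Poisson shot noise with exponential marks. -/
lemma HasPoissonLaplace.shot_noise [IsProbabilityMeasure μ] {E ι : Type*} [MeasurableSpace E] [Countable ι]
    {Y : ι → Ω → E} {Λ : Measure E} (hY : HasPoissonLaplace Y Λ μ) {h : ι → Ω → ℝ}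
    (hm : ∀ i, Measurable (h i)) (hl : ∀ i, μ.map (h i) = expMeasure 1) (hi : iIndepFun h μ)
    (hYh : IndepFun (fun ω i => Y i ω) (fun ω i => h i ω) μ) {w : E → ℝ≥0∞} (hw : Measurable w) :
    ∫⁻ ω, expNeg (∑' i, w (Y i ω) * ENNReal.ofReal (h i ω)) ∂μ
      = expNeg (∫⁻ x, (1 - (1 + w x)⁻¹) ∂Λ) := by
  have hle : ∀ c : ℝ≥0∞, (1 + c)⁻¹ ≤ 1 := fun c => ENNReal.inv_le_one.2 le_self_add
  rw [lintegral_of_indepFun (W := fun ω i => Y i ω) (Z := fun ω i => h i ω)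
    (F := fun y g => expNeg (∑' i, w (y i) * ENNReal.ofReal (g i)))
    (measurable_pi_lambda _ hY.measurable) (measurable_pi_lambda _ hm) hYh]
  -- With the points frozen, each mark contributes the factor `1 / (1 + w)`. Through `negLog` the
  -- product over points is again a Laplace functional of `Y`.
  · have h1 : ∀ ω, ∫⁻ ω', expNeg (∑' i, w (Y i ω) * ENNReal.ofReal (h i ω')) ∂μ
        = expNeg (∑' i, negLog (1 + w (Y i ω))⁻¹) := by
      intro ω
      refine lintegral_expNeg_tsum (ξ := fun i ω' => w (Y i ω) * ENNReal.ofReal (h i ω'))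
        (fun i => ?_) (hi.comp (fun i x => w (Y i ω) * ENNReal.ofReal x) fun i => by fun_prop)
        fun i => ?_
      · exact (ENNReal.measurable_ofReal.comp (hm i)).const_mul _
      · rw [expNeg_negLog (hle _)]
        exact lintegral_expNeg_mul_exp (hm i) (hl i) _
    simp_rw [h1]
    rw [hY.laplace (fun x => negLog (1 + w x)⁻¹) (by fun_prop)]
    simp_rw [expNeg_negLog (hle _)]
  · exact measurable_expNeg_tsum (ξ := fun i (z : (ι → E) × (ι → ℝ)) =>
      w (z.1 i) * ENNReal.ofReal (z.2 i)) fun i => by fun_prop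

end Exp

/-! ### Poisson processes on the half-line -/

section HalfLine

variable {Ω ι : Type*} [MeasurableSpace Ω] {μ : Measure Ω}

/-- With `g = ∞` on `B` and `0` elsewhere, `expNeg (∑ g)` is the indicator that `B` contains no
point. -/
lemma HasPoissonLaplace.void {E : Type*} [MeasurableSpace E] [Countable ι] {Y : ι → Ω → E}
    {Λ : Measure E} (hY : HasPoissonLaplace Y Λ μ) {B : Set E} (hB : MeasurableSet B) :
    μ {ω | ∀ i, Y i ω ∉ B} = expNeg (Λ B) := by
  have h1 := hY.laplace (B.indicator fun _ => ∞) (measurable_const.indicator hB)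
  have h2 : ∀ x, 1 - expNeg (B.indicator (fun _ => ∞) x) = B.indicator 1 x := by
    intro x; by_cases hx : x ∈ B <;> simp [hx]
  simp_rw [h2] at h1
  rw [lintegral_indicator_one hB] at h1
  have hA : MeasurableSet {ω | ∀ i, Y i ω ∉ B} := by
    simp_rw [ofPred_forall]
    exact MeasurableSet.iInter fun i => (hY.measurable i hB).compl
  rw [← h1, ← lintegral_indicator_one hA]
  congr 1 with ω
  by_cases hω : ∀ i, Y i ω ∉ B
  · rw [indicator_of_mem (by exact hω)]
    simp [hω]
  · rw [indicator_of_notMem (by exact hω)]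
    push Not at hω
    obtain ⟨i, hi⟩ := hω
    rw [ENNReal.tsum_eq_top_of_eq_top ⟨i, by simp [hi]⟩, expNeg_top]

/-- Obtained from the Laplace functional alone, by comparing the generating function of the number
of points at `1/2` with the void probability. The quadratic order is what excludes ties in
`HasPoissonLaplace.ae_injOn`. -/
lemma HasPoissonLaplace.measure_two_le [IsProbabilityMeasure μ] {E : Type*} [MeasurableSpace E] [Countable ι]
    {Y : ι → Ω → E} {Λ : Measure E} (hY : HasPoissonLaplace Y Λ μ) {B : Set E}
    (hB : MeasurableSet B) (hB' : Λ B ≠ ∞) :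
    μ {ω | ∃ i j, i ≠ j ∧ Y i ω ∈ B ∧ Y j ω ∈ B} ≤ Λ B ^ 2 := by
  classical
  set A := {ω | ∃ i j, i ≠ j ∧ Y i ω ∈ B ∧ Y j ω ∈ B} with hA
  set V := {ω | ∀ i, Y i ω ∉ B} with hV
  have hAm : MeasurableSet A := by
    have : A = ⋃ i, ⋃ j, ⋃ _ : i ≠ j, (Y i ⁻¹' B ∩ Y j ⁻¹' B) := by
      ext ω; simp only [hA, mem_ofPred_eq, mem_iUnion, mem_inter_iff, mem_preimage, exists_prop]
    rw [this]
    exact MeasurableSet.iUnion fun i => MeasurableSet.iUnion fun j => MeasurableSet.iUnion fun _ =>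
      (hY.measurable i hB).inter (hY.measurable j hB)
  have hVm : MeasurableSet V := by
    simp_rw [hV, ofPred_forall]
    exact MeasurableSet.iInter fun i => (hY.measurable i hB).compl
  set c := negLog 2⁻¹ with hc
  have hec : expNeg c = 2⁻¹ := expNeg_negLog (by norm_num)
  have h1 := hY.laplace (B.indicator fun _ => c) (measurable_const.indicator hB)
  have h2 : ∀ x, 1 - expNeg (B.indicator (fun _ => c) x) = B.indicator (fun _ => 2⁻¹) x := by
    intro x; by_cases hx : x ∈ B <;> simp [hx, hec]
  simp_rw [h2] at h1
  rw [lintegral_indicator_const hB] at h1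
  set Z : Ω → ℝ≥0∞ := fun ω => expNeg (∑' i, B.indicator (fun _ => c) (Y i ω)) with hZ
  -- Here `Z = 2^{-N}` with `N` the number of points in `B`. There is equality for `N = 0` and `N =
  -- 1`, and for `N ≥ 2` the left side is at most `1/4 + 1/4`.
  have key : ∀ ω, Z ω + A.indicator (fun _ => 4⁻¹) ω ≤ V.indicator (fun _ => 2⁻¹) ω + 2⁻¹ := by
    intro ω
    by_cases hω : ω ∈ V
    · have : ω ∉ A := by
        rintro ⟨i, j, -, hi, -⟩
        exact hω i hi
      have hz : Z ω = 1 := by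
        have hω' : ∀ i, Y i ω ∉ B := hω
        simp [hZ, hω']
      simp [hω, this, hz, ENNReal.inv_two_add_inv_two]
    · have hω' : ∃ i, Y i ω ∈ B := by simpa [hV] using hω
      by_cases hωA : ω ∈ A
      · obtain ⟨i, j, hij, hi, hj⟩ := hωA
        have hle : Z ω ≤ 4⁻¹ := by
          have : c + c ≤ ∑' i, B.indicator (fun _ => c) (Y i ω) := by
            refine le_trans (le_of_eq ?_) (ENNReal.sum_le_tsum {i, j})
            simp [Finset.sum_pair hij, hi, hj]
          refine (expNeg_strictAnti.antitone this).trans ?_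
          rw [expNeg_add, hec, ← ENNReal.mul_inv (by simp) (by simp)]
          norm_num
        have hωA : ω ∈ A := ⟨i, j, hij, hi, hj⟩
        rw [indicator_of_mem hωA, indicator_of_notMem hω, zero_add]
        refine (add_le_add_left hle _).trans (le_of_eq ?_)
        rw [← two_mul, show (4 : ℝ≥0∞) = 2 * 2 by norm_num, ENNReal.mul_inv (by simp) (by simp),
          ← mul_assoc, ENNReal.mul_inv_cancel (by simp) (by simp), one_mul]
      · rw [indicator_of_notMem hωA, indicator_of_notMem hω, zero_add, add_zero]
        obtain ⟨i, hi⟩ := hω'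
        rw [← hec]
        refine expNeg_strictAnti.antitone (le_trans (le_of_eq ?_) (ENNReal.le_tsum i))
        simp [hi]
  have h3 := lintegral_mono (μ := μ) key
  rw [lintegral_add_right _ (measurable_const.indicator hAm),
    lintegral_add_right _ measurable_const, lintegral_indicator_const hAm,
    lintegral_indicator_const hVm, lintegral_const, measure_univ, mul_one, hV, hY.void hB,
    h1] at h3
  obtain ⟨l, hl, hl0⟩ : ∃ l : ℝ, Λ B = ENNReal.ofReal l ∧ 0 ≤ l :=
    ⟨(Λ B).toReal, (ENNReal.ofReal_toReal hB').symm, ENNReal.toReal_nonneg⟩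
  obtain ⟨a, ha, ha0⟩ : ∃ a : ℝ, μ A = ENNReal.ofReal a ∧ 0 ≤ a :=
    ⟨(μ A).toReal, (ENNReal.ofReal_toReal (measure_ne_top _ _)).symm, ENNReal.toReal_nonneg⟩
  have e2 : (2⁻¹ : ℝ≥0∞) = ENNReal.ofReal 2⁻¹ := by
    rw [ENNReal.ofReal_inv_of_pos (by norm_num)]; norm_num
  have e4 : (4⁻¹ : ℝ≥0∞) = ENNReal.ofReal 4⁻¹ := by
    rw [ENNReal.ofReal_inv_of_pos (by norm_num)]; norm_num
  have hx0 := Real.exp_pos (-(2⁻¹ * l))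
  rw [hl, ha, e2, e4, ← ENNReal.ofReal_mul (by norm_num), ← ENNReal.ofReal_mul (by norm_num),
    expNeg_ofReal hl0, expNeg_ofReal (by positivity), ← ENNReal.ofReal_mul (by norm_num),
    ← ENNReal.ofReal_add (by positivity) (by positivity),
    ← ENNReal.ofReal_add (by positivity) (by positivity),
    ENNReal.ofReal_le_ofReal_iff (by positivity),
    show -l = -(2⁻¹ * l) + -(2⁻¹ * l) by ring, Real.exp_add] at h3
  rw [ha, hl, ← ENNReal.ofReal_pow hl0]
  apply ENNReal.ofReal_le_ofReal
  have h4 := Real.add_one_le_exp (-(2⁻¹ * l))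
  have h5 : Real.exp (-(2⁻¹ * l)) ≤ 1 := Real.exp_le_one_iff.2 (by linarith)
  -- With `x = e^{-l/2}`, `h3` says `a ≤ 2 (1 - x)^2`, and `0 ≤ 1 - x ≤ l / 2`.
  nlinarith [mul_nonneg (sub_nonneg.2 h5) hl0]

/-- For every `c > 0`, `E e^{-cN} ≤ P(N < ∞)`, while the left side is at least `e^{-c Λ(B)}`; let `c
→ 0`. -/
lemma HasPoissonLaplace.ae_finite [IsProbabilityMeasure μ] {E : Type*} [MeasurableSpace E] [Countable ι]
    {Y : ι → Ω → E} {Λ : Measure E} (hY : HasPoissonLaplace Y Λ μ) {B : Set E}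
    (hB : MeasurableSet B) (hB' : Λ B ≠ ∞) : ∀ᵐ ω ∂μ, {i | Y i ω ∈ B}.Finite := by
  set N : Ω → ℝ≥0∞ := fun ω => ∑' i, B.indicator 1 (Y i ω) with hN
  have hNm : Measurable N := Measurable.tsum fun i =>
    (measurable_one.indicator hB).comp (hY.measurable i)
  have hm : MeasurableSet {ω | N ω = ∞}ᶜ := (hNm (measurableSet_singleton ∞)).compl
  have h1 : ∀ c : ℝ≥0∞, c ≠ 0 → expNeg (Λ B * c) ≤ μ {ω | N ω = ∞}ᶜ := by
    intro c hc
    have h1 := hY.laplace (B.indicator fun _ => c) (measurable_const.indicator hB)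
    have h2 : ∀ x, 1 - expNeg (B.indicator (fun _ => c) x) ≤ B.indicator (fun _ => c) x := by
      intro x; exact one_sub_expNeg_le _
    have h3 := lintegral_mono (μ := Λ) h2
    rw [lintegral_indicator_const hB, mul_comm] at h3
    refine (expNeg_strictAnti.antitone h3).trans ?_
    rw [← h1, ← lintegral_indicator_one hm]
    refine lintegral_mono fun ω => ?_
    by_cases hω : N ω = ∞
    · have : ∑' i, B.indicator (fun _ => c) (Y i ω) = c * N ω := by
        rw [hN, ← ENNReal.tsum_mul_left]
        congr 1 with i
        by_cases hi : Y i ω ∈ B <;> simp [hi]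
      rw [this, hω, ENNReal.mul_top hc, expNeg_top]
      exact zero_le
    · rw [indicator_of_mem (by exact hω)]
      exact expNeg_le_one _
  have h2 : Tendsto (fun n : ℕ => expNeg (Λ B * (n : ℝ≥0∞)⁻¹)) atTop (𝓝 1) := by
    rw [← expNeg_zero]
    refine (continuous_expNeg.tendsto _).comp ?_
    have := ENNReal.Tendsto.const_mul (a := Λ B) ENNReal.tendsto_inv_nat_nhds_zero (Or.inr hB')
    simpa using this
  have h3 : (1 : ℝ≥0∞) ≤ μ {ω | N ω = ∞}ᶜ :=
    le_of_tendsto' h2 fun n => h1 _ (by simp)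
  have h4 : ∀ᵐ ω ∂μ, N ω ≠ ∞ := by
    have := (prob_compl_eq_one_iff (hNm (measurableSet_singleton ∞))).1
      (le_antisymm prob_le_one h3)
    rw [ae_iff]
    simp only [ne_eq, not_not]
    exact this
  filter_upwards [h4] with ω hω
  refine (ENNReal.finite_const_le_of_tsum_ne_top hω one_ne_zero).subset fun i hi => ?_
  simp [show Y i ω ∈ B from hi]

variable [Countable ι] {Y : ι → Ω → ℝ≥0∞} {Λ : Measure ℝ≥0∞} {a : ℝ≥0∞}

/-- Two equal points below `R` lie in a common bin of width `1/n`. By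
`HasPoissonLaplace.measure_two_le` this has probability at most `R n (a/n)^2`, which tends to `0`.
-/
lemma HasPoissonLaplace.ae_injOn [IsProbabilityMeasure μ] (hY : HasPoissonLaplace Y Λ μ) (ha : a ≠ ∞)
    (hΛ : ∀ r, Λ (Iio r) = a * r) :
    ∀ᵐ ω ∂μ, ∀ i j, i ≠ j → Y i ω = Y j ω → Y i ω = ∞ := by
  have hbin : ∀ (n : ℕ), 0 < n → ∀ l : ℕ, Λ (Ico (l / n : ℝ≥0∞) ((l + 1 : ℕ) / n : ℝ≥0∞)) = a / n := by
    intro n hn l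
    have hn' : (n : ℝ≥0∞) ≠ 0 := by exact_mod_cast hn.ne'
    have hf : Λ (Iio (l / n : ℝ≥0∞)) ≠ ∞ := by
      rw [hΛ]
      exact ENNReal.mul_ne_top ha (ENNReal.div_ne_top (by simp) hn')
    have hle : (l / n : ℝ≥0∞) ≤ (l + 1 : ℕ) / n := by gcongr; simp
    rw [← Ici_inter_Iio, ← compl_Iio, inter_comm, ← sdiff_eq, measure_sdiff (Iio_subset_Iio hle) measurableSet_Iio.nullMeasurableSet hf,
      hΛ, hΛ]
    push_cast
    rw [ENNReal.add_div, mul_add, ENNReal.add_sub_cancel_left (by rwa [hΛ] at hf), mul_one_div]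
  have h1 : ∀ R : ℕ, μ {ω | ∃ i j, i ≠ j ∧ Y i ω = Y j ω ∧ Y i ω < R} = 0 := by
    intro R
    have hle : ∀ n : ℕ, 0 < n → μ {ω | ∃ i j, i ≠ j ∧ Y i ω = Y j ω ∧ Y i ω < R}
        ≤ (R * a ^ 2) * (n : ℝ≥0∞)⁻¹ := by
      intro n hn
      have hn' : (n : ℝ≥0∞) ≠ 0 := by exact_mod_cast hn.ne'
      have hsub : {ω | ∃ i j, i ≠ j ∧ Y i ω = Y j ω ∧ Y i ω < R} ⊆
          ⋃ l ∈ Finset.range (R * n), {ω | ∃ i j, i ≠ j ∧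
            Y i ω ∈ Ico (l / n : ℝ≥0∞) ((l + 1 : ℕ) / n : ℝ≥0∞) ∧
            Y j ω ∈ Ico (l / n : ℝ≥0∞) ((l + 1 : ℕ) / n : ℝ≥0∞)} := by
        rintro ω ⟨i, j, hij, he, hlt⟩
        obtain ⟨y, hy⟩ : ∃ y : ℝ≥0, Y i ω = y :=
          ⟨(Y i ω).toNNReal, (ENNReal.coe_toNNReal (hlt.trans_le le_top).ne).symm⟩
        have hyR : y < R := by rw [hy] at hlt; exact_mod_cast hlt
        have hn0 : (0 : ℝ≥0) < n := by exact_mod_cast hn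
        -- The bin containing `y` has index `⌊y n⌋`, which is below `R n` because `y < R`.
        have hm : Y i ω ∈ Ico ((⌊y * n⌋₊ : ℕ) / n : ℝ≥0∞) ((⌊y * n⌋₊ + 1 : ℕ) / n : ℝ≥0∞) := by
          rw [hy]
          constructor
          · rw [ENNReal.div_le_iff hn' (by simp)]
            exact_mod_cast Nat.floor_le (zero_le (a := y * n))
          · rw [ENNReal.lt_div_iff_mul_lt (Or.inl hn') (Or.inl (by simp))]
            exact_mod_cast Nat.lt_floor_add_one (y * n)
        refine mem_biUnion (x := ⌊y * n⌋₊) ?_ ⟨i, j, hij, hm, he ▸ hm⟩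
        simp only [Finset.coe_range, mem_Iio]
        rw [Nat.floor_lt zero_le]
        push_cast
        gcongr
      refine (measure_mono hsub).trans ((measure_biUnion_finset_le _ _).trans ?_)
      refine (Finset.sum_le_sum fun l _ => hY.measure_two_le measurableSet_Ico ?_).trans ?_
      · rw [hbin n hn]; exact ENNReal.div_ne_top ha hn'
      · simp_rw [hbin n hn]
        rw [Finset.sum_const, Finset.card_range, nsmul_eq_mul]
        push_cast
        rw [div_eq_mul_inv, mul_pow, sq (n : ℝ≥0∞)⁻¹]
        have := ENNReal.mul_inv_cancel hn' (ENNReal.natCast_ne_top n)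
        calc (R * n * (a ^ 2 * ((n : ℝ≥0∞)⁻¹ * (n : ℝ≥0∞)⁻¹)) : ℝ≥0∞)
            = R * a ^ 2 * (n * (n : ℝ≥0∞)⁻¹) * (n : ℝ≥0∞)⁻¹ := by ring
          _ ≤ _ := by rw [this, mul_one]
    have hlim : Tendsto (fun n : ℕ => (R * a ^ 2) * (n : ℝ≥0∞)⁻¹) atTop (𝓝 0) := by
      have := ENNReal.Tendsto.const_mul (a := R * a ^ 2) ENNReal.tendsto_inv_nat_nhds_zero
        (Or.inr (ENNReal.mul_ne_top (by simp) (ENNReal.pow_ne_top ha)))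
      simpa using this
    refine le_antisymm (ge_of_tendsto hlim ?_) zero_le
    filter_upwards [eventually_gt_atTop 0] with n hn using hle n hn
  have h2 : ∀ᵐ ω ∂μ, ∀ R : ℕ, ¬ ∃ i j, i ≠ j ∧ Y i ω = Y j ω ∧ Y i ω < R :=
    ae_all_iff.2 fun R => by rw [ae_iff]; simpa only [not_not] using h1 R
  filter_upwards [h2] with ω hω i j hij he
  by_contra hne
  obtain ⟨R, hR⟩ := ENNReal.exists_nat_gt hne
  exact hω R ⟨i, j, hij, he, hR⟩

/-- A Poisson process of constant rate on the half-line has almost surely a unique first point. -/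
lemma HasPoissonLaplace.ae_exists_min [IsProbabilityMeasure μ] (hY : HasPoissonLaplace Y Λ μ) (ha0 : a ≠ 0) (ha : a ≠ ∞)
    (hΛ : ∀ r, Λ (Iio r) = a * r) : ∀ᵐ ω ∂μ, ∃ i, ∀ j, j ≠ i → Y i ω < Y j ω := by
  have h1 : ∀ᵐ ω ∂μ, ∀ R : ℕ, {i | Y i ω ∈ Iio (R : ℝ≥0∞)}.Finite :=
    ae_all_iff.2 fun R => hY.ae_finite measurableSet_Iio (by
      rw [hΛ]; exact ENNReal.mul_ne_top ha (by simp))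
  -- The intensity of `[0, ∞)` is `a * ∞ = ∞`, so its void probability is `0`. This is where `a ≠ 0`
  -- matters.
  have h2 : ∀ᵐ ω ∂μ, ∃ i, Y i ω < ∞ := by
    have := hY.void (B := Iio ∞) measurableSet_Iio
    rw [hΛ, ENNReal.mul_top ha0, expNeg_top] at this
    rw [ae_iff]
    simpa using this
  filter_upwards [h1, h2, hY.ae_injOn ha hΛ] with ω hf ⟨i, hi⟩ hinj
  obtain ⟨R, hR⟩ := ENNReal.exists_nat_gt hi.ne
  obtain ⟨k, hk, hmin⟩ := (hf R).exists_minimalFor (fun i => Y i ω) _ ⟨i, hR⟩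
  have hk' : Y k ω < R := hk
  have hle : ∀ j, Y k ω ≤ Y j ω := by
    intro j
    by_contra! hj
    exact absurd (hmin (show Y j ω < R from hj.trans hk') hj.le) (not_le.2 hj)
  refine ⟨k, fun j hj => (hle j).lt_of_ne fun he => ?_⟩
  exact (hk'.trans_le le_top).ne (hinj k j hj.symm he)

/-- The first point of a Poisson process of constant rate is exponentially distributed. -/
lemma HasPoissonLaplace.lintegral_iInf [IsProbabilityMeasure μ] (hY : HasPoissonLaplace Y Λ μ) {a : ℝ} (ha0 : 0 < a)
    (hΛ : ∀ r, Λ (Iio r) = ENNReal.ofReal a * r) {φ : ℝ≥0∞ → ℝ≥0∞} (hφ : Measurable φ) :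
    ∫⁻ ω, φ (⨅ i, Y i ω) ∂μ
      = ∫⁻ x in Ioi (0 : ℝ), φ (ENNReal.ofReal x) * ENNReal.ofReal (a * Real.exp (-(a * x))) := by
  have hm : Measurable fun ω => ⨅ i, Y i ω := Measurable.iInf hY.measurable
  have := Measure.isProbabilityMeasure_map (μ := μ) hm.aemeasurable
  have := isProbabilityMeasure_expMeasure ha0
  have hmap : μ.map (fun ω => ⨅ i, Y i ω) = (expMeasure a).map ENNReal.ofReal := by
    have := Measure.isProbabilityMeasure_map (μ := expMeasure a)
      ENNReal.measurable_ofReal.aemeasurable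
    refine Measure.ext_of_Ici _ _ fun r => ?_
    rw [Measure.map_apply hm measurableSet_Ici,
      Measure.map_apply ENNReal.measurable_ofReal measurableSet_Ici]
    have h1 : (fun ω => ⨅ i, Y i ω) ⁻¹' Ici r = {ω | ∀ i, Y i ω ∉ Iio r} := by
      ext ω; simp
    rw [h1, hY.void measurableSet_Iio, hΛ]
    rcases eq_or_ne r ∞ with rfl | hr
    · rw [ENNReal.mul_top (by simpa using ha0), expNeg_top]
      have : ENNReal.ofReal ⁻¹' Ici ∞ = ∅ := by ext x; simp
      rw [this, measure_empty]
    rcases eq_or_ne r 0 with rfl | hr0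
    · simp
    · rw [preimage_ofReal_Ici hr hr0, expMeasure_Ici ha0 ENNReal.toReal_nonneg, ← expNeg_ofReal (by positivity),
        ENNReal.ofReal_mul ha0.le, ENNReal.ofReal_toReal hr]
  rw [← lintegral_map hφ hm, hmap, lintegral_map hφ ENNReal.measurable_ofReal,
    lintegral_expMeasure]

end HalfLine

/-! ### Polar coordinates in the plane -/

/-- Valid for every real `u`: `arccos` is constantly `0` above `1` and `π` below `-1`, which matches
the empty and the full circle. This saves all case distinctions when a circle meets a disc. -/
lemma setOf_lt_cos_eq (u : ℝ) :
    {t : ℝ | u < Real.cos t} ∩ Ioo (-Real.pi) Real.pi = Ioo (-Real.arccos u) (Real.arccos u) := by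
  ext t
  rw [mem_inter_iff, mem_ofPred_eq, mem_Ioo, ← abs_lt, mem_Ioo, ← abs_lt, ← Real.cos_abs]
  constructor
  · rintro ⟨h1, h2⟩
    rw [← Real.arccos_cos (abs_nonneg t) h2.le]
    rcases le_or_gt u (-1) with hu | hu
    · rw [Real.arccos_eq_pi.2 hu, Real.arccos_cos (abs_nonneg t) h2.le]
      exact h2
    · exact Real.strictAntiOn_arccos ⟨hu.le, (h1.trans_le (Real.cos_le_one _)).le⟩
        ⟨Real.neg_one_le_cos _, Real.cos_le_one _⟩ h1
  · intro h
    have h2 : |t| < Real.pi := h.trans_le (Real.arccos_le_pi u)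
    refine ⟨?_, h2⟩
    by_contra! hu
    have := Real.antitone_arccos hu
    rw [Real.arccos_cos (abs_nonneg t) h2.le] at this
    exact absurd h (not_lt.2 this)

lemma lintegral_complex_polar {F : ℂ → ℝ≥0∞} (hF : Measurable F) :
    ∫⁻ z, F z = ∫⁻ r in Ioi (0 : ℝ), ENNReal.ofReal r * ∫⁻ t in Ioo (-Real.pi) Real.pi,
      F (r * (Real.cos t + Real.sin t * Complex.I)) := by
  have hm : Measurable fun p : ℝ × ℝ =>
      F ((p.1 : ℂ) * ((Real.cos p.2 : ℂ) + (Real.sin p.2 : ℂ) * Complex.I)) :=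
    hF.comp (by fun_prop)
  rw [← Complex.lintegral_comp_polarCoord_symm, polarCoord_target,
    Measure.volume_eq_prod, ← Measure.prod_restrict, lintegral_prod]
  · refine lintegral_congr fun r => ?_
    simp only [Complex.polarCoord_symm_apply, smul_eq_mul]
    exact lintegral_const_mul _ (hm.comp measurable_prodMk_left)
  · refine Measurable.aemeasurable ?_
    simp only [Complex.polarCoord_symm_apply, smul_eq_mul]
    exact (ENNReal.measurable_ofReal.comp measurable_fst).mul hm

/-- Identify the plane with `ℂ`, then rotate by minus the argument of the image of `c`. -/
lemma exists_isometry_plane (c : Plane) : ∃ L : Plane ≃ₗᵢ[ℝ] ℂ, L c = (‖c‖ : ℂ) := by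
  let L₀ : Plane ≃ₗᵢ[ℝ] ℂ := Complex.orthonormalBasisOneI.repr.symm
  refine ⟨L₀.trans (rotation (Circle.exp (-(L₀ c).arg))), ?_⟩
  have h := Complex.norm_mul_exp_arg_mul_I (L₀ c)
  rw [LinearIsometryEquiv.norm_map] at h
  rw [LinearIsometryEquiv.trans_apply, rotation_apply]
  calc _ = (Circle.exp (-(L₀ c).arg) : ℂ) * (‖c‖ * Complex.exp ((L₀ c).arg * Complex.I)) := by rw [h]
    _ = _ := by
      rw [Circle.coe_exp, mul_left_comm, ← Complex.exp_add]
      simp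

lemma norm_polar {r : ℝ} (hr : 0 ≤ r) (t : ℝ) :
    ‖(r : ℂ) * (Real.cos t + Real.sin t * Complex.I)‖ = r := by
  have := Complex.norm_exp_ofReal_mul_I t
  rw [Complex.exp_mul_I] at this
  push_cast
  rw [norm_mul, this, mul_one, Complex.norm_real, Real.norm_of_nonneg hr]

lemma lintegral_norm_plane {f : ℝ → ℝ≥0∞} (hf : Measurable f) :
    ∫⁻ x : Plane, f ‖x‖ = ∫⁻ r in Ioi (0 : ℝ), ENNReal.ofReal (2 * Real.pi * r) * f r := by
  obtain ⟨L, -⟩ := exists_isometry_plane 0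
  have hfm : Measurable fun z : ℂ => f ‖z‖ := hf.comp measurable_norm
  have h1 : ∫⁻ x : Plane, f ‖x‖ = ∫⁻ z : ℂ, f ‖z‖ := by
    rw [← L.measurePreserving.lintegral_comp hfm]
    simp
  rw [h1, lintegral_complex_polar hfm]
  refine setLIntegral_congr_fun measurableSet_Ioi fun r hr => ?_
  have hr : 0 < r := hr
  simp only [norm_polar hr.le]
  rw [lintegral_const, Measure.restrict_apply MeasurableSet.univ, univ_inter, Real.volume_Ioo,
    mul_left_comm, ← ENNReal.ofReal_mul hr.le, mul_comm]
  congr 2; ring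

/-- The cosine of half the angle of the arc of radius `y` about the origin inside a disc of radius
`R` whose centre is at distance `v`. -/
def arcCos (R v y : ℝ) : ℝ := (y ^ 2 + v ^ 2 - R ^ 2) / (2 * y * v)

/-- After rotating the centre to the positive real axis, the circle of radius `r` meets the disc in
an arc of half-angle `arccos (arcCos R ‖c‖ r)`. -/
lemma lintegral_norm_ball {f : ℝ → ℝ≥0∞} (hf : Measurable f) {c : Plane} (hc : c ≠ 0) {R : ℝ}
    (hR : 0 < R) :
    ∫⁻ x in Metric.ball c R, f ‖x‖
      = ∫⁻ r in Ioi (0 : ℝ), ENNReal.ofReal (2 * r * Real.arccos (arcCos R ‖c‖ r)) * f r := by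
  obtain ⟨L, hL⟩ := exists_isometry_plane c
  set v := ‖c‖ with hv
  have hv0 : 0 < v := norm_pos_iff.2 hc
  have hfm : Measurable fun z : ℂ => f ‖z‖ := hf.comp measurable_norm
  have h1 : ∫⁻ x in Metric.ball c R, f ‖x‖ = ∫⁻ z in Metric.ball (v : ℂ) R, f ‖z‖ := by
    rw [← L.measurePreserving.setLIntegral_comp_preimage measurableSet_ball
      hfm, ← hL]
    simp
  rw [h1, ← lintegral_indicator measurableSet_ball,
    lintegral_complex_polar (hfm.indicator measurableSet_ball)]
  refine setLIntegral_congr_fun measurableSet_Ioi fun r hr => ?_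
  have hr : 0 < r := hr
  have h2 : ∀ t : ℝ, (Metric.ball (v : ℂ) R).indicator (fun z => f ‖z‖)
      (r * (Real.cos t + Real.sin t * Complex.I))
      = {t : ℝ | arcCos R v r < Real.cos t}.indicator (fun _ => f r) t := by
    intro t
    -- The law of cosines.
    have h3 : (r * (Real.cos t + Real.sin t * Complex.I) : ℂ) ∈ Metric.ball (v : ℂ) R ↔
        t ∈ {t : ℝ | arcCos R v r < Real.cos t} := by
      rw [mem_ball_iff_norm, ← sq_lt_sq₀ (norm_nonneg _) hR.le, Complex.sq_norm,
        Complex.normSq_apply, mem_ofPred_eq, arcCos, div_lt_iff₀ (by positivity)]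
      have h4 : Real.cos t ^ 2 + Real.sin t ^ 2 = 1 := Real.cos_sq_add_sin_sq t
      simp only [Complex.sub_re, Complex.sub_im, Complex.mul_re, Complex.mul_im, Complex.add_re,
        Complex.add_im, Complex.ofReal_re, Complex.ofReal_im, Complex.I_re, Complex.I_im]
      constructor <;> intro h
      · linear_combination h - r ^ 2 * h4
      · linear_combination h + r ^ 2 * h4
    by_cases ht : t ∈ {t : ℝ | arcCos R v r < Real.cos t}
    · rw [indicator_of_mem ht, indicator_of_mem (h3.2 ht), norm_polar hr.le]
    · rw [indicator_of_notMem ht, indicator_of_notMem (fun h => ht (h3.1 h))]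
  simp_rw [h2]
  have hm : MeasurableSet {t : ℝ | arcCos R v r < Real.cos t} :=
    measurableSet_lt measurable_const Real.measurable_cos
  rw [lintegral_indicator_const hm, Measure.restrict_apply hm, setOf_lt_cos_eq, Real.volume_Ioo,
    mul_left_comm, ← ENNReal.ofReal_mul hr.le, mul_comm]
  congr 2; ring

/-! ### The path loss kernel -/

/-- The kernel `1 / (1 + r ^ α / q)`. -/
def pathKernel (α q r : ℝ) : ℝ := 1 / (1 + r ^ α / q)

lemma measurable_pathKernel (α q : ℝ) : Measurable (pathKernel α q) := by
  unfold pathKernel; fun_prop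

lemma pathKernel_nonneg {α q r : ℝ} (hq : 0 < q) (hr : 0 ≤ r) : 0 ≤ pathKernel α q r := by
  unfold pathKernel; positivity

lemma pathKernel_le_one {α q r : ℝ} (hq : 0 < q) (hr : 0 ≤ r) : pathKernel α q r ≤ 1 := by
  unfold pathKernel
  rw [div_le_one (by positivity)]
  have : 0 ≤ r ^ α / q := by positivity
  linarith

/-- The left side is the exponent density of a shot noise with exponential marks. It is correct also
at `x = e`, where the received power is infinite and the kernel equals `1`. -/
lemma one_sub_inv_edist {α q : ℝ} (hα : 0 < α) (hq : 0 < q) (x e : Plane) :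
    1 - (1 + ENNReal.ofReal q * edist x e ^ (-α))⁻¹ = ENNReal.ofReal (pathKernel α q ‖x - e‖) := by
  rw [edist_dist, dist_eq_norm]
  set r := ‖x - e‖ with hr
  rcases (norm_nonneg (x - e)).eq_or_lt with h | h
  · rw [hr, ← h, ENNReal.ofReal_zero, ENNReal.zero_rpow_of_neg (by linarith),
      ENNReal.mul_top (by simpa using hq), pathKernel, Real.zero_rpow hα.ne']
    simp
  · rw [← hr] at h
    have hp : 0 < r ^ (-α) := Real.rpow_pos_of_pos h _
    rw [ENNReal.ofReal_rpow_of_pos h, ← ENNReal.ofReal_mul hq.le, ← ENNReal.ofReal_one,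
      ← ENNReal.ofReal_add zero_le_one (by positivity),
      ← ENNReal.ofReal_inv_of_pos (by positivity), ← ENNReal.ofReal_sub _ (by positivity)]
    congr 1
    rw [pathKernel, Real.rpow_neg h.le]
    have hp' : 0 < r ^ α := Real.rpow_pos_of_pos h _
    field_simp
    ring

lemma lintegral_Ioi_mul_exp_rpow {α q t : ℝ} (hα : 2 < α) (hq : 0 < q) (ht : 0 < t) :
    ∫⁻ r in Ioi (0 : ℝ), ENNReal.ofReal (r * Real.exp (-(t / q) * r ^ α))
      = ENNReal.ofReal ((t / q) ^ (-(2 / α)) * (1 / α) * Real.Gamma (2 / α)) := by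
  have h1 := integral_rpow_mul_exp_neg_mul_rpow (p := α) (q := 1) (b := t / q) (by linarith)
    (by norm_num) (by positivity)
  have h2 := integrableOn_rpow_mul_exp_neg_mul_rpow (p := α) (s := 1) (b := t / q) (by norm_num)
    (by linarith) (by positivity)
  simp only [Real.rpow_one, one_add_one_eq_two] at h1 h2
  rw [← ofReal_integral_eq_lintegral_ofReal h2, h1, neg_div]
  filter_upwards [ae_restrict_mem measurableSet_Ioi] with r hr
  exact mul_nonneg (le_of_lt hr) (Real.exp_pos _).le

/-- The integral of the path loss kernel over the plane. -/
lemma lintegral_pathKernel {α q : ℝ} (hα : 2 < α) (hq : 0 < q) (e : Plane) :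
    ∫⁻ x : Plane, ENNReal.ofReal (pathKernel α q ‖x - e‖)
      = ENNReal.ofReal (Real.pi * q ^ (2 / α) / nsinc (2 / α)) := by
  have hα0 : 0 < α := by linarith
  set δ := 2 / α with hδ
  have hδ0 : 0 < δ := by positivity
  have hδ1 : δ < 1 := by rw [hδ, div_lt_one hα0]; exact hα
  -- Write `1 / (1 + x) = ∫ e^{-(1 + x) t} dt` and swap: the integral in `r` produces `Γ(2/α)`, the
  -- one in `t` produces `Γ(1 - 2/α)`, and the reflection formula turns their product into a sine.
  have hker : ∀ r ∈ Ioi (0 : ℝ), ENNReal.ofReal (2 * Real.pi * r) * ENNReal.ofReal (pathKernel α q r)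
      = ∫⁻ t in Ioi (0 : ℝ), ENNReal.ofReal (2 * Real.pi * Real.exp (-t)) *
          ENNReal.ofReal (r * Real.exp (-(t / q) * r ^ α)) := by
    intro r hr
    have hr : 0 < r := hr
    have hp : 0 < 1 + r ^ α / q := by positivity
    have h1 : ∀ t : ℝ, ENNReal.ofReal (2 * Real.pi * Real.exp (-t)) *
          ENNReal.ofReal (r * Real.exp (-(t / q) * r ^ α))
        = ENNReal.ofReal (2 * Real.pi * r) * ENNReal.ofReal (Real.exp (-((1 + r ^ α / q) * t))) := by
      intro t
      rw [← ENNReal.ofReal_mul (by positivity), ← ENNReal.ofReal_mul (by positivity)]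
      congr 1
      rw [show -((1 + r ^ α / q) * t) = -t + -(t / q) * r ^ α by ring, Real.exp_add]
      ring
    simp_rw [h1]
    rw [lintegral_const_mul _ (by fun_prop), lintegral_Ioi_exp_neg_mul hp]
    simp [pathKernel]
  rw [lintegral_sub_right_eq_self (fun x : Plane => ENNReal.ofReal (pathKernel α q ‖x‖)) e,
    lintegral_norm_plane (measurable_pathKernel α q).ennreal_ofReal,
    setLIntegral_congr_fun measurableSet_Ioi hker, lintegral_lintegral_swap]
  swap
  · exact Measurable.aemeasurable (by unfold Function.uncurry; fun_prop)
  have h2 : ∀ t ∈ Ioi (0 : ℝ), ∫⁻ r in Ioi (0 : ℝ), ENNReal.ofReal (2 * Real.pi * Real.exp (-t)) *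
          ENNReal.ofReal (r * Real.exp (-(t / q) * r ^ α))
      = ENNReal.ofReal (2 * Real.pi / α * q ^ δ * Real.Gamma δ *
          (Real.exp (-t) * t ^ ((1 - δ) - 1))) := by
    intro t ht
    have ht : 0 < t := ht
    rw [lintegral_const_mul _ (by fun_prop), lintegral_Ioi_mul_exp_rpow hα hq ht,
      ← ENNReal.ofReal_mul (by positivity)]
    congr 1
    rw [← hδ, Real.div_rpow ht.le hq.le, Real.rpow_neg hq.le,
      show (1 - δ) - 1 = -δ by ring]
    field_simp
  have hG := Real.Gamma_pos_of_pos hδ0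
  rw [setLIntegral_congr_fun measurableSet_Ioi h2, ← ofReal_integral_eq_lintegral_ofReal,
    integral_const_mul, ← Real.Gamma_eq_integral (by linarith), mul_assoc _ (Real.Gamma δ),
    Real.Gamma_mul_Gamma_one_sub]
  · congr 1
    have hs : 0 < Real.sin (Real.pi * δ) :=
      Real.sin_pos_of_pos_of_lt_pi (by positivity) (by nlinarith [Real.pi_pos])
    rw [nsinc, Real.sinc_of_ne_zero (by positivity), hδ]
    rw [hδ] at hs
    field_simp
  · exact (Real.GammaIntegral_convergent (by linarith)).const_mul _
  · filter_upwards [ae_restrict_mem measurableSet_Ioi] with t ht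
    have ht : 0 < t := ht
    simp only [Pi.zero_apply]
    positivity

lemma nsinc_pos {α : ℝ} (hα : 2 < α) : 0 < nsinc (2 / α) := by
  have hα0 : 0 < α := by linarith
  have hδ1 : 2 / α < 1 := by rw [div_lt_one hα0]; exact hα
  have hs : 0 < Real.sin (Real.pi * (2 / α)) :=
    Real.sin_pos_of_pos_of_lt_pi (by positivity) (by nlinarith [Real.pi_pos])
  rw [nsinc, Real.sinc_of_ne_zero (by positivity)]
  positivity

/-! ### The hole -/

lemma arcCos_of_add_le {R v y : ℝ} (hR : 0 < R) (hv : 0 < v) (h : v + R ≤ y) : 1 ≤ arcCos R v y := by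
  have hy : 0 < y := by linarith
  rw [arcCos, le_div_iff₀ (by positivity)]
  nlinarith

lemma arcCos_of_le_sub {R v y : ℝ} (hR : 0 < R) (hv : 0 < v) (hy : 0 < y) (h : y ≤ v - R) :
    1 ≤ arcCos R v y := by
  rw [arcCos, le_div_iff₀ (by positivity)]
  nlinarith

lemma arcCos_of_le_sub' {R v y : ℝ} (hv : 0 < v) (hy : 0 < y) (h : y ≤ R - v) :
    arcCos R v y ≤ -1 := by
  rw [arcCos, div_le_iff₀ (by positivity)]
  nlinarith

/-- The density of `∫ 1 / (1 + ‖x‖ ^ α / q)` over a disc, in the distance `y` to the origin. -/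
def arcKernel (α q R v y : ℝ) : ℝ := 2 * y * Real.arccos (arcCos R v y) * pathKernel α q y

lemma measurable_arcKernel (α q R : ℝ) :
    Measurable fun z : ℝ × ℝ => arcKernel α q R z.1 z.2 := by
  have h : Measurable fun z : ℝ × ℝ => Real.arccos (arcCos R z.1 z.2) :=
    Real.continuous_arccos.measurable.comp (by unfold arcCos; fun_prop)
  unfold arcKernel pathKernel
  fun_prop

lemma arcKernel_nonneg {α q R v y : ℝ} (hq : 0 < q) (hy : 0 ≤ y) : 0 ≤ arcKernel α q R v y :=
  mul_nonneg (mul_nonneg (by positivity) (Real.arccos_nonneg _)) (pathKernel_nonneg hq hy)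

lemma arcKernel_of_add_le {α q R v y : ℝ} (hR : 0 < R) (hv : 0 < v) (h : v + R ≤ y) :
    arcKernel α q R v y = 0 := by
  rw [arcKernel, Real.arccos_eq_zero.2 (arcCos_of_add_le hR hv h), mul_zero, zero_mul]

lemma lintegral_arcKernel {α q R : ℝ} (hR : 0 < R) {c e : Plane} (hc : c ≠ e) :
    ∫⁻ x in Metric.ball c R, ENNReal.ofReal (pathKernel α q ‖x - e‖)
      = ∫⁻ y in Ioi (0 : ℝ), ENNReal.ofReal (arcKernel α q R ‖c - e‖ y) := by
  have h1 : ∫⁻ x in Metric.ball c R, ENNReal.ofReal (pathKernel α q ‖x - e‖)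
      = ∫⁻ x in Metric.ball (c - e) R, ENNReal.ofReal (pathKernel α q ‖x‖) := by
    rw [← lintegral_indicator measurableSet_ball, ← lintegral_indicator measurableSet_ball,
      ← lintegral_sub_right_eq_self ((Metric.ball (c - e) R).indicator _) e]
    congr 1 with x
    by_cases hx : x ∈ Metric.ball c R
    · rw [indicator_of_mem hx, indicator_of_mem]
      rw [mem_ball_iff_norm] at hx ⊢
      rwa [sub_sub_sub_cancel_right]
    · rw [indicator_of_notMem hx, indicator_of_notMem]
      rw [mem_ball_iff_norm] at hx ⊢
      rwa [sub_sub_sub_cancel_right]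
  rw [h1, lintegral_norm_ball (measurable_pathKernel α q).ennreal_ofReal (sub_ne_zero.2 hc) hR]
  refine setLIntegral_congr_fun measurableSet_Ioi fun y hy => ?_
  have hy : 0 < y := hy
  rw [← ENNReal.ofReal_mul (mul_nonneg (by positivity) (Real.arccos_nonneg _)), arcKernel]

/-- The kernel is bounded on `(0, v + R]` and vanishes beyond, where circles miss the disc. -/
lemma integrableOn_arcKernel {α q R v : ℝ} (hq : 0 < q) (hR : 0 < R) (hv : 0 < v) :
    IntegrableOn (arcKernel α q R v) (Ioi 0) := by
  have hm : Measurable (arcKernel α q R v) := (measurable_arcKernel α q R).comp measurable_prodMk_left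
  have h1 : IntegrableOn (arcKernel α q R v) (Ioc 0 (v + R)) := by
    refine Measure.integrableOn_of_bounded (M := 2 * (v + R) * Real.pi * 1) (by simp)
      hm.aestronglyMeasurable ?_
    filter_upwards [ae_restrict_mem measurableSet_Ioc] with y hy
    rw [Real.norm_of_nonneg (arcKernel_nonneg hq hy.1.le), arcKernel]
    have := hy.1
    have := hy.2
    gcongr
    · exact pathKernel_nonneg hq hy.1.le
    · exact Real.arccos_nonneg _
    · exact Real.arccos_le_pi _
    · exact pathKernel_le_one hq hy.1.le
  have h2 : IntegrableOn (arcKernel α q R v) (Ioi (v + R)) :=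
    (integrableOn_zero (s := Ioi (v + R))).congr_fun
      (fun y hy => (arcKernel_of_add_le hR hv (le_of_lt hy)).symm) measurableSet_Ioi
  rw [← Ioc_union_Ioi_eq_Ioi (show (0 : ℝ) ≤ v + R by linarith)]
  exact h1.union h2

/-- For `c = 1 + b` the factor `(1 - t)^(c - b - 1)` has exponent zero, and the Gamma quotient
reduces to `b`. -/
lemma gaussHG_one_eq {δ z : ℝ} (hδ : 0 < δ) :
    gaussHG 1 δ (1 + δ) z = δ * ∫ t in (0 : ℝ)..1, t ^ (δ - 1) * (1 - z * t) ^ (-1 : ℝ) := by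
  have h0 : 1 + δ - δ - 1 = 0 := by ring
  have h1 : 1 + δ - δ = 1 := by ring
  have hG := Real.Gamma_pos_of_pos hδ
  rw [gaussHG, h1, add_comm, Real.Gamma_add_one hδ.ne', Real.Gamma_one, mul_one,
    mul_div_cancel_right₀ _ hG.ne']
  simp

lemma integral_pathKernel_disc {α q ρ : ℝ} (hα : 0 < α) (hq : 0 < q) (hρ : 0 ≤ ρ) :
    ∫ y in (0 : ℝ)..ρ, 2 * y * pathKernel α q y
      = ρ ^ 2 * gaussHG 1 (2 / α) (1 + 2 / α) (-(ρ ^ α / q)) := by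
  have h1 : ∫ y in (0 : ℝ)..ρ, 2 * y * pathKernel α q y
      = ρ ^ 2 * ∫ x in (0 : ℝ)..1, 2 * x * (1 + ρ ^ α / q * x ^ α)⁻¹ := by
    have h2 := intervalIntegral.mul_integral_comp_mul_left (a := 0) (b := 1)
      (f := fun y => 2 * y * pathKernel α q y) ρ
    rw [mul_zero, mul_one] at h2
    rw [← h2, sq, mul_assoc, ← intervalIntegral.integral_const_mul ρ
      fun x => 2 * x * (1 + ρ ^ α / q * x ^ α)⁻¹]
    refine congrArg (ρ * ·) (intervalIntegral.integral_congr fun x hx => ?_)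
    rw [uIcc_of_le zero_le_one] at hx
    simp only [pathKernel]
    rw [Real.mul_rpow hρ hx.1, one_div, mul_div_right_comm]
    ring
  rw [h1, gaussHG_one_eq (by positivity)]
  congr 1
  -- Substitution `t = x ^ α` in Euler's integral; the indicator restricts the half-line formula to
  -- the unit interval, which the map preserves.
  have h3 := integral_comp_rpow_Ioi (E := ℝ) (fun t => (Ioc (0 : ℝ) 1).indicator
    (fun t => t ^ (2 / α - 1) * (1 - -(ρ ^ α / q) * t) ^ (-1 : ℝ)) t) hα.ne'
  rw [setIntegral_indicator measurableSet_Ioc, inter_eq_right.2 Ioc_subset_Ioi_self,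
    ← intervalIntegral.integral_of_le zero_le_one] at h3
  rw [← h3, ← integral_const_mul, intervalIntegral.integral_of_le zero_le_one,
    ← integral_indicator measurableSet_Ioc, ← integral_indicator measurableSet_Ioi]
  congr 1 with x
  by_cases hx : x ∈ Ioi (0 : ℝ)
  · have hx0 : 0 < x := hx
    rw [indicator_of_mem hx]
    by_cases hx1 : x ≤ 1
    · have hp := Real.rpow_pos_of_pos hx0 α
      have hm1 : x ∈ Ioc (0 : ℝ) 1 := ⟨hx0, hx1⟩
      have hm2 : x ^ α ∈ Ioc (0 : ℝ) 1 := ⟨hp, Real.rpow_le_one hx0.le hx1 hα.le⟩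
      rw [indicator_of_mem hm1, indicator_of_mem hm2, Real.rpow_neg_one, abs_of_pos hα,
        smul_eq_mul, ← Real.rpow_mul hx0.le, show α * (2 / α - 1) = 1 + -(α - 1) by field_simp; ring,
        Real.rpow_add hx0, Real.rpow_one, Real.rpow_neg hx0.le]
      have := Real.rpow_pos_of_pos hx0 (α - 1)
      rw [neg_mul, sub_neg_eq_add]
      field_simp
    · rw [indicator_of_notMem (fun h => hx1 h.2), indicator_of_notMem, smul_zero, mul_zero]
      exact fun h => hx1 ((Real.rpow_le_one_iff_of_pos hx0).1 h.2 |>.elim (fun h => by linarith [h.2])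
        fun h => h.1)
  · rw [indicator_of_notMem hx, indicator_of_notMem (fun h => hx h.1)]

namespace Params

variable {K : ℕ} (p : Params K)

lemma α_pos : 0 < p.α := by linarith [p.two_lt_α]

lemma guardRadius_pos {τ : ℝ} (hτ : 0 < τ) : 0 < p.guardRadius τ :=
  Real.rpow_pos_of_pos (div_pos p.powJ_pos hτ) _

/-- The exponent of `G`. -/
def holeExp (τ v s : ℝ) : ℝ :=
  p.lamJ * ∫ y in Ioi (0 : ℝ), arcKernel p.α (s * p.powJ) (p.guardRadius τ) v y

lemma G_integrand_eq (τ v s y : ℝ) : 2 * y * p.lamJ' τ v y / (1 + y ^ p.α / (s * p.powJ))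
    = p.lamJ * arcKernel p.α (s * p.powJ) (p.guardRadius τ) v y := by
  simp only [lamJ', arcKernel, pathKernel, arcCos]
  ring

/-- Both branches of `G` are the same integral over the disc. Circles that miss the disc contribute
nothing; if the disc contains the origin, circles of radius up to `R - v` have half-angle `π`, and
their share is the hypergeometric term. -/
lemma G_eq_exp {τ v s : ℝ} (hτ : 0 < τ) (hv : 0 < v) (hs : 0 < s) :
    p.G τ v s = Real.exp (p.holeExp τ v s) := by
  have hq : 0 < s * p.powJ := mul_pos hs p.powJ_pos
  have hR := p.guardRadius_pos hτ
  set R := p.guardRadius τ with hRdef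
  have hint := integrableOn_arcKernel (α := p.α) hq hR hv
  rw [G, holeExp]
  simp only [G_integrand_eq, intervalIntegral.integral_const_mul]
  rw [← hRdef]
  split_ifs with h
  · rw [intervalIntegral.integral_of_le (by linarith)]
    congr 2
    refine (setIntegral_eq_of_subset_of_forall_sdiff_eq_zero measurableSet_Ioi
      (fun y hy => (sub_pos.2 h).trans hy.1) fun y hy => ?_).symm
    rw [arcKernel, Real.arccos_eq_zero.2, mul_zero, zero_mul]
    have hy0 : 0 < y := hy.1
    rcases le_or_gt y (v - R) with h1 | h1
    · exact arcCos_of_le_sub hR hv hy0 h1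
    · refine arcCos_of_add_le hR hv (le_of_not_gt fun h2 => hy.2 ⟨h1, h2.le⟩)
  · have h : 0 ≤ R - v := by linarith
    have h1 : ∫ y in Ioi (0 : ℝ), arcKernel p.α (s * p.powJ) R v y
        = (∫ y in (0 : ℝ)..(R - v), arcKernel p.α (s * p.powJ) R v y)
          + ∫ y in (R - v)..(R + v), arcKernel p.α (s * p.powJ) R v y := by
      rw [intervalIntegral.integral_add_adjacent_intervals,
        intervalIntegral.integral_of_le (by linarith)]
      · refine setIntegral_eq_of_subset_of_forall_sdiff_eq_zero measurableSet_Ioi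
          (fun y hy => hy.1) fun y hy => arcKernel_of_add_le hR hv ?_
        by_contra! h2
        exact hy.2 ⟨hy.1, by linarith⟩
      · rw [intervalIntegrable_iff_integrableOn_Ioc_of_le h]
        exact hint.mono_set fun y hy => hy.1
      · rw [intervalIntegrable_iff_integrableOn_Ioc_of_le (by linarith)]
        exact hint.mono_set fun y hy => h.trans_lt hy.1
    have h2 : ∫ y in (0 : ℝ)..(R - v), arcKernel p.α (s * p.powJ) R v y
        = Real.pi * ((R - v) ^ 2 * gaussHG 1 (2 / p.α) (1 + 2 / p.α)
            (-((R - v) ^ p.α / (s * p.powJ)))) := by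
      rw [← integral_pathKernel_disc p.α_pos hq h, ← intervalIntegral.integral_const_mul,
        intervalIntegral.integral_of_le h, intervalIntegral.integral_of_le h]
      refine setIntegral_congr_fun measurableSet_Ioc fun y hy => ?_
      simp only [arcKernel]
      rw [Real.arccos_eq_pi.2 (arcCos_of_le_sub' hv hy.1 hy.2)]
      ring
    rw [← Real.exp_add, h1, h2]
    congr 1
    ring

lemma lintegral_hole {τ s : ℝ} (hτ : 0 < τ) (hs : 0 < s) {c e : Plane} (hc : c ≠ e) :
    ENNReal.ofReal p.lamJ * ∫⁻ x in Metric.ball c (p.guardRadius τ),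
        ENNReal.ofReal (pathKernel p.α (s * p.powJ) ‖x - e‖)
      = ENNReal.ofReal (p.holeExp τ ‖c - e‖ s) := by
  have hq : 0 < s * p.powJ := mul_pos hs p.powJ_pos
  have hR := p.guardRadius_pos hτ
  have hv : 0 < ‖c - e‖ := norm_pos_iff.2 (sub_ne_zero.2 hc)
  rw [lintegral_arcKernel hR hc, ← ofReal_integral_eq_lintegral_ofReal
    (integrableOn_arcKernel hq hR hv), ← ENNReal.ofReal_mul p.lamJ_pos.le, holeExp]
  filter_upwards [ae_restrict_mem measurableSet_Ioi] with y hy using arcKernel_nonneg hq (le_of_lt hy)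

lemma measurable_holeExp (τ s : ℝ) : Measurable fun v => p.holeExp τ v s := by
  unfold holeExp
  refine Measurable.const_mul ?_ _
  exact ((measurable_arcKernel _ _ _).stronglyMeasurable.integral_prod_right'
    (ν := volume.restrict (Ioi 0))).measurable

end Params

/-! ### Independence of blocks of labels -/

section Block

variable {Ω ι : Type*} {mΩ : MeasurableSpace Ω} {μ : Measure Ω} {m : ι → MeasurableSpace Ω}

/-- The σ-algebra generated by a set of labels. -/
@[reducible] def block (m : ι → MeasurableSpace Ω) (T : Set ι) : MeasurableSpace Ω := ⨆ j ∈ T, m j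

lemma block_le (hm : ∀ i, m i ≤ mΩ) (T : Set ι) : block m T ≤ mΩ := iSup₂_le fun i _ => hm i

lemma le_block {T : Set ι} {j : ι} (hj : j ∈ T) : m j ≤ block m T := le_iSup₂_of_le j hj le_rfl

lemma block_mono {S T : Set ι} (h : S ⊆ T) : block m S ≤ block m T :=
  iSup₂_le fun _ hj => le_block (h hj)

/-- Induction on the finite set of blocks: a new block is disjoint from the union of the earlier
ones, so independence of two disjoint families of labels suffices. -/
lemma iIndep_block (hm : ∀ i, m i ≤ mΩ) (hi : iIndep m μ) {κ : Type*} {T : κ → Set ι}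
    (hT : Pairwise fun k l => Disjoint (T k) (T l)) : iIndep (fun k => block m (T k)) μ := by
  classical
  rw [iIndep_iff]
  intro s
  have := hi.isProbabilityMeasure
  induction s using Finset.induction_on with
  | empty => intro f _; simp
  | insert k s hk ih =>
    intro f hf
    rw [Finset.set_biInter_insert, Finset.prod_insert hk,
      ← ih fun i hi => hf i (Finset.mem_insert_of_mem hi)]
    have hd : Disjoint (T k) (⋃ l ∈ s, T l) := by
      rw [disjoint_iUnion₂_right]
      exact fun l hl => hT fun h => hk (h ▸ hl)
    refine (Indep_iff _ _ μ).1 (indep_iSup_of_disjoint hm hi hd) _ _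
      (hf k (Finset.mem_insert_self _ _)) ?_
    refine @Finset.measurableSet_biInter _ _ (block m (⋃ l ∈ s, T l)) _ _ fun l hl => ?_
    exact block_mono (subset_biUnion_of_mem (u := T) hl) _ (hf l (Finset.mem_insert_of_mem hl))

lemma iIndepFun_of_block (hm : ∀ i, m i ≤ mΩ) (hi : iIndep m μ) {κ : Type*} {T : κ → Set ι}
    (hT : Pairwise fun k l => Disjoint (T k) (T l)) {β : κ → Type*}
    [∀ k, MeasurableSpace (β k)] {f : ∀ k, Ω → β k}
    (hf : ∀ k, Measurable[block m (T k)] (f k)) : iIndepFun f μ := by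
  have h := (iIndep_iff _ μ).1 (iIndep_block hm hi hT)
  rw [iIndepFun_iff]
  exact fun s f' hf' => h s fun i hi => (hf i).comap_le _ (hf' i hi)

lemma indepFun_of_block (hm : ∀ i, m i ≤ mΩ) (hi : iIndep m μ) {S T : Set ι} (hST : Disjoint S T)
    {α β : Type*} [MeasurableSpace α] [MeasurableSpace β] {f : Ω → α} {g : Ω → β}
    (hf : Measurable[block m S] f) (hg : Measurable[block m T] g) : IndepFun f g μ :=
  indep_of_indep_of_le_right (indep_of_indep_of_le_left (indep_iSup_of_disjoint hm hi hST)
    hf.comap_le) hg.comap_le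

end Block

/-! ### Configurations -/

/-- Labels of all the random objects. -/
abbrev Label (K : ℕ) : Type := PointLabel K ⊕ FadeLabel K

/-- A realization of all the random objects. -/
abbrev Config (K : ℕ) : Type := (PointLabel K → ℕ → Plane) × (FadeLabel K → ℝ)

/-- The points of a configuration. -/
def Config.points {K : ℕ} (a : PointLabel K) (z : Config K) : ℕ → Plane := z.1 a

/-- The fading gains of a configuration. -/
def Config.fades {K : ℕ} (b : FadeLabel K) (z : Config K) : ℝ := z.2 b

lemma Config.measurable_points {K : ℕ} (a : PointLabel K) : Measurable (Config.points a) :=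
  (measurable_pi_apply a).comp measurable_fst

lemma Config.measurable_fades {K : ℕ} (b : FadeLabel K) : Measurable (Config.fades b) :=
  (measurable_pi_apply b).comp measurable_snd

open Classical in
/-- The configuration with the entries of `z` in `T` and those of `z'` elsewhere. -/
def Config.merge {K : ℕ} (T : Set (Label K)) (z z' : Config K) : Config K :=
  (fun a => if Sum.inl a ∈ T then z.1 a else z'.1 a,
    fun b => if Sum.inr b ∈ T then z.2 b else z'.2 b)

lemma Config.measurable_merge {K : ℕ} (T : Set (Label K)) :
    Measurable fun w : Config K × Config K => Config.merge T w.1 w.2 := by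
  refine Measurable.prodMk (measurable_pi_lambda _ fun a => ?_) (measurable_pi_lambda _ fun b => ?_)
  · by_cases h : Sum.inl a ∈ T
    · simp only [h, if_true]; fun_prop
    · simp only [h, if_false]; fun_prop
  · by_cases h : Sum.inr b ∈ T
    · simp only [h, if_true]; fun_prop
    · simp only [h, if_false]; fun_prop

section Network

variable {K : ℕ} {Ω : Type*} (X : PointLabel K → Ω → ℕ → Plane) (h : FadeLabel K → Ω → ℝ)

/-- The realized configuration. -/
def config (ω : Ω) : Config K := (fun a => X a ω, fun b => h b ω)

/-- The σ-algebras generated by the random objects. -/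
@[reducible] def labelSigma : Label K → MeasurableSpace Ω
  | .inl a => MeasurableSpace.comap (X a) inferInstance
  | .inr b => MeasurableSpace.comap (h b) inferInstance

lemma measurable_block_points {T : Set (Label K)} {a : PointLabel K} (ha : Sum.inl a ∈ T) :
    Measurable[block (labelSigma X h) T] (X a) :=
  measurable_iff_comap_le.2 (le_block (m := labelSigma X h) ha)

lemma measurable_block_fades {T : Set (Label K)} {b : FadeLabel K} (hb : Sum.inr b ∈ T) :
    Measurable[block (labelSigma X h) T] (h b) :=
  measurable_iff_comap_le.2 (le_block (m := labelSigma X h) hb)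

variable [mΩ : MeasurableSpace Ω] {μ : Measure Ω} {X h} {p : Params K}

namespace Params.IsNetwork

lemma points_measurable (hn : p.IsNetwork μ X h) (a : PointLabel K) : Measurable (X a) :=
  (hn.poisson a).measurable

lemma labelSigma_le (hn : p.IsNetwork μ X h) (l : Label K) : labelSigma X h l ≤ mΩ := by
  rcases l with a | b
  · exact (hn.points_measurable a).comap_le
  · exact (hn.fade_measurable b).comap_le

lemma measurable_config (hn : p.IsNetwork μ X h) : Measurable (config X h) :=
  (measurable_pi_lambda _ hn.points_measurable).prodMk (measurable_pi_lambda _ hn.fade_measurable)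

/-- Combines the three independence assumptions into one: a finite set of labels splits into point
labels and fading labels, which are independent of each other and each jointly independent. -/
lemma iIndep_labelSigma (hn : p.IsNetwork μ X h) : iIndep (labelSigma X h) μ := by
  rw [iIndep_iff]
  intro s f hf
  have h1 : ⋂ i ∈ s, f i = (⋂ a ∈ s.toLeft, f (.inl a)) ∩ ⋂ b ∈ s.toRight, f (.inr b) := by
    ext ω
    simp only [mem_iInter, mem_inter_iff, Finset.mem_toLeft, Finset.mem_toRight]
    exact ⟨fun H => ⟨fun a => H _, fun b => H _⟩, fun H i => by
      rcases i with a | b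
      · exact H.1 a
      · exact H.2 b⟩
  have h2 : ∏ i ∈ s, μ (f i)
      = (∏ a ∈ s.toLeft, μ (f (.inl a))) * ∏ b ∈ s.toRight, μ (f (.inr b)) := by
    conv_lhs => rw [← Finset.toLeft_disjSum_toRight (u := s)]
    rw [Finset.prod_disjSum]
  have hl : ∀ a ∈ s.toLeft, MeasurableSet[MeasurableSpace.comap (X a) inferInstance] (f (.inl a)) :=
    fun a ha => hf _ (Finset.mem_toLeft.1 ha)
  have hr : ∀ b ∈ s.toRight, MeasurableSet[MeasurableSpace.comap (h b) inferInstance] (f (.inr b)) :=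
    fun b hb => hf _ (Finset.mem_toRight.1 hb)
  rw [h1, h2, ← (iIndepFun_iff _ _ μ).1 hn.points_indep s.toLeft hl,
    ← (iIndepFun_iff _ _ μ).1 hn.fade_indep s.toRight hr]
  refine (Indep_iff _ _ μ).1 hn.points_fade_indep _ _ ?_ ?_
  · refine @Finset.measurableSet_biInter _ _ (_) _ _ fun a ha => ?_
    obtain ⟨A, hA, hA'⟩ := hl a ha
    exact ⟨{x | x a ∈ A}, measurable_pi_apply a hA, hA'⟩
  · refine @Finset.measurableSet_biInter _ _ (_) _ _ fun b hb => ?_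
    obtain ⟨A, hA, hA'⟩ := hr b hb
    exact ⟨{x | x b ∈ A}, measurable_pi_apply b hA, hA'⟩

/-- Integrating over an independent copy of the objects with labels outside `T`. -/
lemma lintegral_resample [IsProbabilityMeasure μ] (hn : p.IsNetwork μ X h) (T : Set (Label K))
    {Φ : Config K → ℝ≥0∞} (hΦ : Measurable Φ) :
    ∫⁻ ω, Φ (config X h ω) ∂μ
      = ∫⁻ ω, ∫⁻ ω', Φ (Config.merge T (config X h ω) (config X h ω')) ∂μ ∂μ := by
  classical
  -- An arbitrary filler. `W` and `Z` retain only the entries in `T` and outside `T`, so they are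
  -- measurable for complementary blocks, hence independent; merging them never reads the filler.
  let z₀ : Config K := (fun _ _ => 0, fun _ => 0)
  let W : Ω → Config K := fun ω => Config.merge T (config X h ω) z₀
  let Z : Ω → Config K := fun ω => Config.merge Tᶜ (config X h ω) z₀
  have hmeas : ∀ S : Set (Label K), Measurable[block (labelSigma X h) S]
      fun ω => Config.merge S (config X h ω) z₀ := by
    intro S
    unfold Config.merge
    refine Measurable.prodMk (m := block (labelSigma X h) S) ?_ ?_
    · refine @measurable_pi_lambda _ _ _ (block (labelSigma X h) S) _ _ fun a => ?_
      by_cases ha : Sum.inl a ∈ S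
      · simp only [ha, if_true]
        exact measurable_block_points X h ha
      · simp only [ha, if_false]
        exact @measurable_const _ _ _ (block (labelSigma X h) S) _
    · refine @measurable_pi_lambda _ _ _ (block (labelSigma X h) S) _ _ fun b => ?_
      by_cases hb : Sum.inr b ∈ S
      · simp only [hb, if_true]
        exact measurable_block_fades X h hb
      · simp only [hb, if_false]
        exact @measurable_const _ _ _ (block (labelSigma X h) S) _
  have hind : IndepFun W Z μ := indepFun_of_block hn.labelSigma_le hn.iIndep_labelSigma
    disjoint_compl_right (hmeas T) (hmeas Tᶜ)
  have hle := block_le hn.labelSigma_le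
  have key := lintegral_of_indepFun ((hmeas T).mono (hle T) le_rfl)
    ((hmeas Tᶜ).mono (hle Tᶜ) le_rfl) hind (F := fun w z => Φ (Config.merge T w z))
    (hΦ.comp (Config.measurable_merge T))
  have hm : ∀ ω ω', Config.merge T (W ω) (Z ω')
      = Config.merge T (config X h ω) (config X h ω') := by
    intro ω ω'
    refine Prod.ext (funext fun a => ?_) (funext fun b => ?_)
    · by_cases ha : Sum.inl a ∈ T <;> simp [W, Z, Config.merge, ha]
    · by_cases hb : Sum.inr b ∈ T <;> simp [W, Z, Config.merge, hb]
  have hs : ∀ ω, Config.merge T (config X h ω) (config X h ω) = config X h ω := by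
    intro ω
    refine Prod.ext (funext fun a => ?_) (funext fun b => ?_) <;> simp [Config.merge]
  have key' : ∫⁻ ω, Φ (Config.merge T (W ω) (Z ω)) ∂μ
      = ∫⁻ ω, ∫⁻ ω', Φ (Config.merge T (W ω) (Z ω')) ∂μ ∂μ := key
  simpa only [hm, hs] using key'

end Params.IsNetwork

end Network

namespace Params

variable {K : ℕ} {p : Params K}

lemma density_pos (p : Params K) (a : PointLabel K) : 0 < p.density a := by
  cases a <;> simp [density, p.lamB_pos, p.lamE_pos, p.lamJ_pos]

lemma ofReal_mul_rxPower (p : Params K) {s P : ℝ} (hs : 0 < s) (hP : 0 < P) (g : ℝ) (x e : Plane) :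
    ENNReal.ofReal s * p.rxPower P g x e
      = ENNReal.ofReal (s * P) * edist x e ^ (-p.α) * ENNReal.ofReal g := by
  rw [rxPower, ENNReal.ofReal_mul hP.le, ENNReal.ofReal_mul hs.le]
  ring

lemma measurable_rxPower {Ω : Type*} {m : MeasurableSpace Ω} (p : Params K) (P : ℝ) {g : Ω → ℝ}
    {x e : Ω → Plane} (hg : Measurable g) (hx : Measurable x) (he : Measurable e) :
    Measurable fun ω => p.rxPower P (g ω) (x ω) (e ω) := by
  unfold rxPower
  exact (hg.const_mul P).ennreal_ofReal.mul ((hx.edist he).pow_const _)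

lemma measurable_tsum_rxPower {Ω : Type*} {m : MeasurableSpace Ω} (p : Params K) (P : ℝ)
    {Y : Ω → ℕ → Plane} {g : ℕ → Ω → ℝ} {e : Ω → Plane} (hY : Measurable Y)
    (hg : ∀ n, Measurable (g n)) (he : Measurable e) :
    Measurable fun ω => ∑' n : ℕ, p.rxPower P (g n ω) (Y ω n) (e ω) :=
  Measurable.tsum fun n => p.measurable_rxPower _ (hg n) ((measurable_pi_apply n).comp hY) he

/-! ### Interference at a given location -/

section Random

variable {Ω : Type*}

/-- The power received at `e` from the points of the processes `Y t`. -/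
def fieldAt (p : Params K) (P : Fin K → ℝ) (Y : Fin K → Ω → ℕ → Plane) (g : Fin K → ℕ → Ω → ℝ)
    (e : Plane) (ω : Ω) : ℝ≥0∞ :=
  ∑ t : Fin K, ∑' n : ℕ, p.rxPower (P t) (g t n ω) (Y t ω n) e

lemma measurable_fieldAt {m : MeasurableSpace Ω} (p : Params K) (P : Fin K → ℝ)
    {Y : Fin K → Ω → ℕ → Plane} {g : Fin K → ℕ → Ω → ℝ} {e : Ω → Plane}
    (hY : ∀ t, Measurable (Y t)) (hg : ∀ t n, Measurable (g t n)) (he : Measurable e) :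
    Measurable fun ω => p.fieldAt P Y g (e ω) ω :=
  Finset.measurable_sum _ fun t _ => p.measurable_tsum_rxPower _ (hY t) (hg t) he

variable (X : PointLabel K → Ω → ℕ → Plane) (h : FadeLabel K → Ω → ℝ)

/-- The interference from the base stations that eavesdropper `i` would see at `e`. -/
def intfBAt (p : Params K) (i : ℕ) (e : Plane) (ω : Ω) : ℝ≥0∞ :=
  p.fieldAt p.powB (fun t => X (.intStation i t)) (fun t n => h (.station i t n)) e ω

/-- The interference from the scheduled users that eavesdropper `i` would see at `e`. -/
def intfUAt (p : Params K) (i : ℕ) (e : Plane) (ω : Ω) : ℝ≥0∞ :=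
  p.fieldAt (fun _ => p.powU) (fun t => X (.intUser i t)) (fun t n => h (.user i t n)) e ω

/-- The `m`-th scheduled user of tier `t` is the hole centre closest to `e`. -/
def IsClosestAt (i : ℕ) (e : Plane) (ω : Ω) (t : Fin K) (m : ℕ) : Prop :=
  ∀ (t' : Fin K) (m' : ℕ), dist (X (.hole i t) ω m) e ≤ dist (X (.hole i t') ω m') e

/-- The jammers that eavesdropper `i` would see active at `e`. -/
def activeAt (p : Params K) (τ : ℝ) (i : ℕ) (e : Plane) (ω : Ω) : Set ℕ :=
  {n | ∀ (t : Fin K) (m : ℕ), IsClosestAt X i e ω t m →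
    X (.jammer i) ω n ∉ Metric.ball (X (.hole i t) ω m) (p.guardRadius τ)}

/-- The interference from the active jammers that eavesdropper `i` would see at `e`. -/
def intfJAt (p : Params K) (τ : ℝ) (i : ℕ) (e : Plane) (ω : Ω) : ℝ≥0∞ :=
  ∑' n : ℕ, (p.activeAt X τ i e ω).indicator
    (fun n => p.rxPower p.powJ (h (.jammer i n) ω) (X (.jammer i) ω n) e) n

lemma intfB_eq (p : Params K) (i : ℕ) (ω : Ω) :
    p.intfB X h i ω = p.intfBAt X h i (X .eavesdropper ω i) ω := rfl

lemma intfU_eq (p : Params K) (i : ℕ) (ω : Ω) :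
    p.intfU X h i ω = p.intfUAt X h i (X .eavesdropper ω i) ω := rfl

/-- The sum over a random subtype becomes a sum over `ℕ` with an indicator, whose terms can be
measured one by one. -/
lemma intfJ_eq (p : Params K) (τ : ℝ) (i : ℕ) (ω : Ω) :
    p.intfJ X h τ i ω = p.intfJAt X h τ i (X .eavesdropper ω i) ω :=
  tsum_subtype (p.activeJammers X τ i ω)
    fun n => p.rxPower p.powJ (h (.jammer i n) ω) (X (.jammer i) ω n) (X .eavesdropper ω i)

variable {X h}

lemma measurable_intfBAt {m : MeasurableSpace Ω} (p : Params K) {i : ℕ} {e : Ω → Plane}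
    (hX : ∀ t, Measurable (X (.intStation i t))) (hh : ∀ t n, Measurable (h (.station i t n)))
    (he : Measurable e) : Measurable fun ω => p.intfBAt X h i (e ω) ω :=
  p.measurable_fieldAt _ hX hh he

lemma measurable_intfUAt {m : MeasurableSpace Ω} (p : Params K) {i : ℕ} {e : Ω → Plane}
    (hX : ∀ t, Measurable (X (.intUser i t))) (hh : ∀ t n, Measurable (h (.user i t n)))
    (he : Measurable e) : Measurable fun ω => p.intfUAt X h i (e ω) ω :=
  p.measurable_fieldAt _ hX hh he

lemma measurable_intfJAt {m : MeasurableSpace Ω} (p : Params K) (τ : ℝ) {i : ℕ} {e : Ω → Plane}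
    (hX : ∀ t, Measurable (X (.hole i t))) (hJ : Measurable (X (.jammer i)))
    (hh : ∀ n, Measurable (h (.jammer i n))) (he : Measurable e) :
    Measurable fun ω => p.intfJAt X h τ i (e ω) ω := by
  have hX' : ∀ t n, Measurable fun ω => X (.hole i t) ω n := fun t n =>
    (measurable_pi_apply n).comp (hX t)
  have hJ' : ∀ n, Measurable fun ω => X (.jammer i) ω n := fun n =>
    (measurable_pi_apply n).comp hJ
  refine Measurable.tsum fun n => ?_
  have hA : MeasurableSet {ω | n ∈ p.activeAt X τ i (e ω) ω} := by
    have h1 : {ω | n ∈ p.activeAt X τ i (e ω) ω} = ⋂ t : Fin K, ⋂ m : ℕ,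
        ({ω | IsClosestAt X i (e ω) ω t m}ᶜ ∪
          {ω | p.guardRadius τ ≤ dist (X (.jammer i) ω n) (X (.hole i t) ω m)}) := by
      ext ω
      simp [activeAt, imp_iff_not_or]
    rw [h1]
    refine MeasurableSet.iInter fun t => MeasurableSet.iInter fun m => MeasurableSet.union ?_ ?_
    · refine MeasurableSet.compl ?_
      simp only [IsClosestAt, ofPred_forall]
      exact MeasurableSet.iInter fun t' => MeasurableSet.iInter fun m' =>
        measurableSet_le ((hX' t m).dist he) ((hX' t' m').dist he)
    · exact measurableSet_le measurable_const ((hJ' n).dist (hX' t m))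
  exact (p.measurable_rxPower _ (hh n) (hJ' n) he).indicator hA

end Random

/-! ### Laplace transforms at a given location -/

namespace IsNetwork

variable {Ω : Type*} [MeasurableSpace Ω] {μ : Measure Ω} [IsProbabilityMeasure μ]
  {X : PointLabel K → Ω → ℕ → Plane} {h : FadeLabel K → Ω → ℝ}

lemma hasPoissonLaplace (hn : p.IsNetwork μ X h) (a : PointLabel K) :
    HasPoissonLaplace (fun j ω => X a ω j) (ENNReal.ofReal (p.density a) • volume) μ :=
  have : SigmaFinite (ENNReal.ofReal (p.density a) • (volume : Measure Plane)) :=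
    inferInstanceAs (SigmaFinite ((p.density a).toNNReal • (volume : Measure Plane)))
  IsPoissonProcess.hasPoissonLaplace (hn.poisson a)

lemma ae_ne (hn : p.IsNetwork μ X h) (a : PointLabel K) (e : Plane) :
    ∀ᵐ ω ∂μ, ∀ n, X a ω n ≠ e := by
  have h1 := (hn.hasPoissonLaplace a).void (measurableSet_singleton e)
  simp only [Measure.smul_apply, measure_singleton, smul_zero, expNeg_zero, mem_singleton_iff] at h1
  have hm : MeasurableSet {ω | ∀ n, X a ω n ≠ e} := by
    simp only [ofPred_forall]
    exact MeasurableSet.iInter fun n =>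
      (((measurable_pi_apply n).comp (hn.points_measurable a)) (measurableSet_singleton e)).compl
  exact (prob_compl_eq_zero_iff hm).2 h1

/-- By independence the Laplace functional of the union factors and the exponents add up, so the
intensity is the sum of the image measures. The pairs `κ × ℕ` serve as indices, so no enumeration of
the union is needed. -/
lemma superpose (hn : p.IsNetwork μ X h) {κ : Type*} [Fintype κ] {a : κ → PointLabel K}
    (ha : Function.Injective a) {φ : κ → Plane → ℝ≥0∞} (hφ : ∀ t, Measurable (φ t)) :
    HasPoissonLaplace (fun (j : κ × ℕ) ω => φ j.1 (X (a j.1) ω j.2))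
      (∑ t, (ENNReal.ofReal (p.density (a t)) • (volume : Measure Plane)).map (φ t)) μ := by
  have hm : ∀ t n, Measurable fun ω => X (a t) ω n := fun t n =>
    (measurable_pi_apply n).comp (hn.points_measurable _)
  refine ⟨fun j => (hφ _).comp (hm _ _), fun g hg => ?_⟩
  have hm' : ∀ t, Measurable fun x : ℕ → Plane => ∑' n, g (φ t (x n)) := fun t =>
    Measurable.tsum fun n => hg.comp ((hφ t).comp (measurable_pi_apply n))
  have hprod : ∀ ω, ∑' j : κ × ℕ, g (φ j.1 (X (a j.1) ω j.2))
      = ∑' t, ∑' n, g (φ t (X (a t) ω n)) := fun ω =>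
    ENNReal.tsum_prod (f := fun t n => g (φ t (X (a t) ω n)))
  simp_rw [hprod]
  rw [lintegral_expNeg_tsum (ξ := fun t ω => ∑' n, g (φ t (X (a t) ω n)))
    (c := fun t => ∫⁻ x, (1 - expNeg (g (φ t x)))
      ∂(ENNReal.ofReal (p.density (a t)) • (volume : Measure Plane)))]
  · rw [tsum_fintype, lintegral_finsetSum_measure]
    congr 1
    refine Finset.sum_congr rfl fun t _ => ?_
    have hg' : Measurable fun y => 1 - expNeg (g y) :=
      measurable_const.sub (measurable_expNeg.comp hg)
    rw [lintegral_map hg' (hφ t)]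
  · exact fun t => (hm' t).comp (hn.points_measurable _)
  · exact (hn.points_indep.precomp ha).comp (fun t x => ∑' n, g (φ t (x n))) hm'
  · exact fun t => (hn.hasPoissonLaplace (a t)).laplace _ (hg.comp (hφ t))

/-- The area of a disc is linear in its squared radius: this is why scaled squared distances form a
process of constant rate on the half-line. -/
lemma volume_mul_sq_lt {c : ℝ} (hc : 0 < c) (e : Plane) (r : ℝ≥0∞) :
    (volume : Measure Plane) {x | ENNReal.ofReal c * edist x e ^ 2 < r}
      = ENNReal.ofReal (Real.pi / c) * r := by
  rcases eq_or_ne r ∞ with rfl | hr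
  · have h1 : {x : Plane | ENNReal.ofReal c * edist x e ^ 2 < ∞} = univ :=
      eq_univ_of_forall fun x => ENNReal.mul_lt_top (by simp)
        (ENNReal.pow_lt_top (edist_lt_top x e))
    have : 0 < Real.pi / c := by positivity
    rw [h1, ENNReal.mul_top (by simpa using this), measure_univ_of_isAddLeftInvariant]
  · have h1 : {x : Plane | ENNReal.ofReal c * edist x e ^ 2 < r}
        = Metric.ball e (Real.sqrt (r.toReal / c)) := by
      ext x
      rw [mem_ofPred_eq, Metric.mem_ball, edist_dist, ← ENNReal.ofReal_pow dist_nonneg,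
        ← ENNReal.ofReal_mul hc.le, ENNReal.ofReal_lt_iff_lt_toReal (by positivity) hr,
        Real.lt_sqrt dist_nonneg, lt_div_iff₀ hc, mul_comm]
    rw [h1, EuclideanSpace.volume_ball_fin_two, ← ENNReal.ofReal_pow (Real.sqrt_nonneg _),
      Real.sq_sqrt (by positivity), ← ENNReal.ofReal_mul (by positivity)]
    conv_rhs => rw [← ENNReal.ofReal_toReal hr, ← ENNReal.ofReal_mul (by positivity)]
    congr 1; ring

lemma superpose_Iio (p : Params K) {κ : Type*} [Fintype κ] (a : κ → PointLabel K) {c : κ → ℝ}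
    (hc : ∀ t, 0 < c t) (e : Plane) (r : ℝ≥0∞) :
    (∑ t, (ENNReal.ofReal (p.density (a t)) • (volume : Measure Plane)).map
        fun x => ENNReal.ofReal (c t) * edist x e ^ 2) (Iio r)
      = ENNReal.ofReal (∑ t, Real.pi * p.density (a t) / c t) * r := by
  rw [Measure.finsetSum_apply, ENNReal.ofReal_sum_of_nonneg, Finset.sum_mul]
  · refine Finset.sum_congr rfl fun t _ => ?_
    rw [Measure.map_apply (by fun_prop) measurableSet_Iio, Measure.smul_apply, smul_eq_mul]
    have h1 := volume_mul_sq_lt (hc t) e r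
    rw [show (fun x : Plane => ENNReal.ofReal (c t) * edist x e ^ 2) ⁻¹' Iio r
      = {x | ENNReal.ofReal (c t) * edist x e ^ 2 < r} from rfl, h1, ← mul_assoc,
      ← ENNReal.ofReal_mul (p.density_pos _).le]
    congr 2; ring
  · intro t _
    have := p.density_pos (a t)
    have := hc t
    positivity

/-- The Laplace transform of the power received from the points of one process in a region. -/
lemma lintegral_expNeg_tier (hn : p.IsNetwork μ X h) (a : PointLabel K) {b : ℕ → FadeLabel K}
    (hb : Function.Injective b) {D : Set Plane} (hD : MeasurableSet D) {s P : ℝ} (hs : 0 < s)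
    (hP : 0 < P) (e : Plane) :
    ∫⁻ ω, expNeg (ENNReal.ofReal s *
        ∑' n, D.indicator (fun x => p.rxPower P (h (b n) ω) x e) (X a ω n)) ∂μ
      = expNeg (ENNReal.ofReal (p.density a) *
          ∫⁻ x in D, ENNReal.ofReal (pathKernel p.α (s * P) ‖x - e‖)) := by
  set w : Plane → ℝ≥0∞ := D.indicator fun x => ENNReal.ofReal (s * P) * edist x e ^ (-p.α) with hw
  have hwm : Measurable w := Measurable.indicator (by fun_prop) hD
  have hind : IndepFun (fun ω n => X a ω n) (fun ω n => h (b n) ω) μ :=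
    hn.points_fade_indep.comp (φ := fun x : PointLabel K → ℕ → Plane => x a)
      (ψ := fun g : FadeLabel K → ℝ => fun n => g (b n)) (measurable_pi_apply a)
      (measurable_pi_lambda _ fun n => measurable_pi_apply _)
  have key := (hn.hasPoissonLaplace a).shot_noise (h := fun n => h (b n))
    (fun n => hn.fade_measurable _) (fun n => hn.fade_law _) (hn.fade_indep.precomp hb) hind hwm
  have h1 : ∀ ω, ENNReal.ofReal s *
      ∑' n, D.indicator (fun x => p.rxPower P (h (b n) ω) x e) (X a ω n)
      = ∑' n, w (X a ω n) * ENNReal.ofReal (h (b n) ω) := by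
    intro ω
    rw [← ENNReal.tsum_mul_left]
    congr 1 with n
    by_cases hx : X a ω n ∈ D
    · rw [hw, indicator_of_mem hx, indicator_of_mem hx, p.ofReal_mul_rxPower hs hP]
    · rw [hw, indicator_of_notMem hx, indicator_of_notMem hx, mul_zero, zero_mul]
  simp_rw [h1]
  rw [key, lintegral_smul_measure, smul_eq_mul, ← lintegral_indicator hD]
  congr 3 with x
  by_cases hx : x ∈ D
  · rw [hw, indicator_of_mem hx, indicator_of_mem hx, one_sub_inv_edist p.α_pos (mul_pos hs hP)]
  · rw [hw, indicator_of_notMem hx, indicator_of_notMem hx]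
    simp

/-- The tiers use disjoint blocks of labels, so the Laplace transform is the product of those of the
single tiers. Stated for general labels to cover both stations and users. -/
lemma lintegral_expNeg_field (hn : p.IsNetwork μ X h) {a : Fin K → PointLabel K}
    (ha : Function.Injective a) {b : Fin K → ℕ → FadeLabel K}
    (hb : ∀ t t' n n', b t n = b t' n' → t = t' ∧ n = n') {P : Fin K → ℝ} (hP : ∀ t, 0 < P t)
    {s : ℝ} (hs : 0 < s) (e : Plane) :
    ∫⁻ ω, expNeg (ENNReal.ofReal s *
        p.fieldAt P (fun t => X (a t)) (fun t n => h (b t n)) e ω) ∂μ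
      = ENNReal.ofReal (Real.exp (-(∑ t, p.density (a t) *
          (Real.pi * (s * P t) ^ (2 / p.α) / nsinc (2 / p.α))))) := by
  let T : Fin K → Set (Label K) := fun t => insert (.inl (a t)) (range fun n => .inr (b t n))
  have hT : Pairwise fun t t' => Disjoint (T t) (T t') := by
    intro t t' htt'
    rw [disjoint_left]
    rintro l (rfl | ⟨n, rfl⟩) (h | ⟨n', h⟩)
    · exact htt' (ha (Sum.inl_injective h))
    · cases h
    · cases h
    · exact htt' (hb _ _ _ _ (Sum.inr_injective h)).1.symm
  let ξ : Fin K → Ω → ℝ≥0∞ := fun t ω => ENNReal.ofReal s *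
    ∑' n, p.rxPower (P t) (h (b t n) ω) (X (a t) ω n) e
  have hξ : ∀ t, Measurable[block (labelSigma X h) (T t)] (ξ t) := by
    intro t
    have hf : ∀ n, Measurable[block (labelSigma X h) (T t)] (h (b t n)) := fun n =>
      measurable_block_fades X h (mem_insert_of_mem _ ⟨n, rfl⟩)
    have hp : Measurable[block (labelSigma X h) (T t)] (X (a t)) :=
      measurable_block_points X h (mem_insert _ _)
    exact (measurable_tsum_rxPower (m := block (labelSigma X h) (T t)) p (P t) hp hf
      (@measurable_const _ _ _ (block (labelSigma X h) (T t)) e)).const_mul _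
  have h1 : ∀ ω, ENNReal.ofReal s * p.fieldAt P (fun t => X (a t)) (fun t n => h (b t n)) e ω
      = ∑' t, ξ t ω := by
    intro ω
    rw [tsum_fintype, fieldAt, Finset.mul_sum]
  simp_rw [h1]
  have hpos : ∀ t, 0 ≤ Real.pi * (s * P t) ^ (2 / p.α) / nsinc (2 / p.α) := fun t => by
    have := nsinc_pos p.two_lt_α
    have := hP t
    positivity
  rw [lintegral_expNeg_tsum (c := fun t => ENNReal.ofReal (p.density (a t) *
    (Real.pi * (s * P t) ^ (2 / p.α) / nsinc (2 / p.α)))), tsum_fintype,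
    ← ENNReal.ofReal_sum_of_nonneg, expNeg_ofReal]
  · exact Finset.sum_nonneg fun t _ => mul_nonneg (p.density_pos _).le (hpos t)
  · exact fun t _ => mul_nonneg (p.density_pos _).le (hpos t)
  · exact fun t => (hξ t).mono (block_le hn.labelSigma_le _) le_rfl
  · exact iIndepFun_of_block hn.labelSigma_le hn.iIndep_labelSigma hT hξ
  · intro t
    have := hn.lintegral_expNeg_tier (a t) (b := b t) (fun n n' hnn => (hb _ _ _ _ hnn).2)
      MeasurableSet.univ hs (hP t) e
    simp only [indicator_univ, Measure.restrict_univ,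
      lintegral_pathKernel p.two_lt_α (mul_pos hs (hP t))] at this
    rw [ENNReal.ofReal_mul (p.density_pos _).le, ← this]

lemma lintegral_expNeg_intfBAt (hn : p.IsNetwork μ X h) (i : ℕ) {s : ℝ} (hs : 0 < s) (e : Plane) :
    ∫⁻ ω, expNeg (ENNReal.ofReal s * p.intfBAt X h i e ω) ∂μ = ENNReal.ofReal (p.lapB s) := by
  refine (hn.lintegral_expNeg_field (a := fun t => .intStation i t)
    (b := fun t n => .station i t n) (fun t t' h => by simpa using h)
    (fun t t' n n' h => by simpa using h) p.powB_pos hs e).trans ?_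
  rw [lapB]
  congr 3
  rw [neg_div, Finset.mul_sum, Finset.sum_div]
  congr 1
  refine Finset.sum_congr rfl fun t _ => ?_
  rw [Real.mul_rpow hs.le (p.powB_pos t).le, density]
  ring

lemma lintegral_expNeg_intfUAt (hn : p.IsNetwork μ X h) (i : ℕ) {s : ℝ} (hs : 0 < s) (e : Plane) :
    ∫⁻ ω, expNeg (ENNReal.ofReal s * p.intfUAt X h i e ω) ∂μ = ENNReal.ofReal (p.lapU s) := by
  refine (hn.lintegral_expNeg_field (a := fun t => .intUser i t)
    (b := fun t n => .user i t n) (fun t t' h => by simpa using h)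
    (fun t t' n n' h => by simpa using h) (fun _ => p.powU_pos) hs e).trans ?_
  rw [lapU, lamS]
  congr 3
  rw [← Finset.sum_mul]
  simp only [density]
  ring

end IsNetwork

end Params

/-! ### Jammer interference with the closest hole removed -/

lemma Config.points_merge_of_mem {K : ℕ} {T : Set (Label K)} {a : PointLabel K}
    (ha : Sum.inl a ∈ T) (z z' : Config K) :
    Config.points a (Config.merge T z z') = Config.points a z := by
  simp [Config.points, Config.merge, ha]

lemma Config.points_merge_of_notMem {K : ℕ} {T : Set (Label K)} {a : PointLabel K}
    (ha : Sum.inl a ∉ T) (z z' : Config K) :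
    Config.points a (Config.merge T z z') = Config.points a z' := by
  simp [Config.points, Config.merge, ha]

lemma Config.fades_merge_of_notMem {K : ℕ} {T : Set (Label K)} {b : FadeLabel K}
    (hb : Sum.inr b ∉ T) (z z' : Config K) :
    Config.fades b (Config.merge T z z') = Config.fades b z' := by
  simp [Config.fades, Config.merge, hb]

lemma sq_edist_le_sq_edist {x y e : Plane} :
    edist x e ^ 2 ≤ edist y e ^ 2 ↔ dist x e ≤ dist y e := by
  rw [edist_dist, edist_dist, ← ENNReal.ofReal_pow dist_nonneg, ← ENNReal.ofReal_pow dist_nonneg,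
    ENNReal.ofReal_le_ofReal_iff (by positivity), sq_le_sq₀ dist_nonneg dist_nonneg]

lemma lintegral_Ioi_comp_sq (F : ℝ → ℝ≥0∞) :
    ∫⁻ x in Ioi (0 : ℝ), F x = ∫⁻ v in Ioi (0 : ℝ), ENNReal.ofReal (2 * v) * F (v ^ 2) := by
  have himg : (fun v : ℝ => v ^ 2) '' Ioi 0 = Ioi 0 := by
    ext x
    refine ⟨?_, fun hx => ⟨Real.sqrt x, Real.sqrt_pos.2 hx, Real.sq_sqrt (le_of_lt hx)⟩⟩
    rintro ⟨v, hv, rfl⟩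
    exact pow_pos (mem_Ioi.1 hv) 2
  have h1 := lintegral_image_eq_lintegral_abs_deriv_mul (f := fun v : ℝ => v ^ 2)
    (f' := fun v => 2 * v) measurableSet_Ioi
    (fun v _ => by simpa using (hasDerivAt_pow 2 v).hasDerivWithinAt) (fun x hx y hy hxy => by
      exact (pow_left_inj₀ (le_of_lt hx) (le_of_lt hy) two_ne_zero).1 hxy) F
  rw [himg] at h1
  rw [h1]
  refine setLIntegral_congr_fun measurableSet_Ioi fun v hv => ?_
  have hv : 0 < v := hv
  rw [abs_of_pos (by positivity)]

namespace Params

variable {K : ℕ} {p : Params K}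

/-- The Laplace transform of the interference from all the jammers, without a hole. -/
def lapAllJ (p : Params K) (s : ℝ) : ℝ :=
  Real.exp (-(Real.pi * p.lamJ * (s * p.powJ) ^ (2 / p.α)) / nsinc (2 / p.α))

lemma lamS_pos (p : Params K) (hK : 0 < K) : 0 < p.lamS := by
  have : Nonempty (Fin K) := ⟨⟨0, hK⟩⟩
  exact Finset.sum_pos (fun t _ => p.lamB_pos t) Finset.univ_nonempty

/-- Disc and complement add up to the plane, so their `expNeg` factors multiply to `lapAllJ`;
multiplying by the exponential of the disc integral avoids a subtraction in `[0, ∞]`. -/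
lemma expNeg_compl_hole (p : Params K) {τ s : ℝ} (hτ : 0 < τ) (hs : 0 < s) {c e : Plane}
    (hc : c ≠ e) :
    expNeg (ENNReal.ofReal p.lamJ * ∫⁻ x in (Metric.ball c (p.guardRadius τ))ᶜ,
        ENNReal.ofReal (pathKernel p.α (s * p.powJ) ‖x - e‖))
      = ENNReal.ofReal (p.lapAllJ s * Real.exp (p.holeExp τ ‖c - e‖ s)) := by
  have hq : 0 < s * p.powJ := mul_pos hs p.powJ_pos
  have h1 := lintegral_add_compl (μ := volume)
    (fun x : Plane => ENNReal.ofReal (pathKernel p.α (s * p.powJ) ‖x - e‖))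
    (measurableSet_ball (x := c) (ε := p.guardRadius τ))
  rw [lintegral_pathKernel p.two_lt_α hq] at h1
  have hH : 0 ≤ p.holeExp τ ‖c - e‖ s := mul_nonneg p.lamJ_pos.le
    (setIntegral_nonneg measurableSet_Ioi fun y hy => arcKernel_nonneg hq (le_of_lt hy))
  have hs' := nsinc_pos p.two_lt_α
  have h2 := congrArg (fun y => expNeg (ENNReal.ofReal p.lamJ * y)) h1
  simp only [mul_add, expNeg_add, p.lintegral_hole hτ hs hc, expNeg_ofReal hH] at h2
  rw [← ENNReal.ofReal_mul p.lamJ_pos.le, expNeg_ofReal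
    (mul_nonneg p.lamJ_pos.le (by positivity))] at h2
  rw [lapAllJ, mul_comm (Real.exp _), ENNReal.ofReal_mul (Real.exp_pos _).le,
    show -(Real.pi * p.lamJ * (s * p.powJ) ^ (2 / p.α)) / nsinc (2 / p.α)
      = -(p.lamJ * (Real.pi * (s * p.powJ) ^ (2 / p.α) / nsinc (2 / p.α))) by ring,
    ← h2, ← mul_assoc, ← ENNReal.ofReal_mul (Real.exp_pos _).le, ← Real.exp_add]
  simp

lemma lapJIntegrand_eq (p : Params K) {τ v s : ℝ} (hτ : 0 < τ) (hv : 0 < v) (hs : 0 < s) :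
    p.lapJIntegrand τ s v = Real.exp (p.holeExp τ v s) *
      (2 * Real.pi * p.lamS * Real.exp (-(Real.pi * p.lamS * v ^ 2)) * v) := by
  rw [lapJIntegrand, p.G_eq_exp hτ hv hs]

namespace IsNetwork

variable {Ω : Type*} [MeasurableSpace Ω] {μ : Measure Ω} [IsProbabilityMeasure μ]
  {X : PointLabel K → Ω → ℕ → Plane} {h : FadeLabel K → Ω → ℝ}

lemma lintegral_expNeg_intfJAt_of_hole (hn : p.IsNetwork μ X h) {τ s : ℝ} (hτ : 0 < τ)
    (hs : 0 < s) (i : ℕ) {e c : Plane} (hc : c ≠ e) :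
    ∫⁻ ω, expNeg (ENNReal.ofReal s * ∑' n, (Metric.ball c (p.guardRadius τ))ᶜ.indicator
        (fun x => p.rxPower p.powJ (h (.jammer i n) ω) x e) (X (.jammer i) ω n)) ∂μ
      = ENNReal.ofReal (p.lapAllJ s * Real.exp (p.holeExp τ ‖c - e‖ s)) := by
  rw [hn.lintegral_expNeg_tier (.jammer i) (b := fun n => .jammer i n)
    (fun n n' h => by simpa using h) measurableSet_ball.compl hs p.powJ_pos e]
  exact p.expNeg_compl_hole hτ hs hc

/-- Freeze the hole centres and resample the rest. Almost surely one centre is strictly closest, so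
the active jammers are those outside a fixed disc, and only the distance of that centre matters; its
square is exponential of rate `π lamS`. -/
lemma lintegral_expNeg_intfJAt (hn : p.IsNetwork μ X h) (hK : 0 < K) {τ s : ℝ} (hτ : 0 < τ)
    (hs : 0 < s) (i : ℕ) (e : Plane) :
    ∫⁻ ω, expNeg (ENNReal.ofReal s * p.intfJAt X h τ i e ω) ∂μ
      = ∫⁻ v in Ioi (0 : ℝ), ENNReal.ofReal (p.lapAllJ s * p.lapJIntegrand τ s v) := by
  let Φ : Config K → ℝ≥0∞ := fun z =>
    expNeg (ENNReal.ofReal s * p.intfJAt Config.points Config.fades τ i e z)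
  have hΦ : Measurable Φ := measurable_expNeg.comp ((p.measurable_intfJAt τ
    (fun t => Config.measurable_points _) (Config.measurable_points _)
    (fun n => Config.measurable_fades _) measurable_const).const_mul _)
  let T : Set (Label K) := range fun t => .inl (.hole i t)
  let Y : Fin K × ℕ → Ω → ℝ≥0∞ := fun j ω => ENNReal.ofReal 1 * edist (X (.hole i j.1) ω j.2) e ^ 2
  have hY := hn.superpose (a := fun t : Fin K => .hole i t) (fun t t' h => by simpa using h)
    (φ := fun _ x => ENNReal.ofReal 1 * edist x e ^ 2) (fun t => by fun_prop)
  have hYI := superpose_Iio p (fun t : Fin K => .hole i t) (c := fun _ => 1) (fun _ => one_pos) e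
  have ha : ∑ t : Fin K, Real.pi * p.density (.hole i t) / 1 = Real.pi * p.lamS := by
    simp only [density, div_one, lamS, Finset.mul_sum]
  rw [ha] at hYI
  have ha0 : 0 < Real.pi * p.lamS := mul_pos Real.pi_pos (p.lamS_pos hK)
  let φ : ℝ≥0∞ → ℝ≥0∞ := fun x =>
    ENNReal.ofReal (p.lapAllJ s * Real.exp (p.holeExp τ (Real.sqrt x.toReal) s))
  have hφ : Measurable φ := by
    have := p.measurable_holeExp τ s
    exact ((Real.measurable_exp.comp (this.comp
      (Real.continuous_sqrt.measurable.comp ENNReal.measurable_toReal))).const_mul _).ennreal_ofReal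
  have hmin := hY.ae_exists_min (by simpa using ha0) ENNReal.ofReal_ne_top hYI
  have hne : ∀ᵐ ω ∂μ, ∀ (t : Fin K) (m : ℕ), X (.hole i t) ω m ≠ e :=
    ae_all_iff.2 fun t => hn.ae_ne _ e
  have key : ∫⁻ ω, Φ (config X h ω) ∂μ = ∫⁻ ω, φ (⨅ j, Y j ω) ∂μ := by
    rw [hn.lintegral_resample T hΦ]
    refine lintegral_congr_ae ?_
    filter_upwards [hmin, hne] with ω ⟨⟨t₀, m₀⟩, hω⟩ hne
    set c := X (.hole i t₀) ω m₀ with hcdef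
    have hinf : ⨅ j, Y j ω = edist c e ^ 2 := by
      refine le_antisymm ((iInf_le _ (t₀, m₀)).trans (by simp [Y, hcdef])) (le_iInf fun j => ?_)
      by_cases hj : j = (t₀, m₀)
      · simp [Y, hj, hcdef]
      · exact le_of_eq_of_le (by simp [hcdef]) (hω j hj).le
    -- Uniqueness of the closest centre makes the quantifier over closest holes in `activeAt` refer
    -- to a single disc.
    have hclosest : ∀ t m, (∀ t' m', dist (X (.hole i t) ω m) e ≤ dist (X (.hole i t') ω m') e) ↔
        (t, m) = (t₀, m₀) := by
      intro t m
      constructor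
      · intro H
        by_contra hne'
        have := hω (t, m) hne'
        simp only [ENNReal.ofReal_one, one_mul] at this
        exact absurd (sq_edist_le_sq_edist.2 (H t₀ m₀)) (not_le.2 this)
      · intro H t' m'
        obtain ⟨rfl, rfl⟩ := Prod.mk.inj H
        rw [← sq_edist_le_sq_edist]
        by_cases hj : (t', m') = (t, m)
        · obtain ⟨rfl, rfl⟩ := Prod.mk.inj hj
          exact le_rfl
        · have := (hω _ hj).le
          simpa using this
    have h1 : ∀ ω', Φ (Config.merge T (config X h ω) (config X h ω'))
        = expNeg (ENNReal.ofReal s * ∑' n, (Metric.ball c (p.guardRadius τ))ᶜ.indicator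
          (fun x => p.rxPower p.powJ (h (.jammer i n) ω') x e) (X (.jammer i) ω' n)) := by
      intro ω'
      have e1 : ∀ t, Config.points (.hole i t) (Config.merge T (config X h ω) (config X h ω'))
          = X (.hole i t) ω := fun t => Config.points_merge_of_mem (mem_range_self t) _ _
      have e2 : Config.points (.jammer i) (Config.merge T (config X h ω) (config X h ω'))
          = X (.jammer i) ω' := Config.points_merge_of_notMem (by simp [T]) _ _
      have e3 : ∀ n, Config.fades (.jammer i n) (Config.merge T (config X h ω) (config X h ω'))
          = h (.jammer i n) ω' := fun n => Config.fades_merge_of_notMem (by simp [T]) _ _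
      simp only [Φ, intfJAt, activeAt, IsClosestAt, e1, e2, e3, hclosest]
      congr 3 with n
      by_cases hx : X (.jammer i) ω' n ∈ Metric.ball c (p.guardRadius τ)
      · rw [indicator_of_notMem, indicator_of_notMem (by simpa using hx)]
        exact fun H => H t₀ m₀ rfl hx
      · rw [indicator_of_mem, indicator_of_mem hx]
        intro t m htm
        obtain ⟨rfl, rfl⟩ := Prod.mk.inj htm
        exact hx
    simp_rw [h1]
    rw [hn.lintegral_expNeg_intfJAt_of_hole hτ hs i (hne t₀ m₀), hinf]
    simp only [φ]
    rw [edist_dist, ← ENNReal.ofReal_pow dist_nonneg, ENNReal.toReal_ofReal (by positivity),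
      Real.sqrt_sq dist_nonneg, dist_eq_norm]
  refine key.trans ?_
  -- The substitution `x = v ^ 2` turns the exponential density of the squared distance into the
  -- Rayleigh density in `lapJIntegrand`.
  rw [hY.lintegral_iInf ha0 hYI hφ, lintegral_Ioi_comp_sq]
  refine setLIntegral_congr_fun measurableSet_Ioi fun v hv => ?_
  have hv : 0 < v := hv
  have hL : 0 < p.lapAllJ s := Real.exp_pos _
  have hE := Real.exp_pos (p.holeExp τ v s)
  simp only [φ]
  rw [ENNReal.toReal_ofReal (by positivity), Real.sqrt_sq hv.le, p.lapJIntegrand_eq hτ hv hs,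
    ← ENNReal.ofReal_mul (by positivity), ← ENNReal.ofReal_mul (by positivity)]
  congr 1
  ring

/-- The integrability of the integrand of `lapJ`, and the Laplace transform of the interference
from the active jammers at a given location. -/
lemma laplace_intfJAt (hn : p.IsNetwork μ X h) (hK : 0 < K) {τ s : ℝ} (hτ : 0 < τ)
    (hs : 0 < s) (i : ℕ) (e : Plane) :
    IntegrableOn (p.lapJIntegrand τ s) (Ioi 0) ∧
      ∫⁻ ω, expNeg (ENNReal.ofReal s * p.intfJAt X h τ i e ω) ∂μ = ENNReal.ofReal (p.lapJ τ s) := by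
  have hL : 0 < p.lapAllJ s := Real.exp_pos _
  have hlam := p.lamS_pos hK
  have hnn : ∀ v ∈ Ioi (0 : ℝ), 0 ≤ p.lapJIntegrand τ s v := by
    intro v hv
    have hv : 0 < v := hv
    rw [p.lapJIntegrand_eq hτ hv hs]
    positivity
  have hm : AEStronglyMeasurable (p.lapJIntegrand τ s) (volume.restrict (Ioi 0)) := by
    have := p.measurable_holeExp τ s
    refine AEStronglyMeasurable.congr (f := fun v => Real.exp (p.holeExp τ v s) *
      (2 * Real.pi * p.lamS * Real.exp (-(Real.pi * p.lamS * v ^ 2)) * v))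
      (Measurable.aestronglyMeasurable (by fun_prop)) ?_
    filter_upwards [ae_restrict_mem measurableSet_Ioi] with v hv
    exact (p.lapJIntegrand_eq hτ hv hs).symm
  have h1 := hn.lintegral_expNeg_intfJAt hK hτ hs i e
  have hnn' : 0 ≤ᵐ[volume.restrict (Ioi 0)] p.lapJIntegrand τ s := by
    filter_upwards [ae_restrict_mem measurableSet_Ioi] with v hv using hnn v hv
  have h2 : ∫⁻ v in Ioi (0 : ℝ), ENNReal.ofReal (p.lapAllJ s * p.lapJIntegrand τ s v)
      = ENNReal.ofReal (p.lapAllJ s) * ∫⁻ v in Ioi (0 : ℝ), ENNReal.ofReal (p.lapJIntegrand τ s v) := by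
    simp_rw [ENNReal.ofReal_mul hL.le]
    exact lintegral_const_mul'' _ hm.aemeasurable.ennreal_ofReal
  -- No bound on `G` is needed: up to a positive constant the integral is an expectation of a
  -- variable at most `1`.
  have hfin : ∫⁻ v in Ioi (0 : ℝ), ENNReal.ofReal (p.lapJIntegrand τ s v) ≠ ∞ := by
    intro htop
    rw [h2, htop, ENNReal.mul_top (by simpa using hL)] at h1
    have : ∫⁻ ω, expNeg (ENNReal.ofReal s * p.intfJAt X h τ i e ω) ∂μ ≤ ∫⁻ _, 1 ∂μ :=
      lintegral_mono fun ω => expNeg_le_one _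
    rw [h1] at this
    simp at this
  have hint : IntegrableOn (p.lapJIntegrand τ s) (Ioi 0) := by
    refine ⟨hm, ?_⟩
    rw [hasFiniteIntegral_iff_ofReal hnn']
    exact hfin.lt_top
  refine ⟨hint, ?_⟩
  rw [h1, h2, ← ofReal_integral_eq_lintegral_ofReal hint hnn', ← ENNReal.ofReal_mul hL.le]
  rfl

end IsNetwork

end Params

/-! ### From a fixed location to the eavesdroppers -/

/-- The convention `exp(-∞) = 0` in `laplace` agrees with `expNeg` because `s > 0` makes `s * ∞ =
∞`. -/
lemma laplace_eq_toReal {Ω : Type*} [MeasurableSpace Ω] {μ : Measure Ω} {I : Ω → ℝ≥0∞}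
    (hI : Measurable I) {s : ℝ} (hs : 0 < s) :
    laplace μ I s = (∫⁻ ω, expNeg (ENNReal.ofReal s * I ω) ∂μ).toReal := by
  have hm : Measurable fun ω => expNeg (ENNReal.ofReal s * I ω) :=
    measurable_expNeg.comp (hI.const_mul _)
  rw [laplace, ← integral_toReal hm.aemeasurable
    (ae_of_all _ fun ω => (expNeg_ne_top _).lt_top)]
  congr 1 with ω
  split_ifs with h
  · rw [h, ENNReal.mul_top (by simpa using hs), expNeg_top, ENNReal.toReal_zero]
  · rw [expNeg_of_ne_top (ENNReal.mul_ne_top ENNReal.ofReal_ne_top h), ENNReal.toReal_mul,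
      ENNReal.toReal_ofReal hs.le, ENNReal.toReal_ofReal (Real.exp_pos _).le]

/-- The eavesdropper to which a label belongs, and the component of the SINR that it enters. -/
def tag {K : ℕ} : Label K → Option ℕ × Fin 4
  | .inl (.station _) => (none, 0)
  | .inl .eavesdropper => (none, 1)
  | .inl (.intStation i _) => (some i, 0)
  | .inl (.intUser i _) => (some i, 1)
  | .inl (.hole i _) => (some i, 2)
  | .inl (.jammer i) => (some i, 2)
  | .inr (.signal i) => (some i, 3)
  | .inr (.station i _ _) => (some i, 0)
  | .inr (.user i _ _) => (some i, 1)
  | .inr (.jammer i _) => (some i, 2)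

namespace Params

variable {K : ℕ} {p : Params K}

lemma gam_pos (p : Params K) {θ r : ℝ} (hθ : 0 < θ) (hr : 0 < r) (k : Fin K) : 0 < p.gam θ k r :=
  div_pos (mul_pos hθ (Real.rpow_pos_of_pos hr _)) (p.powB_pos k)

lemma lapB_pos (p : Params K) (s : ℝ) : 0 < p.lapB s := Real.exp_pos _

lemma lapU_pos (p : Params K) (s : ℝ) : 0 < p.lapU s := Real.exp_pos _

section Random

variable {Ω : Type*} (X : PointLabel K → Ω → ℕ → Plane) (h : FadeLabel K → Ω → ℝ)

/-- The interference that eavesdropper `i` would see at `e`. -/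
def intfAt (p : Params K) (τ : ℝ) (i : ℕ) (e : Plane) (ω : Ω) : ℝ≥0∞ :=
  p.intfBAt X h i e ω + p.intfUAt X h i e ω + p.intfJAt X h τ i e ω

/-- The SINR that eavesdropper `i` would see at `e` from a base station of tier `k` at `b`. -/
def sinrAt (p : Params K) (τ : ℝ) (k : Fin K) (b : Plane) (i : ℕ) (e : Plane) (ω : Ω) : ℝ≥0∞ :=
  p.rxPower (p.powB k) (h (.signal i) ω) b e / (p.intfAt X h τ i e ω + ENNReal.ofReal p.noise)

lemma sinrE_eq (p : Params K) (τ : ℝ) (k : Fin K) (n i : ℕ) (ω : Ω) :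
    p.sinrE X h τ k n i ω
      = p.sinrAt X h τ k (X (.station k) ω n) i (X .eavesdropper ω i) ω := by
  rw [sinrE, sinrAt, intfAt, intfB_eq, intfU_eq, intfJ_eq]

variable {X h}

lemma measurable_intfAt {m : MeasurableSpace Ω} (p : Params K) (τ : ℝ) {i : ℕ} {e : Ω → Plane}
    (hB : ∀ t, Measurable (X (.intStation i t))) (hU : ∀ t, Measurable (X (.intUser i t)))
    (hH : ∀ t, Measurable (X (.hole i t))) (hJ : Measurable (X (.jammer i)))
    (hB' : ∀ t n, Measurable (h (.station i t n))) (hU' : ∀ t n, Measurable (h (.user i t n)))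
    (hJ' : ∀ n, Measurable (h (.jammer i n))) (he : Measurable e) :
    Measurable fun ω => p.intfAt X h τ i (e ω) ω :=
  ((p.measurable_intfBAt hB hB' he).add (p.measurable_intfUAt hU hU' he)).add
    (p.measurable_intfJAt τ hH hJ hJ' he)

lemma measurable_sinrAt {m : MeasurableSpace Ω} (p : Params K) (τ : ℝ) (k : Fin K) {i : ℕ}
    {b e : Ω → Plane}
    (hB : ∀ t, Measurable (X (.intStation i t))) (hU : ∀ t, Measurable (X (.intUser i t)))
    (hH : ∀ t, Measurable (X (.hole i t))) (hJ : Measurable (X (.jammer i)))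
    (hS' : Measurable (h (.signal i)))
    (hB' : ∀ t n, Measurable (h (.station i t n))) (hU' : ∀ t n, Measurable (h (.user i t n)))
    (hJ' : ∀ n, Measurable (h (.jammer i n))) (hb : Measurable b) (he : Measurable e) :
    Measurable fun ω => p.sinrAt X h τ k (b ω) i (e ω) ω :=
  (p.measurable_rxPower _ hS' hb he).div
    ((p.measurable_intfAt τ hB hU hH hJ hB' hU' hJ' he).add_const _)

lemma measurable_block_intfBAt (p : Params K) (i : ℕ) (e : Plane) {T : Set (Label K)}
    (hT : tag ⁻¹' {(some i, 0)} ⊆ T) :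
    Measurable[block (labelSigma X h) T] (p.intfBAt X h i e) :=
  p.measurable_intfBAt (m := block (labelSigma X h) T)
    (fun _ => measurable_block_points X h (hT rfl))
    (fun _ _ => measurable_block_fades X h (hT rfl))
    (@measurable_const _ _ _ (block (labelSigma X h) T) _)

lemma measurable_block_intfUAt (p : Params K) (i : ℕ) (e : Plane) {T : Set (Label K)}
    (hT : tag ⁻¹' {(some i, 1)} ⊆ T) :
    Measurable[block (labelSigma X h) T] (p.intfUAt X h i e) :=
  p.measurable_intfUAt (m := block (labelSigma X h) T)
    (fun _ => measurable_block_points X h (hT rfl))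
    (fun _ _ => measurable_block_fades X h (hT rfl))
    (@measurable_const _ _ _ (block (labelSigma X h) T) _)

lemma measurable_block_intfJAt (p : Params K) (τ : ℝ) (i : ℕ) (e : Plane) {T : Set (Label K)}
    (hT : tag ⁻¹' {(some i, 2)} ⊆ T) :
    Measurable[block (labelSigma X h) T] (p.intfJAt X h τ i e) :=
  p.measurable_intfJAt τ (m := block (labelSigma X h) T)
    (fun _ => measurable_block_points X h (hT rfl)) (measurable_block_points X h (hT rfl))
    (fun _ => measurable_block_fades X h (hT rfl))
    (@measurable_const _ _ _ (block (labelSigma X h) T) _)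

lemma measurable_block_sinrAt (p : Params K) (τ : ℝ) (k : Fin K) (b : Plane) (i : ℕ) (e : Plane)
    {T : Set (Label K)} (hT : tag ⁻¹' ({some i} ×ˢ univ) ⊆ T) :
    Measurable[block (labelSigma X h) T] (p.sinrAt X h τ k b i e) :=
  p.measurable_sinrAt τ k (m := block (labelSigma X h) T)
    (fun _ => measurable_block_points X h (hT ⟨rfl, trivial⟩))
    (fun _ => measurable_block_points X h (hT ⟨rfl, trivial⟩))
    (fun _ => measurable_block_points X h (hT ⟨rfl, trivial⟩))
    (measurable_block_points X h (hT ⟨rfl, trivial⟩))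
    (measurable_block_fades X h (hT ⟨rfl, trivial⟩))
    (fun _ _ => measurable_block_fades X h (hT ⟨rfl, trivial⟩))
    (fun _ _ => measurable_block_fades X h (hT ⟨rfl, trivial⟩))
    (fun _ => measurable_block_fades X h (hT ⟨rfl, trivial⟩))
    (@measurable_const _ _ _ (block (labelSigma X h) T) _)
    (@measurable_const _ _ _ (block (labelSigma X h) T) _)

/-- The received power is finite and nonzero, as `b ≠ e` and the gain is positive. The quotient can
therefore be cleared even when interference plus noise is `0` or `∞`. -/
lemma le_sinrAt_iff (p : Params K) {θ : ℝ} (hθ : 0 < θ) (τ : ℝ) (k : Fin K) {b e : Plane}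
    (hbe : b ≠ e) (i : ℕ) {ω : Ω} (hω : 0 < h (.signal i) ω) :
    ENNReal.ofReal θ ≤ p.sinrAt X h τ k b i e ω ↔
      ENNReal.ofReal (p.gam θ k (dist b e)) * (p.intfAt X h τ i e ω + ENNReal.ofReal p.noise)
        ≤ ENNReal.ofReal (h (.signal i) ω) := by
  have hP := p.powB_pos k
  have hd : 0 < dist b e := dist_pos.2 hbe
  have hd' : 0 < dist b e ^ p.α := Real.rpow_pos_of_pos hd _
  have hrx : p.rxPower (p.powB k) (h (.signal i) ω) b e
      = ENNReal.ofReal (p.powB k / dist b e ^ p.α) * ENNReal.ofReal (h (.signal i) ω) := by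
    rw [rxPower, edist_dist, ENNReal.ofReal_rpow_of_pos hd, ← ENNReal.ofReal_mul (by positivity),
      ← ENNReal.ofReal_mul (by positivity), Real.rpow_neg hd.le]
    congr 1
    field_simp
  have hc : ENNReal.ofReal (p.powB k / dist b e ^ p.α) ≠ 0 := by
    have : 0 < p.powB k / dist b e ^ p.α := by positivity
    simpa using this
  have hx : ENNReal.ofReal (h (.signal i) ω) ≠ 0 := by simpa using hω
  have hg : ENNReal.ofReal θ
      = ENNReal.ofReal (p.powB k / dist b e ^ p.α) * ENNReal.ofReal (p.gam θ k (dist b e)) := by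
    rw [← ENNReal.ofReal_mul (by positivity), gam]
    congr 1
    field_simp
  rw [sinrAt, hrx, ENNReal.le_div_iff_mul_le (Or.inr (mul_ne_zero hc hx))
    (Or.inr (ENNReal.mul_ne_top ENNReal.ofReal_ne_top ENNReal.ofReal_ne_top)), hg, mul_assoc,
    ENNReal.mul_le_mul_iff_right hc ENNReal.ofReal_ne_top]

end Random

/-- The probability that an eavesdropper at distance `r` from a serving base station of tier `k`
decodes its signal. -/
def detectProb (p : Params K) (θ τ : ℝ) (k : Fin K) (r : ℝ) : ℝ :=
  Real.exp (-(p.noise * p.gam θ k r)) * p.lapB (p.gam θ k r) * p.lapU (p.gam θ k r) *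
    p.lapJ τ (p.gam θ k r)

namespace IsNetwork

/-- The Laplace transform of the gain at `c = ∞` is `0`, while its integrand equals `1` wherever the
gain is nonpositive. -/
lemma ae_fade_pos {Ω : Type*} [MeasurableSpace Ω] {μ : Measure Ω}
    {X : PointLabel K → Ω → ℕ → Plane} {h : FadeLabel K → Ω → ℝ} (hn : p.IsNetwork μ X h) (b : FadeLabel K) :
    ∀ᵐ ω ∂μ, 0 < h b ω := by
  have h1 := lintegral_expNeg_mul_exp (hn.fade_measurable b) (hn.fade_law b) ∞
  have hm : Measurable fun ω => expNeg (∞ * ENNReal.ofReal (h b ω)) :=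
    measurable_expNeg.comp ((hn.fade_measurable b).ennreal_ofReal.const_mul _)
  rw [add_top, ENNReal.inv_top, lintegral_eq_zero_iff hm] at h1
  filter_upwards [h1] with ω hω
  by_contra! hle
  simp [ENNReal.ofReal_of_nonpos hle] at hω

variable {Ω : Type*} [MeasurableSpace Ω] {μ : Measure Ω} [IsProbabilityMeasure μ]
  {X : PointLabel K → Ω → ℕ → Plane} {h : FadeLabel K → Ω → ℝ}

/-- Freezes the eavesdroppers' locations. `hF'` says that `F` reads them only through its first
argument, so resampling everything else leaves a fixed-location problem. -/
lemma lintegral_eavesdropper (hn : p.IsNetwork μ X h) {F : (ℕ → Plane) → Config K → ℝ≥0∞}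
    (hF : Measurable (Function.uncurry F))
    (hF' : ∀ e z z', F e (Config.merge {.inl .eavesdropper} z z') = F e z') :
    ∫⁻ ω, F (X .eavesdropper ω) (config X h ω) ∂μ
      = ∫⁻ ω, ∫⁻ ω', F (X .eavesdropper ω) (config X h ω') ∂μ ∂μ := by
  have h1 : Measurable fun z : Config K => F (Config.points .eavesdropper z) z :=
    hF.comp ((Config.measurable_points _).prodMk measurable_id)
  refine (hn.lintegral_resample {.inl .eavesdropper} h1).trans ?_
  simp only [hF', Config.points_merge_of_mem (mem_singleton _)]
  rfl

lemma laplace_intfB (hn : p.IsNetwork μ X h) (i : ℕ) {s : ℝ} (hs : 0 < s) :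
    laplace μ (p.intfB X h i) s = p.lapB s := by
  have hm : Measurable (p.intfB X h i) :=
    p.measurable_intfBAt (e := fun ω => X .eavesdropper ω i) (fun t => hn.points_measurable _)
      (fun t n => hn.fade_measurable _)
      ((measurable_pi_apply i).comp (hn.points_measurable _))
  rw [laplace_eq_toReal hm hs]
  have h1 := hn.lintegral_eavesdropper (F := fun e z =>
    expNeg (ENNReal.ofReal s * p.intfBAt Config.points Config.fades i (e i) z))
    (measurable_expNeg.comp (Measurable.const_mul (p.measurable_intfBAt
      (X := fun a (w : (ℕ → Plane) × Config K) => Config.points a w.2)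
      (h := fun b (w : (ℕ → Plane) × Config K) => Config.fades b w.2)
      (fun t => (Config.measurable_points _).comp measurable_snd)
      (fun t n => (Config.measurable_fades _).comp measurable_snd)
      ((measurable_pi_apply i).comp measurable_fst)) _))
    (fun e z z' => by
      simp [intfBAt, fieldAt, Config.points_merge_of_notMem, Config.fades_merge_of_notMem])
  have h2 : ∫⁻ ω, expNeg (ENNReal.ofReal s * p.intfB X h i ω) ∂μ = ENNReal.ofReal (p.lapB s) := by
    refine h1.trans ?_
    have h3 := fun ω => hn.lintegral_expNeg_intfBAt i hs (X .eavesdropper ω i)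
    refine (lintegral_congr h3).trans ?_
    simp
  rw [h2, ENNReal.toReal_ofReal (p.lapB_pos s).le]

lemma laplace_intfU (hn : p.IsNetwork μ X h) (i : ℕ) {s : ℝ} (hs : 0 < s) :
    laplace μ (p.intfU X h i) s = p.lapU s := by
  have hm : Measurable (p.intfU X h i) :=
    p.measurable_intfUAt (e := fun ω => X .eavesdropper ω i) (fun t => hn.points_measurable _)
      (fun t n => hn.fade_measurable _)
      ((measurable_pi_apply i).comp (hn.points_measurable _))
  rw [laplace_eq_toReal hm hs]
  have h1 := hn.lintegral_eavesdropper (F := fun e z =>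
    expNeg (ENNReal.ofReal s * p.intfUAt Config.points Config.fades i (e i) z))
    (measurable_expNeg.comp (Measurable.const_mul (p.measurable_intfUAt
      (X := fun a (w : (ℕ → Plane) × Config K) => Config.points a w.2)
      (h := fun b (w : (ℕ → Plane) × Config K) => Config.fades b w.2)
      (fun t => (Config.measurable_points _).comp measurable_snd)
      (fun t n => (Config.measurable_fades _).comp measurable_snd)
      ((measurable_pi_apply i).comp measurable_fst)) _))
    (fun e z z' => by
      simp [intfUAt, fieldAt, Config.points_merge_of_notMem, Config.fades_merge_of_notMem])
  have h2 : ∫⁻ ω, expNeg (ENNReal.ofReal s * p.intfU X h i ω) ∂μ = ENNReal.ofReal (p.lapU s) := by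
    refine h1.trans ?_
    have h3 := fun ω => hn.lintegral_expNeg_intfUAt i hs (X .eavesdropper ω i)
    refine (lintegral_congr h3).trans ?_
    simp
  rw [h2, ENNReal.toReal_ofReal (p.lapU_pos s).le]

lemma lapJ_nonneg (p : Params K) {τ s : ℝ} (hK : 0 < K) (hτ : 0 < τ) (hs : 0 < s) :
    0 ≤ p.lapJ τ s := by
  have := p.lamS_pos hK
  refine mul_nonneg (Real.exp_pos _).le (setIntegral_nonneg measurableSet_Ioi fun v hv => ?_)
  have hv : 0 < v := hv
  rw [p.lapJIntegrand_eq hτ hv hs]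
  positivity

lemma intfJAt_merge_eavesdropper (p : Params K) (τ : ℝ) (i : ℕ) (e : Plane) (z z' : Config K) :
    p.intfJAt Config.points Config.fades τ i e (Config.merge {.inl .eavesdropper} z z')
      = p.intfJAt Config.points Config.fades τ i e z' := by
  simp [intfJAt, activeAt, IsClosestAt, Config.points_merge_of_notMem,
    Config.fades_merge_of_notMem]

lemma laplace_intfJ (hn : p.IsNetwork μ X h) (hK : 0 < K) {τ : ℝ} (hτ : 0 < τ) (i : ℕ) {s : ℝ}
    (hs : 0 < s) : laplace μ (p.intfJ X h τ i) s = p.lapJ τ s := by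
  have he : p.intfJ X h τ i = fun ω => p.intfJAt X h τ i (X .eavesdropper ω i) ω :=
    funext fun ω => intfJ_eq X h p τ i ω
  have hm : Measurable fun ω => p.intfJAt X h τ i (X .eavesdropper ω i) ω :=
    p.measurable_intfJAt τ (fun t => hn.points_measurable _) (hn.points_measurable _)
      (fun n => hn.fade_measurable _)
      ((measurable_pi_apply i).comp (hn.points_measurable _))
  rw [he, laplace_eq_toReal hm hs]
  have h1 := hn.lintegral_eavesdropper (F := fun e z =>
    expNeg (ENNReal.ofReal s * p.intfJAt Config.points Config.fades τ i (e i) z))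
    (measurable_expNeg.comp (Measurable.const_mul (p.measurable_intfJAt τ
      (X := fun a (w : (ℕ → Plane) × Config K) => Config.points a w.2)
      (h := fun b (w : (ℕ → Plane) × Config K) => Config.fades b w.2)
      (fun t => (Config.measurable_points _).comp measurable_snd)
      ((Config.measurable_points _).comp measurable_snd)
      (fun n => (Config.measurable_fades _).comp measurable_snd)
      ((measurable_pi_apply i).comp measurable_fst)) _))
    (fun e z z' => by rw [intfJAt_merge_eavesdropper])
  have h2 : ∫⁻ ω, expNeg (ENNReal.ofReal s * p.intfJAt X h τ i (X .eavesdropper ω i) ω) ∂μ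
      = ENNReal.ofReal (p.lapJ τ s) := by
    refine h1.trans ?_
    have h3 := fun ω => (hn.laplace_intfJAt hK hτ hs i (X .eavesdropper ω i)).2
    refine (lintegral_congr h3).trans ?_
    simp
  rw [h2, ENNReal.toReal_ofReal (lapJ_nonneg p hK hτ hs)]

/-! ### The law of the SINR at a given location -/

lemma disjoint_tag {S T : Set (Option ℕ × Fin 4)} (hST : Disjoint S T) :
    Disjoint (tag (K := K) ⁻¹' S) (tag ⁻¹' T) := hST.preimage _

/-- The three interferences carry different tags, hence are independent. The holes and the jammers
share a tag, since both enter the jammer term. -/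
lemma lintegral_expNeg_intfAt (hn : p.IsNetwork μ X h) (hK : 0 < K) {τ : ℝ} (hτ : 0 < τ) (i : ℕ)
    {s : ℝ} (hs : 0 < s) (e : Plane) :
    ∫⁻ ω, expNeg (ENNReal.ofReal s * p.intfAt X h τ i e ω) ∂μ
      = ENNReal.ofReal (p.lapB s * p.lapU s * p.lapJ τ s) := by
  have hle := block_le hn.labelSigma_le
  -- `hB` and `hU` refer to the joint block, for the independence of the pair from the jammer term;
  -- `hB1` and `hU1` refer to the separate blocks, for the independence inside the pair.
  have hB := measurable_block_intfBAt (X := X) (h := h) p i e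
    (T := tag ⁻¹' {(some i, 0), (some i, 1)}) (preimage_mono (by simp))
  have hU := measurable_block_intfUAt (X := X) (h := h) p i e
    (T := tag ⁻¹' {(some i, 0), (some i, 1)}) (preimage_mono (by simp))
  have hB1 := measurable_block_intfBAt (X := X) (h := h) p i e subset_rfl
  have hU1 := measurable_block_intfUAt (X := X) (h := h) p i e subset_rfl
  have hJ1 := measurable_block_intfJAt (X := X) (h := h) p τ i e subset_rfl
  have i1 : IndepFun (p.intfBAt X h i e) (p.intfUAt X h i e) μ :=
    indepFun_of_block hn.labelSigma_le hn.iIndep_labelSigma (disjoint_tag (by simp)) hB1 hU1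
  have i2 : IndepFun (fun ω => (p.intfBAt X h i e ω, p.intfUAt X h i e ω))
      (p.intfJAt X h τ i e) μ :=
    indepFun_of_block hn.labelSigma_le hn.iIndep_labelSigma
      (disjoint_tag (by simp [Prod.ext_iff])) (Measurable.prodMk hB hU) hJ1
  have m1 : Measurable fun y : ℝ≥0∞ => expNeg (ENNReal.ofReal s * y) := by fun_prop
  have m2 : Measurable fun y : ℝ≥0∞ × ℝ≥0∞ =>
      expNeg (ENNReal.ofReal s * y.1) * expNeg (ENNReal.ofReal s * y.2) := by fun_prop
  have mB := hB1.mono (hle _) le_rfl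
  have mU := hU1.mono (hle _) le_rfl
  have mJ := hJ1.mono (hle _) le_rfl
  have e1 : ∫⁻ ω, expNeg (ENNReal.ofReal s * p.intfBAt X h i e ω) *
      expNeg (ENNReal.ofReal s * p.intfUAt X h i e ω) ∂μ = ENNReal.ofReal (p.lapB s * p.lapU s) := by
    have := lintegral_mul_eq_lintegral_mul_lintegral_of_indepFun (m1.comp mB) (m1.comp mU)
      (i1.comp m1 m1)
    refine this.trans ?_
    rw [ENNReal.ofReal_mul (p.lapB_pos s).le, ← hn.lintegral_expNeg_intfBAt i hs e,
      ← hn.lintegral_expNeg_intfUAt i hs e]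
    rfl
  have e2 := lintegral_mul_eq_lintegral_mul_lintegral_of_indepFun (m2.comp (mB.prodMk mU))
      (m1.comp mJ) (i2.comp m2 m1)
  simp only [intfAt, mul_add, expNeg_add]
  refine e2.trans ?_
  rw [ENNReal.ofReal_mul (mul_pos (p.lapB_pos s) (p.lapU_pos s)).le,
    ← (hn.laplace_intfJAt hK hτ hs i e).2, ← e1]
  rfl

/-- The probability that the SINR at a given location exceeds the threshold. -/
lemma measure_le_sinrAt (hn : p.IsNetwork μ X h) (hK : 0 < K) {θ τ : ℝ} (hθ : 0 < θ) (hτ : 0 < τ)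
    (k : Fin K) {b e : Plane} (hbe : b ≠ e) (i : ℕ) :
    μ {ω | ENNReal.ofReal θ ≤ p.sinrAt X h τ k b i e ω}
      = ENNReal.ofReal (p.detectProb θ τ k (dist b e)) := by
  have hγ := p.gam_pos hθ (dist_pos.2 hbe) k
  set γ := p.gam θ k (dist b e) with hγdef
  have hle := block_le hn.labelSigma_le
  have hI : Measurable[block (labelSigma X h) (tag ⁻¹' {(some i, 0), (some i, 1), (some i, 2)})]
      (p.intfAt X h τ i e) :=
    ((measurable_block_intfBAt p i e (preimage_mono (by simp))).add
      (measurable_block_intfUAt p i e (preimage_mono (by simp)))).add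
      (measurable_block_intfJAt p τ i e (preimage_mono (by simp)))
  have hS : Measurable[block (labelSigma X h) (tag ⁻¹' {(some i, 3)})] (h (.signal i)) :=
    measurable_block_fades X h rfl
  have hind : IndepFun (p.intfAt X h τ i e) (h (.signal i)) μ :=
    indepFun_of_block hn.labelSigma_le hn.iIndep_labelSigma
      (disjoint_tag (by simp [Prod.ext_iff])) hI hS
  have mI := hI.mono (hle _) le_rfl
  have mS := hS.mono (hle _) le_rfl
  let A : Set (ℝ≥0∞ × ℝ) := {y | ENNReal.ofReal γ * (y.1 + ENNReal.ofReal p.noise)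
    ≤ ENNReal.ofReal y.2}
  have hA : MeasurableSet A := measurableSet_le (by fun_prop) (by fun_prop)
  have hae : {ω | ENNReal.ofReal θ ≤ p.sinrAt X h τ k b i e ω}
      =ᵐ[μ] {ω | (p.intfAt X h τ i e ω, h (.signal i) ω) ∈ A} := by
    filter_upwards [hn.ae_fade_pos (.signal i)] with ω hω
    exact propext (le_sinrAt_iff p hθ τ k hbe i hω)
  have hA' : MeasurableSet {ω | (p.intfAt X h τ i e ω, h (.signal i) ω) ∈ A} :=
    (mI.prodMk mS) hA
  rw [measure_congr hae, ← lintegral_indicator_one hA']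
  have h1 := lintegral_of_indepFun mI mS hind (F := fun x g => A.indicator 1 (x, g))
    ((measurable_one.indicator hA))
  refine h1.trans ?_
  -- Given the interference, the exponential tail of the signal gain yields `e^{-γ(I + N_0)}`, so
  -- the remaining average is a Laplace transform at `γ`.
  have h2 : ∀ ω, ∫⁻ ω', A.indicator 1 (p.intfAt X h τ i e ω, h (.signal i) ω') ∂μ
      = expNeg (ENNReal.ofReal γ * p.intfAt X h τ i e ω) *
        ENNReal.ofReal (Real.exp (-(p.noise * γ))) := by
    intro ω
    have hm : MeasurableSet {ω' | (p.intfAt X h τ i e ω, h (.signal i) ω') ∈ A} :=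
      (measurable_const.prodMk mS) hA
    have h3 := lintegral_indicator_one (μ := μ) hm
    refine h3.trans ?_
    rw [show {ω' | (p.intfAt X h τ i e ω, h (.signal i) ω') ∈ A}
      = {ω' | ENNReal.ofReal γ * (p.intfAt X h τ i e ω + ENNReal.ofReal p.noise)
        ≤ ENNReal.ofReal (h (.signal i) ω')} from rfl,
      measure_le_ofReal_exp mS (hn.fade_law _), mul_add, expNeg_add, ← ENNReal.ofReal_mul hγ.le,
      expNeg_ofReal (mul_nonneg hγ.le p.noise_nonneg), mul_comm γ]
  simp_rw [h2]
  have hme : Measurable fun ω => expNeg (ENNReal.ofReal γ * p.intfAt X h τ i e ω) :=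
    measurable_expNeg.comp (mI.const_mul _)
  rw [lintegral_mul_const _ hme,
    hn.lintegral_expNeg_intfAt hK hτ i hγ e, ← ENNReal.ofReal_mul (mul_nonneg
      (mul_pos (p.lapB_pos γ) (p.lapU_pos γ)).le (lapJ_nonneg p hK hτ hγ)), detectProb]
  congr 1
  ring

end IsNetwork

end Params

/-! ### Secrecy against the whole process of eavesdroppers -/

namespace Params

namespace IsNetwork

variable {K : ℕ} {p : Params K} {Ω : Type*} [MeasurableSpace Ω] {μ : Measure Ω}
  [IsProbabilityMeasure μ] {X : PointLabel K → Ω → ℕ → Plane} {h : FadeLabel K → Ω → ℝ}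

lemma measurable_sinrAt_config (p : Params K) (τ : ℝ) (k : Fin K) (i : ℕ) {β : Type*}
    [MeasurableSpace β] {z : β → Config K} {b e : β → Plane} (hz : Measurable z)
    (hb : Measurable b) (he : Measurable e) :
    Measurable fun w => p.sinrAt Config.points Config.fades τ k (b w) i (e w) (z w) :=
  p.measurable_sinrAt τ k (X := fun a w => Config.points a (z w))
    (h := fun b w => Config.fades b (z w))
    (fun _ => (Config.measurable_points _).comp hz)
    (fun _ => (Config.measurable_points _).comp hz)
    (fun _ => (Config.measurable_points _).comp hz)
    ((Config.measurable_points _).comp hz)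
    ((Config.measurable_fades _).comp hz)
    (fun _ _ => (Config.measurable_fades _).comp hz)
    (fun _ _ => (Config.measurable_fades _).comp hz)
    (fun _ => (Config.measurable_fades _).comp hz) hb he

lemma detectProb_nonneg (p : Params K) (hK : 0 < K) {θ τ r : ℝ} (hθ : 0 < θ) (hτ : 0 < τ)
    (hr : 0 < r) (k : Fin K) : 0 ≤ p.detectProb θ τ k r :=
  mul_nonneg (mul_pos (mul_pos (Real.exp_pos _) (p.lapB_pos _)) (p.lapU_pos _)).le
    (lapJ_nonneg p hK hτ (p.gam_pos hθ hr k))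

/-- The detection probability has a measurable version bounded by `1`. -/
lemma exists_measurable_detectProb (hn : p.IsNetwork μ X h) (hK : 0 < K) {θ τ : ℝ} (hθ : 0 < θ)
    (hτ : 0 < τ) (k : Fin K) : ∃ W : ℝ → ℝ≥0∞, Measurable W ∧ (∀ r, W r ≤ 1) ∧
      ∀ r, 0 < r → W r = ENNReal.ofReal (p.detectProb θ τ k r) := by
  let u : Plane := EuclideanSpace.single 0 1
  have hu : ‖u‖ = 1 := by simp [u]
  -- The probability itself serves as the version, for a station at the origin and a listener at `r
  -- • u`: it is measurable in `r` as the measure of sections, which avoids studying how `lapJ`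
  -- depends on `s`.
  refine ⟨fun r => μ {ω | ENNReal.ofReal θ ≤ p.sinrAt X h τ k 0 0 (r • u) ω}, ?_,
    fun r => prob_le_one, fun r hr => ?_⟩
  · have hm : Measurable fun w : ℝ × Ω => p.sinrAt Config.points Config.fades τ k 0 0 (w.1 • u)
        (config X h w.2) :=
      measurable_sinrAt_config p τ k 0 (hn.measurable_config.comp measurable_snd)
        measurable_const (by fun_prop)
    exact measurable_measure_prodMk_left (measurableSet_le measurable_const hm)
  · have hd : dist 0 (r • u) = r := by
      rw [dist_zero_left, norm_smul, hu, mul_one, Real.norm_of_nonneg hr.le]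
    have hne : (0 : Plane) ≠ r • u := by
      rw [← dist_pos, hd]; exact hr
    have := hn.measure_le_sinrAt hK hθ hτ k hne 0
    rwa [hd] at this

/-- Not visible from the formula, where `G ≥ 1`; it holds because `lapJ` is a Laplace transform. -/
lemma lapJ_le_one (hn : p.IsNetwork μ X h) (hK : 0 < K) {τ s : ℝ} (hτ : 0 < τ) (hs : 0 < s) :
    p.lapJ τ s ≤ 1 := by
  rw [← ENNReal.ofReal_le_one, ← (hn.laplace_intfJAt hK hτ hs 0 0).2]
  refine (lintegral_mono fun ω => expNeg_le_one _).trans ?_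
  simp

lemma lapU_le_one (p : Params K) {s : ℝ} (hs : 0 < s) : p.lapU s ≤ 1 := by
  have := nsinc_pos p.two_lt_α
  have h2 : 0 ≤ p.lamS := Finset.sum_nonneg fun t _ => (p.lamB_pos t).le
  have := p.powU_pos
  rw [lapU, Real.exp_le_one_iff, neg_div, neg_nonpos]
  positivity

/-- Every factor other than `lapB` and `r` is at most `1`, and `lapB (γ_k(r))` is a Gaussian in `r`,
because `γ_k(r)^(2/α)` is proportional to `r ^ 2`. -/
lemma integrableOn_secrecyIntegrand (hn : p.IsNetwork μ X h) (hK : 0 < K) {θ τ : ℝ} (hθ : 0 < θ)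
    (hτ : 0 < τ) (k : Fin K) : IntegrableOn (p.secrecyIntegrand θ τ k) (Ioi 0) := by
  obtain ⟨W, hW, -, hW'⟩ := hn.exists_measurable_detectProb hK hθ hτ k
  have hsinc := nsinc_pos p.two_lt_α
  have hP := p.powB_pos k
  have hα := p.α_pos
  have hS : 0 < ∑ t, p.lamB t * p.powB t ^ (2 / p.α) :=
    Finset.sum_pos (fun t _ => mul_pos (p.lamB_pos t) (Real.rpow_pos_of_pos (p.powB_pos t) _))
      ⟨⟨0, hK⟩, Finset.mem_univ _⟩
  set c := Real.pi * (θ / p.powB k) ^ (2 / p.α) * (∑ t, p.lamB t * p.powB t ^ (2 / p.α))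
    / nsinc (2 / p.α) with hc
  have hc0 : 0 < c := by positivity
  have hi := integrableOn_rpow_mul_exp_neg_mul_rpow (p := 2) (s := 1) (b := c) (by norm_num)
    (by norm_num) hc0
  refine Integrable.mono' hi ?_ ?_
  · have hm : Measurable fun r : ℝ => (W r).toReal * r := hW.ennreal_toReal.mul measurable_id
    refine hm.aestronglyMeasurable.congr ?_
    filter_upwards [ae_restrict_mem measurableSet_Ioi] with r hr
    rw [hW' r hr, ENNReal.toReal_ofReal (detectProb_nonneg p hK hθ hτ hr k)]
    rfl
  · filter_upwards [ae_restrict_mem measurableSet_Ioi] with r hr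
    have hr : 0 < r := hr
    have hγ := p.gam_pos hθ hr k
    have hB : p.lapB (p.gam θ k r) = Real.exp (-c * r ^ (2 : ℝ)) := by
      have h1 : p.gam θ k r ^ (2 / p.α) = (θ / p.powB k) ^ (2 / p.α) * r ^ (2 : ℝ) := by
        rw [gam, mul_div_right_comm, Real.mul_rpow (by positivity) (by positivity),
          ← Real.rpow_mul hr.le, mul_div_cancel₀ _ hα.ne']
      rw [lapB, h1, hc]
      congr 1
      ring
    have h0 := detectProb_nonneg p hK hθ hτ hr k
    have hle : p.detectProb θ τ k r ≤ p.lapB (p.gam θ k r) := by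
      have h1 : Real.exp (-(p.noise * p.gam θ k r)) ≤ 1 := by
        have := mul_nonneg p.noise_nonneg hγ.le
        simpa using this
      have h2 := lapU_le_one p hγ
      have h3 := hn.lapJ_le_one hK hτ hγ
      have hB0 := (p.lapB_pos (p.gam θ k r)).le
      have hU0 := (p.lapU_pos (p.gam θ k r)).le
      have hJ0 := lapJ_nonneg p hK hτ hγ
      calc p.detectProb θ τ k r
          ≤ 1 * p.lapB (p.gam θ k r) * 1 * 1 := by
            unfold detectProb
            gcongr
        _ = _ := by ring
    rw [Real.rpow_one, ← hB, mul_comm r]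
    refine (Real.norm_of_nonneg (mul_nonneg h0 hr.le)).trans_le ?_
    exact mul_le_mul_of_nonneg_right hle hr.le

/-- The probability that no eavesdropper decodes the signal of a given base station. -/
lemma measure_sinrAt_lt (hn : p.IsNetwork μ X h) (hK : 0 < K) {θ τ : ℝ} (hθ : 0 < θ) (hτ : 0 < τ)
    (k : Fin K) (b : Plane) :
    μ {ω | ∀ i, p.sinrAt X h τ k b i (X .eavesdropper ω i) ω < ENNReal.ofReal θ}
      = ENNReal.ofReal (Real.exp
          (-(2 * Real.pi * p.lamE * ∫ r in Ioi (0 : ℝ), p.secrecyIntegrand θ τ k r))) := by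
  obtain ⟨W, hW, hW1, hW'⟩ := hn.exists_measurable_detectProb hK hθ hτ k
  -- A single eavesdropper reaching `θ` adds weight `∞`, so `F` is the indicator of secrecy, written
  -- as `expNeg` of a sum over the eavesdroppers.
  let F : (ℕ → Plane) → Config K → ℝ≥0∞ := fun e z =>
    expNeg (∑' i, {z | ENNReal.ofReal θ ≤ p.sinrAt Config.points Config.fades τ k b i (e i) z}.indicator
      (fun _ => ∞) z)
  have hF : Measurable (Function.uncurry F) := by
    refine measurable_expNeg_tsum fun i => ?_
    have h1 : Measurable fun w : (ℕ → Plane) × Config K =>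
        p.sinrAt Config.points Config.fades τ k b i (w.1 i) w.2 :=
      measurable_sinrAt_config p τ k i measurable_snd measurable_const
        ((measurable_pi_apply i).comp measurable_fst)
    exact measurable_const.indicator (measurableSet_le measurable_const h1)
  have hF' : ∀ e z z', F e (Config.merge {.inl .eavesdropper} z z') = F e z' := by
    intro e z z'
    simp only [F]
    congr 2 with i
    have h1 : p.sinrAt Config.points Config.fades τ k b i (e i)
        (Config.merge {.inl .eavesdropper} z z')
        = p.sinrAt Config.points Config.fades τ k b i (e i) z' := by
      simp only [sinrAt, intfAt, intfJAt_merge_eavesdropper]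
      simp [intfBAt, intfUAt, fieldAt, Config.points_merge_of_notMem,
        Config.fades_merge_of_notMem]
    simp only [indicator, mem_ofPred_eq, h1]
  have hA : MeasurableSet
      {ω | ∀ i, p.sinrAt X h τ k b i (X .eavesdropper ω i) ω < ENNReal.ofReal θ} := by
    simp only [ofPred_forall]
    refine MeasurableSet.iInter fun i => measurableSet_lt ?_ measurable_const
    exact measurable_sinrAt_config p τ k i hn.measurable_config measurable_const
      ((measurable_pi_apply i).comp (hn.points_measurable .eavesdropper))
  have h1 : μ {ω | ∀ i, p.sinrAt X h τ k b i (X .eavesdropper ω i) ω < ENNReal.ofReal θ}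
      = ∫⁻ ω, F (X .eavesdropper ω) (config X h ω) ∂μ := by
    rw [← lintegral_indicator_one hA]
    refine lintegral_congr fun ω => ?_
    have hs : ∀ i, p.sinrAt Config.points Config.fades τ k b i (X .eavesdropper ω i) (config X h ω)
        = p.sinrAt X h τ k b i (X .eavesdropper ω i) ω := fun _ => rfl
    by_cases hω : ∀ i, p.sinrAt X h τ k b i (X .eavesdropper ω i) ω < ENNReal.ofReal θ
    · refine (indicator_of_mem (by exact hω) _).trans ?_
      simp [F, indicator, hs, not_le.2 (hω _)]
    · refine (indicator_of_notMem (by exact hω) _).trans ?_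
      push Not at hω
      obtain ⟨i, hi⟩ := hω
      symm
      simp only [F]
      rw [ENNReal.tsum_eq_top_of_eq_top ⟨i, indicator_of_mem (by exact hi) _⟩, expNeg_top]
  -- Chosen so that, for `x ≠ b`, `expNeg (g x)` is the probability that an eavesdropper at `x`
  -- fails; the Laplace functional then integrates exactly `W`.
  let g : Plane → ℝ≥0∞ := fun x => negLog (1 - W (dist b x))
  have hWd : Measurable fun x => W (dist b x) := hW.comp (by fun_prop)
  have hg : Measurable g := measurable_negLog.comp (measurable_const.sub hWd)
  have hgW : ∀ x, 1 - expNeg (g x) = W (dist b x) := fun x => by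
    rw [expNeg_negLog tsub_le_self, ENNReal.sub_sub_cancel ENNReal.one_ne_top (hW1 _)]
  -- At fixed locations the events for different `i` use blocks with different tags, so they are
  -- independent. Locations equal to `b` are excluded, as the detection formula needs a positive
  -- distance; almost surely there are none.
  have hinner : ∀ e : ℕ → Plane, (∀ i, e i ≠ b) →
      ∫⁻ ω', F e (config X h ω') ∂μ = expNeg (∑' i, g (e i)) := by
    intro e he
    let B : ℕ → Set Ω := fun i => {ω | ENNReal.ofReal θ ≤ p.sinrAt X h τ k b i (e i) ω}
    have hB : ∀ i, MeasurableSet[block (labelSigma X h) (tag ⁻¹' ({some i} ×ˢ univ))] (B i) :=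
      fun i => (measurable_block_sinrAt (X := X) (h := h) p τ k b i (e i) subset_rfl)
        measurableSet_Ici
    have hBm : ∀ i, MeasurableSet (B i) := fun i => block_le hn.labelSigma_le _ _ (hB i)
    have hT : Pairwise fun i j => Disjoint
        (tag (K := K) ⁻¹' (({some i} : Set (Option ℕ)) ×ˢ (univ : Set (Fin 4))))
        (tag ⁻¹' (({some j} : Set (Option ℕ)) ×ˢ (univ : Set (Fin 4)))) := fun i j hij =>
      disjoint_tag (by
        rw [Set.disjoint_prod]
        exact Or.inl (by simpa using hij))
    have hind : iIndepFun (fun i => (B i).indicator fun _ => (∞ : ℝ≥0∞)) μ :=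
      iIndepFun_of_block hn.labelSigma_le hn.iIndep_labelSigma hT fun i =>
        Measurable.indicator (@measurable_const _ _ _
          (block (labelSigma X h) (tag ⁻¹' ({some i} ×ˢ univ))) _) (hB i)
    refine lintegral_expNeg_tsum (ξ := fun i => (B i).indicator fun _ => (∞ : ℝ≥0∞))
      (fun i => measurable_const.indicator (hBm i)) hind fun i => ?_
    have h2 := measure_eq_lintegral_expNeg_indicator (μ := μ) (hBm i).compl
    rw [compl_compl] at h2
    rw [← h2, prob_compl_eq_one_sub (hBm i), expNeg_negLog tsub_le_self,
      hW' _ (dist_pos.2 (he i).symm), ← hn.measure_le_sinrAt hK hθ hτ k (he i).symm i]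
  have h2 : ∫⁻ x : Plane, W (dist b x)
      = ENNReal.ofReal (2 * Real.pi * ∫ r in Ioi (0 : ℝ), p.secrecyIntegrand θ τ k r) := by
    have h3 : ∫⁻ x : Plane, W (dist b x) = ∫⁻ x : Plane, W ‖x‖ := by
      simp_rw [dist_comm b, dist_eq_norm]
      exact lintegral_sub_right_eq_self (fun x : Plane => W ‖x‖) b
    rw [h3, lintegral_norm_plane hW, ← integral_const_mul, ofReal_integral_eq_lintegral_ofReal
      ((hn.integrableOn_secrecyIntegrand hK hθ hτ k).const_mul _)]
    · refine setLIntegral_congr_fun measurableSet_Ioi fun r hr => ?_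
      have hr : 0 < r := hr
      rw [hW' r hr, ← ENNReal.ofReal_mul (by positivity)]
      congr 1
      rw [secrecyIntegrand, detectProb]
      ring
    · filter_upwards [ae_restrict_mem measurableSet_Ioi] with r hr
      have hr : 0 < r := hr
      have := detectProb_nonneg p hK hθ hτ hr k
      exact mul_nonneg (by positivity) (mul_nonneg this hr.le)
  have hint : 0 ≤ ∫ r in Ioi (0 : ℝ), p.secrecyIntegrand θ τ k r :=
    setIntegral_nonneg measurableSet_Ioi fun r hr =>
      mul_nonneg (detectProb_nonneg p hK hθ hτ hr k) (le_of_lt hr)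
  have hE := p.lamE_pos
  rw [h1, hn.lintegral_eavesdropper hF hF']
  have h4 : ∫⁻ ω, ∫⁻ ω', F (X .eavesdropper ω) (config X h ω') ∂μ ∂μ
      = ∫⁻ ω, expNeg (∑' i, g (X .eavesdropper ω i)) ∂μ := by
    refine lintegral_congr_ae ?_
    filter_upwards [hn.ae_ne .eavesdropper b] with ω hω
    exact hinner _ hω
  rw [h4, (hn.hasPoissonLaplace .eavesdropper).laplace g hg]
  simp_rw [hgW]
  rw [lintegral_smul_measure, h2, smul_eq_mul, density, ← ENNReal.ofReal_mul hE.le,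
    expNeg_ofReal (by positivity)]
  congr 3
  ring

end IsNetwork

end Params

/-! ### Association of the typical user and the secrecy probability -/

namespace Params

variable {K : ℕ} {p : Params K}

/-- The squared distance to the origin, scaled such that the received power is a decreasing
function of it that does not depend on the tier. -/
def attenuation (p : Params K) (t : Fin K) (x : Plane) : ℝ≥0∞ :=
  ENNReal.ofReal (p.powB t ^ (-(2 / p.α))) * edist x 0 ^ 2

lemma measurable_attenuation (p : Params K) (t : Fin K) : Measurable (p.attenuation t) := by
  unfold attenuation; fun_prop

/-- As `P ‖x‖^{-α} = (P^{-2/α} ‖x‖^2)^{-α/2}`, comparing average powers across tiers amounts to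
comparing points of one process on the half-line. -/
lemma rxPower_eq_attenuation (p : Params K) (t : Fin K) (x : Plane) :
    p.rxPower (p.powB t) 1 x 0 = (p.attenuation t x ^ (p.α / 2))⁻¹ := by
  have hP := p.powB_pos t
  have hα := p.α_pos
  rw [← ENNReal.rpow_neg, attenuation, ENNReal.mul_rpow_of_ne_top ENNReal.ofReal_ne_top
    (ENNReal.pow_ne_top (edist_ne_top _ _)), ENNReal.ofReal_rpow_of_pos (by positivity),
    ← Real.rpow_mul hP.le, ← ENNReal.rpow_natCast, ← ENNReal.rpow_mul, rxPower, mul_one]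
  have h1 : -(2 / p.α) * -(p.α / 2) = 1 := by field_simp
  have h2 : ((2 : ℕ) : ℝ) * -(p.α / 2) = -p.α := by push_cast; ring
  rw [h1, h2, Real.rpow_one]

lemma isServing_iff {Ω : Type*} (p : Params K) {X : PointLabel K → Ω → ℕ → Plane} {ω : Ω}
    {k : Fin K} {n : ℕ} : p.IsServing X ω k n ↔ ∀ t m,
      p.attenuation k (X (.station k) ω n) ≤ p.attenuation t (X (.station t) ω m) := by
  have hα : 0 < p.α / 2 := half_pos p.α_pos
  simp only [IsServing, rxPower_eq_attenuation, ENNReal.inv_le_inv,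
    ENNReal.rpow_le_rpow_iff hα]

lemma measurableSet_isServing {Ω : Type*} [MeasurableSpace Ω] (p : Params K)
    {X : PointLabel K → Ω → ℕ → Plane} (hX : ∀ t, Measurable (X (.station t))) (k : Fin K) (n : ℕ) :
    MeasurableSet {ω | p.IsServing X ω k n} := by
  have hm : ∀ t m, Measurable fun ω => p.attenuation t (X (.station t) ω m) := fun t m =>
    (p.measurable_attenuation t).comp ((measurable_pi_apply m).comp (hX t))
  simp only [isServing_iff, ofPred_forall]
  exact MeasurableSet.iInter fun t => MeasurableSet.iInter fun m =>
    measurableSet_le (hm k n) (hm t m)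

lemma measurableSet_associated {Ω : Type*} [MeasurableSpace Ω] (p : Params K)
    {X : PointLabel K → Ω → ℕ → Plane} (hX : ∀ t, Measurable (X (.station t))) (k : Fin K) :
    MeasurableSet (p.associated X k) := by
  simp only [associated, ofPred_exists]
  exact MeasurableSet.iUnion fun n => p.measurableSet_isServing hX k n

lemma measurableSet_secrecyEvent_config (p : Params K) (θ τ : ℝ) :
    MeasurableSet (p.secrecyEvent Config.points Config.fades θ τ) := by
  have h1 : p.secrecyEvent Config.points Config.fades θ τ
      = ⋃ k, ⋃ n, ({z | p.IsServing Config.points z k n} ∩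
        ⋂ i, {z | p.sinrE Config.points Config.fades τ k n i z < ENNReal.ofReal θ}) := by
    ext z
    simp [secrecyEvent]
  rw [h1]
  refine MeasurableSet.iUnion fun k => MeasurableSet.iUnion fun n =>
    (p.measurableSet_isServing (fun t => Config.measurable_points _) k n).inter
      (MeasurableSet.iInter fun i => measurableSet_lt ?_ measurable_const)
  rw [show p.sinrE Config.points Config.fades τ k n i = _ from funext fun z =>
    sinrE_eq Config.points Config.fades p τ k n i z]
  exact IsNetwork.measurable_sinrAt_config p τ k i measurable_id
    ((measurable_pi_apply n).comp (Config.measurable_points _))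
    ((measurable_pi_apply i).comp (Config.measurable_points _))

section Merge

variable {Ω : Type*} {X : PointLabel K → Ω → ℕ → Plane} {h : FadeLabel K → Ω → ℝ}

/-- The tag `(none, 0)` marks exactly the stations of the typical user: these come from `ω`, while
the eavesdroppers and all their environments come from `ω'`. -/
lemma sinrE_merge (p : Params K) (τ : ℝ) (k : Fin K) (n i : ℕ) (ω ω' : Ω) :
    p.sinrE Config.points Config.fades τ k n i
        (Config.merge (tag ⁻¹' {(none, 0)}) (config X h ω) (config X h ω'))
      = p.sinrAt X h τ k (X (.station k) ω n) i (X .eavesdropper ω' i) ω' := by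
  have hm : ∀ a : PointLabel K, tag (.inl a) ≠ (none, 0) →
      (.inl a : Label K) ∉ (tag ⁻¹' {(none, 0)} : Set (Label K)) := fun a ha => ha
  have hm' : ∀ b : FadeLabel K, tag (.inr b) ≠ (none, 0) →
      (.inr b : Label K) ∉ (tag ⁻¹' {(none, 0)} : Set (Label K)) := fun b hb => hb
  have hs : (.inl (.station k) : Label K) ∈ (tag ⁻¹' {(none, 0)} : Set (Label K)) := rfl
  rw [sinrE_eq]
  simp only [sinrAt, intfAt, intfBAt, intfUAt, intfJAt, activeAt, IsClosestAt, fieldAt,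
    Config.points_merge_of_mem hs,
    Config.points_merge_of_notMem (hm (.intStation _ _) (by simp [tag])),
    Config.points_merge_of_notMem (hm (.intUser _ _) (by simp [tag])),
    Config.points_merge_of_notMem (hm (.hole _ _) (by simp [tag])),
    Config.points_merge_of_notMem (hm (.jammer _) (by simp [tag])),
    Config.points_merge_of_notMem (hm .eavesdropper (by simp [tag])),
    Config.fades_merge_of_notMem (hm' (.signal _) (by simp [tag])),
    Config.fades_merge_of_notMem (hm' (.station _ _ _) (by simp [tag])),
    Config.fades_merge_of_notMem (hm' (.user _ _ _) (by simp [tag])),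
    Config.fades_merge_of_notMem (hm' (.jammer _ _) (by simp [tag]))]
  rfl

lemma isServing_merge (p : Params K) (k : Fin K) (n : ℕ) (ω ω' : Ω) :
    p.IsServing Config.points
        (Config.merge (tag ⁻¹' {(none, 0)}) (config X h ω) (config X h ω')) k n
      ↔ p.IsServing X ω k n := by
  have hs : ∀ t, (.inl (.station t) : Label K) ∈ (tag ⁻¹' {(none, 0)} : Set (Label K)) :=
    fun _ => rfl
  simp only [IsServing, Config.points_merge_of_mem (hs _)]
  rfl

end Merge

namespace IsNetwork

lemma measurableSet_secrecyEvent {Ω : Type*} [MeasurableSpace Ω] {μ : Measure Ω}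
    {X : PointLabel K → Ω → ℕ → Plane} {h : FadeLabel K → Ω → ℝ} (hn : p.IsNetwork μ X h) (θ τ : ℝ) :
    MeasurableSet (p.secrecyEvent X h θ τ) :=
  hn.measurable_config (p.measurableSet_secrecyEvent_config θ τ)

variable {Ω : Type*} [MeasurableSpace Ω] {μ : Measure Ω} [IsProbabilityMeasure μ]
  {X : PointLabel K → Ω → ℕ → Plane} {h : FadeLabel K → Ω → ℝ}

lemma hasPoissonLaplace_attenuation (hn : p.IsNetwork μ X h) {κ : Type*} [Fintype κ]
    {a : κ → Fin K} (ha : Function.Injective a) :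
    HasPoissonLaplace (fun (j : κ × ℕ) ω => p.attenuation (a j.1) (X (.station (a j.1)) ω j.2))
      (∑ t, (ENNReal.ofReal (p.density (.station (a t))) • (volume : Measure Plane)).map
        (p.attenuation (a t))) μ :=
  hn.superpose (a := fun t => .station (a t)) (fun t t' htt => ha (by simpa using htt))
    fun t => p.measurable_attenuation (a t)

/-- The scaling by `P^{-2/α}` gives tier `t` the rate `π λ_t P_t^{2/α}`, the source of the weights
in `assocProb`. -/
lemma attenuation_Iio (p : Params K) {κ : Type*} [Fintype κ] (a : κ → Fin K) (r : ℝ≥0∞) :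
    (∑ t, (ENNReal.ofReal (p.density (.station (a t))) • (volume : Measure Plane)).map
        (p.attenuation (a t))) (Iio r)
      = ENNReal.ofReal (∑ t, Real.pi * (p.lamB (a t) * p.powB (a t) ^ (2 / p.α))) * r := by
  have hP := p.powB_pos
  refine (superpose_Iio p (fun t => .station (a t)) (c := fun t => p.powB (a t) ^ (-(2 / p.α)))
    (fun t => Real.rpow_pos_of_pos (hP _) _) 0 r).trans ?_
  congr 3 with t
  rw [Real.rpow_neg (hP _).le, div_inv_eq_mul, density, mul_assoc]

lemma ae_exists_min_attenuation (hn : p.IsNetwork μ X h) {κ : Type*} [Fintype κ] [Nonempty κ]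
    {a : κ → Fin K} (ha : Function.Injective a) :
    ∀ᵐ ω ∂μ, ∃ i : κ × ℕ, ∀ j : κ × ℕ, j ≠ i →
      p.attenuation (a i.1) (X (.station (a i.1)) ω i.2)
        < p.attenuation (a j.1) (X (.station (a j.1)) ω j.2) := by
  refine (hn.hasPoissonLaplace_attenuation ha).ae_exists_min ?_ ENNReal.ofReal_ne_top
    (attenuation_Iio p a)
  rw [ne_eq, ENNReal.ofReal_eq_zero, not_le]
  exact Finset.sum_pos (fun t _ => mul_pos Real.pi_pos
    (mul_pos (p.lamB_pos _) (Real.rpow_pos_of_pos (p.powB_pos _) _))) Finset.univ_nonempty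

/-- Almost surely, exactly one base station serves the typical user. -/
lemma ae_exists_isServing_iff (hn : p.IsNetwork μ X h) (hK : 0 < K) :
    ∀ᵐ ω ∂μ, ∃ k n, ∀ t m, p.IsServing X ω t m ↔ t = k ∧ m = n := by
  have : Nonempty (Fin K) := ⟨⟨0, hK⟩⟩
  filter_upwards [hn.ae_exists_min_attenuation (a := id) Function.injective_id] with ω ⟨⟨k, n⟩, hkn⟩
  refine ⟨k, n, fun t m => ?_⟩
  rw [isServing_iff]
  constructor
  · intro hs
    by_contra hne
    have := hkn (t, m) (by simpa using hne)
    exact absurd (hs k n) (not_le.2 this)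
  · rintro ⟨rfl, rfl⟩ t' m'
    by_cases hne : (t', m') = (t, m)
    · obtain ⟨rfl, rfl⟩ := Prod.ext_iff.1 hne
      exact le_rfl
    · exact (hkn (t', m') hne).le

/-- Competing exponentials: the smallest attenuation `V` in tier `k` is exponential of rate `a`, the
other tiers have no attenuation below it with conditional probability `e^{-bV}`, and averaging gives
`a / (a + b)`. -/
lemma measure_associated (hn : p.IsNetwork μ X h) (k : Fin K) :
    μ (p.associated X k) = ENNReal.ofReal (p.assocProb k) := by
  have hw : ∀ t, 0 < p.lamB t * p.powB t ^ (2 / p.α) := fun t =>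
    mul_pos (p.lamB_pos t) (Real.rpow_pos_of_pos (p.powB_pos t) _)
  have hpi := Real.pi_pos
  -- The factor `Unit` presents tier `k` as a superposition of one process, so that the general
  -- half-line lemmas apply.
  let V : (ℕ → Plane) → ℝ≥0∞ := fun x => ⨅ j : Unit × ℕ, p.attenuation k (x j.2)
  have hV : Measurable V := Measurable.iInf fun j =>
    (p.measurable_attenuation k).comp (measurable_pi_apply j.2)
  let S : Set (Config K) := {z | ∀ j : {t // t ≠ k} × ℕ,
    V (Config.points (.station k) z) ≤ p.attenuation j.1 (Config.points (.station j.1) z j.2)}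
  have hS : MeasurableSet S := by
    simp only [S, ofPred_forall]
    exact MeasurableSet.iInter fun j => measurableSet_le (hV.comp (Config.measurable_points _))
      ((p.measurable_attenuation _).comp ((measurable_pi_apply _).comp (Config.measurable_points _)))
  -- Only almost surely: a serving station exists in tier `k` only if the infimum `V` is attained.
  have h1 : p.associated X k =ᵐ[μ] config X h ⁻¹' S := by
    filter_upwards [hn.ae_exists_min_attenuation (κ := Unit) (a := fun _ => k)
      (Function.injective_of_subsingleton _)] with ω ⟨⟨u, n⟩, hmin⟩
    have hle : ∀ m, p.attenuation k (X (.station k) ω n) ≤ p.attenuation k (X (.station k) ω m) := by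
      intro m
      rcases eq_or_ne m n with rfl | hne
      · exact le_rfl
      · exact (hmin (u, m) (by simpa using hne)).le
    refine propext ⟨?_, fun hs => ⟨n, ?_⟩⟩
    · rintro ⟨m, hm⟩ j
      rw [isServing_iff] at hm
      exact (iInf_le _ ((), m)).trans (hm _ _)
    · rw [isServing_iff]
      intro t m
      rcases eq_or_ne t k with rfl | hne
      · exact hle m
      · refine (le_iInf fun j : Unit × ℕ => hle j.2).trans (hs (⟨t, hne⟩, m))
  set a := Real.pi * (p.lamB k * p.powB k ^ (2 / p.α)) with ha
  set b := ∑ t : {t // t ≠ k}, Real.pi * (p.lamB t * p.powB t ^ (2 / p.α)) with hb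
  have ha0 : 0 < a := mul_pos hpi (hw k)
  have hb0 : 0 ≤ b := Finset.sum_nonneg fun t _ => (mul_pos hpi (hw t)).le
  have h2 : ∀ ω, ∫⁻ ω', S.indicator 1
      (Config.merge {.inl (.station k)} (config X h ω) (config X h ω')) ∂μ
      = expNeg (ENNReal.ofReal b * V (X (.station k) ω)) := by
    intro ω
    let Y := fun (j : {t // t ≠ k} × ℕ) ω =>
      p.attenuation (j.1 : Fin K) (X (.station (j.1 : Fin K)) ω j.2)
    have hY := hn.hasPoissonLaplace_attenuation (κ := {t // t ≠ k}) (a := Subtype.val)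
      Subtype.val_injective
    have hvoid := hY.void (B := Iio (V (X (.station k) ω))) measurableSet_Iio
    rw [attenuation_Iio p] at hvoid
    rw [← hb] at hvoid
    rw [← hvoid]
    have hm : MeasurableSet {ω' | ∀ j, Y j ω' ∉ Iio (V (X (.station k) ω))} := by
      simp only [ofPred_forall]
      exact MeasurableSet.iInter fun j => (hY.measurable j measurableSet_Iio).compl
    refine Eq.trans ?_ (lintegral_indicator_one hm)
    refine lintegral_congr fun ω' => ?_
    refine indicator_eq_indicator ?_ rfl
    have hne : ∀ j : {t // t ≠ k}, (Sum.inl (.station (j : Fin K)) : Label K)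
        ∉ ({.inl (.station k)} : Set (Label K)) := fun j => by
      simpa using j.2
    simp only [S, mem_ofPred_eq, Config.points_merge_of_mem (mem_singleton _),
      Config.points_merge_of_notMem (hne _), mem_Iio, not_lt]
    rfl
  have h3 : μ (p.associated X k)
      = ∫⁻ ω, expNeg (ENNReal.ofReal b * V (X (.station k) ω)) ∂μ := by
    rw [measure_congr h1, ← lintegral_indicator_one (hn.measurable_config hS)]
    have h6 := hn.lintegral_resample {.inl (.station k)} (Φ := S.indicator 1)
      (measurable_one.indicator hS)
    simp_rw [h2] at h6
    exact h6
  have h4 := (hn.hasPoissonLaplace_attenuation (κ := Unit) (a := fun _ => k)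
    (Function.injective_of_subsingleton _)).lintegral_iInf (a := a) ha0
    (fun r => (attenuation_Iio p (fun _ : Unit => k) r).trans (by simp [ha]))
    (φ := fun r => expNeg (ENNReal.ofReal b * r)) (by fun_prop)
  rw [h3]
  refine h4.trans ?_
  have h5 : ∀ x ∈ Ioi (0 : ℝ), expNeg (ENNReal.ofReal b * ENNReal.ofReal x) *
      ENNReal.ofReal (a * Real.exp (-(a * x)))
      = ENNReal.ofReal a * ENNReal.ofReal (Real.exp (-((a + b) * x))) := by
    intro x hx
    have hx : 0 < x := hx
    rw [← ENNReal.ofReal_mul hb0, expNeg_ofReal (by positivity), ← ENNReal.ofReal_mul ha0.le,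
      ← ENNReal.ofReal_mul (Real.exp_pos _).le, mul_left_comm, ← Real.exp_add]
    congr 3
    ring
  rw [setLIntegral_congr_fun measurableSet_Ioi h5, lintegral_const_mul _ (by fun_prop),
    lintegral_Ioi_exp_neg_mul (by positivity), ← ENNReal.ofReal_mul ha0.le]
  congr 1
  have hab : a + b = Real.pi * ∑ t, p.lamB t * p.powB t ^ (2 / p.α) := by
    rw [Finset.mul_sum, Fintype.sum_eq_add_sum_subtype_ne _ k]
  rw [hab, assocProb, ha]
  simp only [mul_zero, neg_zero, Real.exp_zero]
  rw [mul_one_div, mul_div_mul_left _ _ hpi.ne']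

/-- With the stations frozen there is almost surely exactly one serving station, and the conditional
secrecy probability depends on it only through its tier. It is thus a simple function on the
association events. -/
lemma measure_secrecyEvent (hn : p.IsNetwork μ X h) (hK : 0 < K) {θ τ : ℝ} (hθ : 0 < θ)
    (hτ : 0 < τ) : μ (p.secrecyEvent X h θ τ) = ∑ k, ENNReal.ofReal (Real.exp
      (-(2 * Real.pi * p.lamE * ∫ r in Ioi (0 : ℝ), p.secrecyIntegrand θ τ k r))) *
        μ (p.associated X k) := by
  set C : Fin K → ℝ≥0∞ := fun k => ENNReal.ofReal (Real.exp
    (-(2 * Real.pi * p.lamE * ∫ r in Ioi (0 : ℝ), p.secrecyIntegrand θ τ k r))) with hC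
  have hS := p.measurableSet_secrecyEvent_config θ τ
  have hA := p.measurableSet_associated (X := X) fun t => hn.points_measurable _
  have h1 : μ (p.secrecyEvent X h θ τ) = ∫⁻ ω, ∫⁻ ω',
      (p.secrecyEvent Config.points Config.fades θ τ).indicator 1
        (Config.merge (tag ⁻¹' {(none, 0)}) (config X h ω) (config X h ω')) ∂μ ∂μ := by
    rw [← hn.lintegral_resample _ (measurable_one.indicator hS),
      ← lintegral_indicator_one (hn.measurableSet_secrecyEvent θ τ)]
    rfl
  have h2 : ∫⁻ ω, ∫⁻ ω', (p.secrecyEvent Config.points Config.fades θ τ).indicator 1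
        (Config.merge (tag ⁻¹' {(none, 0)}) (config X h ω) (config X h ω')) ∂μ ∂μ
      = ∫⁻ ω, ∑ k, C k * (p.associated X k).indicator 1 ω ∂μ := by
    refine lintegral_congr_ae ?_
    filter_upwards [hn.ae_exists_isServing_iff hK] with ω ⟨k, n, hkn⟩
    have h3 : ∑ t, C t * (p.associated X t).indicator 1 ω = C k := by
      rw [Finset.sum_eq_single k]
      · rw [indicator_of_mem (show ω ∈ p.associated X k from ⟨n, (hkn k n).2 ⟨rfl, rfl⟩⟩), Pi.one_apply, mul_one]
      · intro t _ htk
        rw [indicator_of_notMem, mul_zero]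
        rintro ⟨m, hm⟩
        exact htk ((hkn t m).1 hm).1
      · simp
    rw [h3]
    refine Eq.trans ?_ (hn.measure_sinrAt_lt hK hθ hτ k (X (.station k) ω n))
    have hm : MeasurableSet {ω' | ∀ i, p.sinrAt X h τ k (X (.station k) ω n) i
        (X .eavesdropper ω' i) ω' < ENNReal.ofReal θ} := by
      simp only [ofPred_forall]
      refine MeasurableSet.iInter fun i => measurableSet_lt ?_ measurable_const
      exact measurable_sinrAt_config p τ k i hn.measurable_config measurable_const
        ((measurable_pi_apply i).comp (hn.points_measurable .eavesdropper))
    refine Eq.trans ?_ (lintegral_indicator_one hm)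
    refine lintegral_congr fun ω' => indicator_eq_indicator ?_ rfl
    simp only [secrecyEvent, mem_ofPred_eq, isServing_merge, hkn, sinrE_merge]
    constructor
    · rintro ⟨_, _, ⟨rfl, rfl⟩, H⟩
      exact H
    · exact fun H => ⟨k, n, ⟨rfl, rfl⟩, H⟩
  rw [h1, h2, lintegral_finsetSum _ fun k _ => (measurable_one.indicator (hA k)).const_mul _]
  refine Finset.sum_congr rfl fun k _ => ?_
  rw [lintegral_const_mul _ (measurable_one.indicator (hA k)), lintegral_indicator_one (hA k)]

end IsNetwork

end Params

end HetNet
end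

theorem theorem2 {K : ℕ} (hK : 0 < K) (p : HetNet.Params K)
    {Ω : Type*} [MeasurableSpace Ω] (μ : Measure Ω) [IsProbabilityMeasure μ]
    (X : HetNet.PointLabel K → Ω → ℕ → HetNet.Plane) (h : HetNet.FadeLabel K → Ω → ℝ)
    (hnet : p.IsNetwork μ X h) (θ τ : ℝ) (hθ : 0 < θ) (hτ : 0 < τ) :
    (∀ k, μ.real (p.associated X k) = p.assocProb k) ∧
    (∀ i : ℕ, ∀ s : ℝ, 0 < s →
      HetNet.laplace μ (p.intfB X h i) s = p.lapB s ∧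
      HetNet.laplace μ (p.intfU X h i) s = p.lapU s ∧
      IntegrableOn (p.lapJIntegrand τ s) (Ioi 0) ∧
      HetNet.laplace μ (p.intfJ X h τ i) s = p.lapJ τ s) ∧
    (∀ k, IntegrableOn (p.secrecyIntegrand θ τ k) (Ioi 0)) ∧
    MeasurableSet (p.secrecyEvent X h θ τ) ∧
    μ.real (p.secrecyEvent X h θ τ) =
      ∑ k, p.assocProb k *
        Real.exp (-(2 * Real.pi * p.lamE * ∫ r in Ioi (0 : ℝ), p.secrecyIntegrand θ τ k r)) := by
  have hassoc : ∀ k, μ.real (p.associated X k) = p.assocProb k := fun k => by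
    have hw : ∀ t, 0 ≤ p.lamB t * p.powB t ^ (2 / p.α) := fun t =>
      mul_nonneg (p.lamB_pos t).le (Real.rpow_nonneg (p.powB_pos t).le _)
    rw [Measure.real, hnet.measure_associated k, ENNReal.toReal_ofReal]
    exact div_nonneg (hw k) (Finset.sum_nonneg fun t _ => hw t)
  refine ⟨hassoc, fun i s hs => ⟨hnet.laplace_intfB i hs, hnet.laplace_intfU i hs,
    -- The location `0` is arbitrary: the integrability statement does not depend on it.
    (hnet.laplace_intfJAt hK hτ hs i 0).1, hnet.laplace_intfJ hK hτ i hs⟩,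
    hnet.integrableOn_secrecyIntegrand hK hθ hτ, hnet.measurableSet_secrecyEvent θ τ, ?_⟩
  rw [Measure.real, hnet.measure_secrecyEvent hK hθ hτ, ENNReal.toReal_sum fun k _ =>
    ENNReal.mul_ne_top ENNReal.ofReal_ne_top (measure_ne_top μ _)]
  refine Finset.sum_congr rfl fun k _ => ?_
  rw [ENNReal.toReal_mul, ENNReal.toReal_ofReal (Real.exp_pos _).le, ← hassoc k, mul_comm]
  rfl
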